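/- **Setting.** Let $r\ge 1$ and let $D\subset\mathbb R^d$ be a closed region (a region in the torus $\mathbb T^d$ is treated through its periodic lift) whose boundary is a finite union of closed walls $\Gamma_1,\dots,\Gamma_m$. Let $\Gamma_*\subset\partial D$ be the closed set of corners (the points where walls end); near every point of $\Gamma_i\setminus\Gamma_*$ the wall $\Gamma_i$ is a $C^{r+1}$ hypersurface with $D$ on one side of it, and $n(q)$ denotes the unit inward normal. The billiard flow $b_t$ on phase points $(q,p)$ is free motion $\dot q=p$, $\dot p=0$ inside $D$, with the reflection $p_{out}=p_{in}-2\langle p_{in},n(q)\rangle n(q)$ at non-corner points of $\partial D$. A phase point $(q,p)$ is inner if $q\in \mathrm{int}\,D$; a collision is a tangency if $\langle p,n(q)\rangle=0$. For $0<\epsilon\le\epsilon_0$ let $V(\cdot;\epsilon):\mathbb R^d\to(-\infty,+\infty]$ be continuous, and $C^{r+1}$ where it is finite. Let $N(\Gamma_i)$ be open neighbourhoods of the walls and $N(\Gamma_*)$ a closed neighbourhood of the corner set, such that the sets $\tilde N_i=N(\Gamma_i)\setminus N(\Gamma_*)$ are pairwise disjoint. Assume: * **(I)** For every compact $K\subset\mathrm{int}\,D$,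 $\lim_{\epsilon\to+0}\|V(\cdot;\epsilon)|_K\|_{C^{r+1}}=0$. * **(II)** There are $C^{r+1}$ functions $Q(\cdot;\epsilon)$, $0\le\epsilon\le\epsilon_0$, on $\bigcup_i\tilde N_i$, converging to $Q(\cdot;0)$ in $C^{r+1}$ on compact subsets as $\epsilon\to+0$, constants $Q_i$, open intervals $J_i\ni 0$ and functions $W_i(\cdot;\epsilon):J_i\to(-\infty,+\infty]$, $0<\epsilon\le\epsilon_0$, continuous, and $C^{r+1}$ where finite, with $Q(q;\epsilon)-Q_i\in J_i$ for $q\in\tilde N_i$ and $0<\epsilon\le\epsilon_0$, such that: (a) $Q(\cdot;0)=Q_i$ on $\Gamma_i\cap\tilde N_i$, and near each point of $\Gamma_i\cap\tilde N_i$ the set $D$ is $\{Q(\cdot;0)\ge Q_i\}$; (b) $V(q;\epsilon)=W_i(Q(q;\epsilon)-Q_i;\epsilon)$ for $q\in\tilde N_i$, $0<\epsilon\le\epsilon_0$; (c) $\nabla Q(\cdot;\epsilon)\neq0$ on $\tilde N_i$ for $0\le\epsilon\le\epsilon_0$, and for $0<\epsilon\le\epsilon_0$ the function $W_i(\cdot;\epsilon)$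 is non-increasing with $W_i'\ne0$ where it is finite. * **(III)** For each $i$ there is $\mathcal E_i\in(0,+\infty]$ such that, as $\epsilon\to+0$, $W_i(s;\epsilon)\to0$ for every $s>0$ in $J_i$ and $W_i(s;\epsilon)\to\mathcal E_i$ for every $s<0$ in $J_i$. * **(IV)** Let $\mathcal Q_i(\cdot;\epsilon)$ be the inverse function of $W_i(\cdot;\epsilon)$. For all $0<w_1<w_2<\mathcal E_i$, as $\epsilon\to+0$, $\mathcal Q_i(\cdot;\epsilon)$ tends to $0$ uniformly on $[w_1,w_2]$ together with its first $r+1$ derivatives. Let $h^\epsilon_t$ be the Hamiltonian flow of $H(q,p)=\tfrac12|p|^2+V(q;\epsilon)$. **Theorem.** Let $T>0$ and let $\rho_0=(q_0,p_0)$ and $\rho_T=b_T\rho_0$ be inner phase points, with energy $H^*=\tfrac12|p_0|^2<\mathcal E:=\min_i\mathcal E_i$. Assume that on $[0,T]$ the billiard trajectory of $\rho_0$ has finitely many collisions, that they take place at non-corner points, outside $N(\Gamma_*)$, and that none of them is a tangency. Then $h^\epsilon_t\to b_t$ as $\epsilon\to+0$ in the $C^r$ topology near $\rho_0$ and for $t$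 near $T$: there are an open neighbourhood $U$ of $\rho_0$ in the phase space and $\delta>0$ such that on $U\times(T-\delta,T+\delta)$ the map $(\rho,t)\mapsto b_t\rho$ is defined and $C^r$, the map $(\rho,t)\mapsto h^\epsilon_t\rho$ is defined and $C^r$ for all sufficiently small $\epsilon>0$, and all partial derivatives of $h^\epsilon_t\rho$ in $(\rho,t)$ of orders $0,\dots,r$ converge uniformly on $U\times(T-\delta,T+\delta)$ to those of $b_t\rho$ as $\epsilon\to+0$. -/

import Mathlib

open Set Filter Topology

noncomputable section

namespace SoftBilliard

/-- Configuration space `ℝ^d` with its Euclidean structure. -/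
abbrev Config (d : ℕ) : Type := EuclideanSpace ℝ (Fin d)

/-- Phase space: pairs `(q, p)` of a position and a momentum. -/
abbrev Phase (d : ℕ) : Type := Config d × Config d

/-! ### The billiard -/

/-- A billiard table in `ℝ^d` whose boundary is made of walls `Γ i` of class `C^{r+1}`.  The set
`corner` contains all points where a wall ends: at every other boundary point the wall is locally
a `C^{r+1}` hypersurface with the table on one side of it.  The table is only asked to be closed;
a table in the torus is described by its periodic lift. -/
structure BilliardTable (d r : ℕ) (ι : Type*) where
  /-- the closed region `D` in which the particle moves -/
  domain : Set (Config d)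
  /-- the walls `Γ i` -/
  wall : ι → Set (Config d)
  /-- the corner set `Γ*` -/
  corner : Set (Config d)
  isClosed_domain : IsClosed domain
  isClosed_wall : ∀ i, IsClosed (wall i)
  isClosed_corner : IsClosed corner
  frontier_domain : frontier domain = ⋃ i, wall i
  corner_subset : corner ⊆ ⋃ i, wall i
  smooth_wall : ∀ i, ∀ q ∈ wall i, q ∉ corner →
    ∃ f : Config d → ℝ, ContDiffAt ℝ (r + 1) f q ∧ f q = 0 ∧ gradient f q ≠ 0 ∧
      ∀ᶠ x in 𝓝 q, (x ∈ wall i ↔ f x = 0) ∧ (x ∈ domain ↔ 0 ≤ f x)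

/-- `n` is the unit inward normal to the boundary of `D` at the point `q`: near `q` the set `D` is
`{f ≥ f q}` for a `C^1` function `f` without critical point at `q`, and `n = ∇f / |∇f|` there. -/
def IsInwardNormal {d : ℕ} (D : Set (Config d)) (q n : Config d) : Prop :=
  ∃ f : Config d → ℝ, ContDiffAt ℝ 1 f q ∧ gradient f q ≠ 0 ∧
    (∀ᶠ x in 𝓝 q, x ∈ D ↔ f q ≤ f x) ∧ n = ‖gradient f q‖⁻¹ • gradient f q

/-- The elastic reflection law `p_out = p_in - 2 ⟨p_in, n⟩ n`. -/
def reflect {d : ℕ} (n p : Config d) : Config d := p - (2 * inner ℝ p n) • n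

namespace BilliardTable

variable {d r : ℕ} {ι : Type*}

/-- `γ = (q, p)` is a billiard trajectory on `[0, T]` with finitely many collisions, none of them
at a corner.  At a collision time `p` takes its outgoing value. -/
structure IsTrajectory (B : BilliardTable d r ι) (T : ℝ) (γ : ℝ → Phase d) : Prop where
  mem_domain : ∀ t ∈ Icc 0 T, (γ t).1 ∈ B.domain
  continuousOn : ContinuousOn (fun t => (γ t).1) (Icc 0 T)
  finite_collisions : {t | t ∈ Icc 0 T ∧ (γ t).1 ∈ frontier B.domain}.Finite
  free : ∀ s t, 0 ≤ s → s ≤ t → t ≤ T → (∀ u ∈ Ioc s t, (γ u).1 ∉ frontier B.domain) →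
    (γ t).2 = (γ s).2 ∧ (γ t).1 = (γ s).1 + (t - s) • (γ s).2
  collision : ∀ t ∈ Ioc 0 T, (γ t).1 ∈ frontier B.domain →
    (γ t).1 ∉ B.corner ∧
    ∃ n p_in : Config d, IsInwardNormal B.domain (γ t).1 n ∧
      Tendsto (fun s => (γ s).2) (𝓝[<] t) (𝓝 p_in) ∧ (γ t).2 = reflect n p_in

/-- The trajectory `γ` is tangent to the boundary at time `t`: it is at a boundary point and its
momentum is orthogonal to the normal (equivalently for the incoming and the outgoing momentum). -/
def IsTangency (B : BilliardTable d r ι) (γ : ℝ → Phase d) (t : ℝ) : Prop :=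
  (γ t).1 ∈ frontier B.domain ∧
    ∃ n : Config d, IsInwardNormal B.domain (γ t).1 n ∧ inner ℝ (γ t).2 n = 0

/-- `ρ` has a billiard trajectory on `[0, t]`. -/
def FlowDefined (B : BilliardTable d r ι) (t : ℝ) (ρ : Phase d) : Prop :=
  ∃ γ : ℝ → Phase d, B.IsTrajectory t γ ∧ γ 0 = ρ

open Classical in
/-- The billiard flow `b_t ρ`: the state at time `t` of the billiard trajectory of `ρ`
(and `ρ` itself, a junk value, where there is no such trajectory). -/
def flow (B : BilliardTable d r ι) (t : ℝ) (ρ : Phase d) : Phase d :=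
  if h : B.FlowDefined t ρ then h.choose t else ρ

end BilliardTable

/-! ### The Hamiltonian flow -/

/-- The Hamiltonian `H(q, p) = p^2 / 2 + V(q)`, meaningful where `V` is finite.  Potentials may
take the value `+∞`, which allows for walls such as `ε / Q`. -/
def hamiltonian {d : ℕ} (V : Config d → EReal) (q p : Config d) : ℝ :=
  ‖p‖ ^ 2 / 2 + (V q).toReal

/-- `γ = (q, p)` solves `q' = ∂H/∂p`, `p' = -∂H/∂q` on `[0, t]`, in the region where `V` is
finite. -/
def IsHamiltonianSolution {d : ℕ} (V : Config d → EReal) (t : ℝ) (γ : ℝ → Phase d) : Prop :=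
  ∀ s ∈ Icc 0 t, V (γ s).1 ≠ ⊤ ∧
    HasDerivWithinAt (fun u => (γ u).1)
      (gradient (fun p => hamiltonian V (γ s).1 p) (γ s).2) (Icc 0 t) s ∧
    HasDerivWithinAt (fun u => (γ u).2)
      (-gradient (fun q => hamiltonian V q (γ s).2) (γ s).1) (Icc 0 t) s

/-- The Hamiltonian trajectory of `ρ` exists on `[0, t]`. -/
def HamiltonianFlowDefined {d : ℕ} (V : Config d → EReal) (t : ℝ) (ρ : Phase d) : Prop :=
  ∃ γ : ℝ → Phase d, IsHamiltonianSolution V t γ ∧ γ 0 = ρ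

open Classical in
/-- The Hamiltonian flow `h_t ρ`: the state at time `t` of the solution that starts at `ρ`
(and `ρ` itself, a junk value, where the solution does not exist up to time `t`). -/
def hamiltonianFlow {d : ℕ} (V : Config d → EReal) (t : ℝ) (ρ : Phase d) : Phase d :=
  if h : HamiltonianFlowDefined V t ρ then h.choose t else ρ

/-! ### Billiard-like potentials -/

/-- The objects that describe a billiard-like family of potentials `V(q; ε)`, `0 < ε ≤ ε₀`:
the pattern function `Q(q; ε)` (also for `ε = 0`) near the walls and the barrier functions
`W i (s; ε)` of the variable `s = Q - Q_i` in an interval `J i` around `0`. -/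
structure PotentialData {d r : ℕ} {ι : Type*} (B : BilliardTable d r ι) where
  ε₀ : ℝ
  ε₀_pos : 0 < ε₀
  /-- the potential, `V ε q = V(q; ε)` -/
  V : ℝ → Config d → EReal
  continuous_V : ∀ ε ∈ Ioc 0 ε₀, Continuous (V ε)
  V_ne_bot : ∀ ε ∈ Ioc 0 ε₀, ∀ q, V ε q ≠ ⊥
  contDiffOn_V : ∀ ε ∈ Ioc 0 ε₀, ContDiffOn ℝ (r + 1) (fun q => (V ε q).toReal) {q | V ε q ≠ ⊤}
  /-- an open neighbourhood of each wall -/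
  nhd : ι → Set (Config d)
  isOpen_nhd : ∀ i, IsOpen (nhd i)
  wall_subset : ∀ i, B.wall i ⊆ nhd i
  /-- a closed neighbourhood `N(Γ*)` of the corner set -/
  cornerNhd : Set (Config d)
  isClosed_cornerNhd : IsClosed cornerNhd
  corner_subset : B.corner ⊆ interior cornerNhd
  disjoint_strips : Pairwise fun i j => Disjoint (nhd i \ cornerNhd) (nhd j \ cornerNhd)
  /-- the pattern function, `Q ε q = Q(q; ε)` -/
  Q : ℝ → Config d → ℝ
  /-- the value `Q_i` of the pattern function on the wall `Γ i` -/
  level : ι → ℝ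
  contDiffOn_Q : ∀ ε ∈ Icc 0 ε₀, ∀ i, ContDiffOn ℝ (r + 1) (Q ε) (nhd i \ cornerNhd)
  tendsto_Q : ∀ i, ∀ K ⊆ nhd i \ cornerNhd, IsCompact K → ∀ k ≤ r + 1,
    TendstoUniformlyOn (fun ε => iteratedFDeriv ℝ k (Q ε)) (iteratedFDeriv ℝ k (Q 0)) (𝓝[>] 0) K
  /-- the interval in which `Q - Q_i` varies near the wall `Γ i` -/
  J : ι → Set ℝ
  isOpen_J : ∀ i, IsOpen (J i)
  ordConnected_J : ∀ i, (J i).OrdConnected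
  zero_mem_J : ∀ i, 0 ∈ J i
  mapsTo_J : ∀ ε ∈ Ioc 0 ε₀, ∀ i, ∀ q ∈ nhd i \ cornerNhd, Q ε q - level i ∈ J i
  /-- the barrier function, `W i ε s = W_i(s; ε)` -/
  W : ι → ℝ → ℝ → EReal
  continuousOn_W : ∀ i, ∀ ε ∈ Ioc 0 ε₀, ContinuousOn (W i ε) (J i)
  W_ne_bot : ∀ i, ∀ ε ∈ Ioc 0 ε₀, ∀ s ∈ J i, W i ε s ≠ ⊥
  contDiffOn_W : ∀ i, ∀ ε ∈ Ioc 0 ε₀,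
    ContDiffOn ℝ (r + 1) (fun s => (W i ε s).toReal) {s | s ∈ J i ∧ W i ε s ≠ ⊤}
  /-- the height `E_i ∈ (0, +∞]` of the barrier at the wall `Γ i` -/
  height : ι → EReal
  height_pos : ∀ i, 0 < height i

namespace PotentialData

variable {d r : ℕ} {ι : Type*} {B : BilliardTable d r ι}

/-- The part of the neighbourhood of the wall `Γ i` outside the neighbourhood of the corners. -/
def strip (P : PotentialData B) (i : ι) : Set (Config d) := P.nhd i \ P.cornerNhd

/-- The inverse `𝒬_i(w; ε)` of the barrier function `s ↦ W_i(s; ε)`. -/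
def barrierInv (P : PotentialData B) (i : ι) (ε w : ℝ) : ℝ :=
  Function.invFunOn (P.W i ε) (P.J i) (w : EReal)

/-- Condition I: on compact subsets of the interior of the table the potential tends to zero in
the `C^{r+1}` norm. -/
def ConditionI (P : PotentialData B) : Prop :=
  ∀ K ⊆ interior B.domain, IsCompact K →
    (∀ᶠ ε in 𝓝[>] (0 : ℝ), ∀ q ∈ K, P.V ε q ≠ ⊤) ∧
    ∀ k ≤ r + 1,
      TendstoUniformlyOn (fun ε => iteratedFDeriv ℝ k (fun q => (P.V ε q).toReal))
        (fun _ => 0) (𝓝[>] 0) K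

/-- Condition II a: the walls are level surfaces of `Q(·; 0)`, with the convention that `Q`
increases from the wall into the table. -/
def ConditionIIa (P : PotentialData B) : Prop :=
  ∀ i, (∀ q ∈ B.wall i ∩ P.strip i, P.Q 0 q = P.level i) ∧
    ∀ q ∈ B.wall i ∩ P.strip i, ∀ᶠ x in 𝓝 q, (x ∈ B.domain ↔ P.level i ≤ P.Q 0 x)

/-- Condition II b: near the walls the potential is a function of the pattern function. -/
def ConditionIIb (P : PotentialData B) : Prop :=
  ∀ ε ∈ Ioc 0 P.ε₀, ∀ i, ∀ q ∈ P.strip i, P.V ε q = P.W i ε (P.Q ε q - P.level i)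

/-- Condition II c: the gradient of the pattern function and the derivative of the barrier function
do not vanish, and the barrier function is non-increasing in `Q` (so that it is finite on an
interval). -/
def ConditionIIc (P : PotentialData B) : Prop :=
  (∀ ε ∈ Icc 0 P.ε₀, ∀ i, ∀ q ∈ P.strip i, gradient (P.Q ε) q ≠ 0) ∧
  ∀ ε ∈ Ioc 0 P.ε₀, ∀ i, AntitoneOn (P.W i ε) (P.J i) ∧
    ∀ s ∈ P.J i, P.W i ε s ≠ ⊤ → deriv (fun u => (P.W i ε u).toReal) s ≠ 0

/-- Condition III: in the limit the barrier function jumps from `0` to `E_i` across the wall. -/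
def ConditionIII (P : PotentialData B) : Prop :=
  ∀ i, ∀ s ∈ P.J i,
    (0 < s → Tendsto (fun ε => P.W i ε s) (𝓝[>] 0) (𝓝 0)) ∧
    (s < 0 → Tendsto (fun ε => P.W i ε s) (𝓝[>] 0) (𝓝 (P.height i)))

/-- Condition IV: the inverse of the barrier function tends to zero with its first `r + 1`
derivatives, uniformly on every interval `[w₁, w₂]` with `0 < w₁ < w₂ < E_i`. -/
def ConditionIV (P : PotentialData B) : Prop :=
  ∀ i, ∀ w₁ w₂ : ℝ, 0 < w₁ → w₁ < w₂ → (w₂ : EReal) < P.height i → ∀ k ≤ r + 1,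
    TendstoUniformlyOn (fun ε => iteratedDeriv k (P.barrierInv i ε)) (fun _ => 0)
      (𝓝[>] 0) (Icc w₁ w₂)

end PotentialData

end SoftBilliard

end

open SoftBilliard

/-!
The flows `h^ε` and the billiard flow are the members `e = ε` and `e = 0` of one family indexed by
`e : ℝ≥0`, and the assertion is that this family is continuous at `e = 0` in the `C^r` topology.
`CkConv n f x` is this notion of convergence for a family of maps `f e` near a point `x`, jointly in
the parameter and the point. It is stable under composition, under solving equations
(`exists_implicit_of_ckConv`) and under solving differential equations (`exists_flow`, an
implicit function argument in the space of curves). In `exists_flow` the right hand side may contain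
time dependent scalar weights that converge only in `L^1`, which is what a potential wall that
becomes infinitely steep requires.

Inside the table the theorem is smooth dependence on parameters, as the potential tends to `0` in
`C^{r+1}` (`exists_freeFlight`). A collision is cut into three parts by the level surfaces of the
pattern function, and each part is given a new independent variable in which the equations of motion
converge.

* While the potential is smaller than a threshold `ν e → 0` the motion is parametrized by the
  value `y` of the pattern function (`exists_crossing`). The force enters with the weight `W'(y)`,
  which need not be bounded but has constant sign and a small integral, namely the increment of `W`; the
  limit is free motion.
* While the potential is larger than `ν e`, its value `w` is used as a state variable and the motion
  is parametrized so that `p' = σ ∇Q` (`exists_reflection`). Only the derivative of the inverse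
  barrier function enters the equations, and it tends to zero by condition IV. In the limit the
  position is frozen and the momentum moves along the normal; as `w` must return to its initial
  value the energy is conserved, which gives the elastic reflection. Tangency is excluded so that
  the implicit function theorem applies to the return condition.
* Condition IV says nothing about the inverse barrier function near `w = 0`. The thresholds `ν e`
  are obtained by a diagonal argument (`exists_barrierInverse`), together with a cut off that makes
  the derivatives of the inverse barrier functions small on a fixed interval around `0`.

The composition of the parts is the collision map (`exists_collisionMap`), and the trajectory is
followed by induction on the number of collisions (`reaches_of_isTrajectory`). Uniqueness of
Hamiltonian and of billiard trajectories identifies the maps so constructed with the flows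
(`HamStep.flow_eq`, `BilliardStep.flow_eq`); for the latter, the inward normal is unique
(`IsInwardNormal.unique`). Convergence at each point of a closed ball is uniform by compactness.
-/


open scoped NNReal

noncomputable section

namespace SoftBilliard

/-! ### Families converging in `C^n` -/

section Families

variable {E F G : Type} [NormedAddCommGroup E] [NormedSpace ℝ E] [NormedAddCommGroup F]
  [NormedSpace ℝ F] [NormedAddCommGroup G] [NormedSpace ℝ G]

/-- A family of maps `f e`, indexed by `e ≥ 0`, converges to `f 0` at the point `x` together with
its derivatives up to order `n`, jointly in the parameter and the point: this is continuity at
`(0, x)` of `(e, y) ↦ D^k (f e) y`. The members of the family are asked to be `C^n` at the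
points near `x`, but nothing is required of the dependence on `e` away from `e = 0`. -/
def CkConvAt (n : ℕ) (f : ℝ≥0 → E → F) (x : E) : Prop :=
  (∀ᶠ p in 𝓝 ((0 : ℝ≥0), x), ContDiffAt ℝ n (f p.1) p.2) ∧
  ∀ k ≤ n, Tendsto (fun p : ℝ≥0 × E => iteratedFDeriv ℝ k (f p.1) p.2) (𝓝 (0, x))
    (𝓝 (iteratedFDeriv ℝ k (f 0) x))

/-- `CkConvAt` at all points near `x`; in finite dimension this is `C^n` convergence, uniform on a
neighbourhood of `x`. -/
def CkConv (n : ℕ) (f : ℝ≥0 → E → F) (x : E) : Prop := ∀ᶠ y in 𝓝 x, CkConvAt n f y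

theorem eventually_eventually_snd {X : Type*} [TopologicalSpace X] {P : ℝ≥0 × X → Prop} {x : X}
    (h : ∀ᶠ p in 𝓝 ((0 : ℝ≥0), x), P p) :
    ∀ᶠ p in 𝓝 ((0 : ℝ≥0), x), ∀ᶠ y in 𝓝 p.2, P (p.1, y) := by
  filter_upwards [h.eventually_nhds] with p hp
  exact (Eventually.curry_nhds (p := P) hp).self_of_nhds

theorem eventually_zero_mem {X : Type*} [TopologicalSpace X] {P : ℝ≥0 × X → Prop} {x : X}
    (h : ∀ᶠ p in 𝓝 ((0 : ℝ≥0), x), P p) : ∀ᶠ y in 𝓝 x, P (0, y) :=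
  (Eventually.curry_nhds (p := P) h).self_of_nhds

theorem CkConvAt.mono {m n : ℕ} {f : ℝ≥0 → E → F} {x : E} (h : CkConvAt n f x) (hm : m ≤ n) :
    CkConvAt m f x :=
  ⟨h.1.mono fun _ hp => hp.of_le (by exact_mod_cast hm), fun k hk => h.2 k (hk.trans hm)⟩

theorem CkConv.mono {m n : ℕ} {f : ℝ≥0 → E → F} {x : E} (h : CkConv n f x) (hm : m ≤ n) :
    CkConv m f x := Eventually.mono h fun _ hy => hy.mono hm

theorem CkConv.at {n : ℕ} {f : ℝ≥0 → E → F} {x : E} (h : CkConv n f x) : CkConvAt n f x :=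
  h.self_of_nhds

theorem CkConvAt.tendsto {n : ℕ} {f : ℝ≥0 → E → F} {x : E} (h : CkConvAt n f x) :
    Tendsto (fun p : ℝ≥0 × E => f p.1 p.2) (𝓝 (0, x)) (𝓝 (f 0 x)) := by
  have := h.2 0 (Nat.zero_le _)
  simp only [iteratedFDeriv_zero_eq_comp, Function.comp_apply] at this
  have h2 := ((continuousMultilinearCurryFin0 ℝ E F).continuous.tendsto _).comp this
  simpa [Function.comp_def] using h2

theorem CkConvAt.continuousAt {n : ℕ} {f : ℝ≥0 → E → F} {x : E} (h : CkConvAt n f x) :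
    ContinuousAt (f 0) x :=
  (h.tendsto.comp (Continuous.tendsto (by fun_prop : Continuous fun y : E => ((0 : ℝ≥0), y)) x) :)

/-- A family that coincides with `f` near `(0, x)` converges like `f`. -/
theorem CkConvAt.congr {n : ℕ} {f g : ℝ≥0 → E → F} {x : E} (h : CkConvAt n f x)
    (hfg : ∀ᶠ p in 𝓝 ((0 : ℝ≥0), x), g p.1 p.2 = f p.1 p.2) : CkConvAt n g x := by
  have h1 : ∀ᶠ p in 𝓝 ((0 : ℝ≥0), x), g p.1 =ᶠ[𝓝 p.2] f p.1 := eventually_eventually_snd hfg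
  refine ⟨?_, fun k hk => ?_⟩
  · filter_upwards [h1, h.1] with p hp hp2 using hp2.congr_of_eventuallyEq hp
  · have h0 : g 0 =ᶠ[𝓝 x] f 0 := h1.self_of_nhds
    rw [(h0.iteratedFDeriv ℝ k).eq_of_nhds]
    refine (h.2 k hk).congr' ?_
    filter_upwards [h1] with p hp using (hp.iteratedFDeriv ℝ k).eq_of_nhds.symm

/-- A parameter-independent family converges wherever it is smooth. -/
theorem ContDiffAt.ckConvAt {n : ℕ} {f : E → F} {x : E} (h : ContDiffAt ℝ n f x) :
    CkConvAt n (fun _ => f) x := by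
  refine ⟨?_, fun k hk => ?_⟩
  · exact (continuous_snd.tendsto ((0 : ℝ≥0), x)).eventually (h.eventually (by simp))
  · exact ((h.continuousAt_iteratedFDeriv (by exact_mod_cast hk)).tendsto.comp
      (continuous_snd.tendsto ((0 : ℝ≥0), x)) :)

theorem ContDiffAt.ckConv {n : ℕ} {f : E → F} {x : E} (h : ContDiffAt ℝ n f x) :
    CkConv n (fun _ => f) x :=
  (h.eventually (by simp)).mono fun _ hy => ContDiffAt.ckConvAt hy

/-- A family of constants. -/
theorem ckConv_const {n : ℕ} {c : ℝ≥0 → F} (h : Tendsto c (𝓝 0) (𝓝 (c 0))) (x : E) :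
    CkConv n (fun e (_ : E) => c e) x := by
  refine Eventually.of_forall fun y => ⟨Eventually.of_forall fun _ => contDiffAt_const, ?_⟩
  rintro (_ | k) -
  · simp only [iteratedFDeriv_zero_eq_comp, Function.comp_def]
    exact ((continuousMultilinearCurryFin0 ℝ E F).symm.continuous.tendsto _).comp
      (h.comp (continuous_fst.tendsto ((0 : ℝ≥0), y)))
  · simp only [iteratedFDeriv_succ_const, Pi.zero_apply]
    exact tendsto_const_nhds

theorem ckConvAt_zero_iff {f : ℝ≥0 → E → F} {x : E} :
    CkConvAt 0 f x ↔ (∀ᶠ p in 𝓝 ((0 : ℝ≥0), x), ContDiffAt ℝ 0 (f p.1) p.2) ∧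
      Tendsto (fun p : ℝ≥0 × E => f p.1 p.2) (𝓝 (0, x)) (𝓝 (f 0 x)) := by
  refine ⟨fun h => ⟨by simpa using h.1, h.tendsto⟩, fun h => ⟨by simpa using h.1, ?_⟩⟩
  rintro k hk
  obtain rfl : k = 0 := by omega
  simp only [iteratedFDeriv_zero_eq_comp, Function.comp_def]
  exact ((continuousMultilinearCurryFin0 ℝ E F).symm.continuous.tendsto _).comp h.2

theorem CkConvAt.fderiv {n : ℕ} {f : ℝ≥0 → E → F} {x : E} (h : CkConvAt (n + 1) f x) :
    CkConvAt n (fun e => fderiv ℝ (f e)) x := by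
  refine ⟨h.1.mono fun p hp => hp.fderiv_right (by norm_cast), fun k hk => ?_⟩
  have := h.2 (k + 1) (by omega)
  simp only [iteratedFDeriv_succ_eq_comp_right, Function.comp_apply] at this
  have h2 := ((continuousMultilinearCurryRightEquiv' ℝ k E F).continuous.tendsto _).comp this
  simpa only [Function.comp_def, LinearIsometryEquiv.apply_symm_apply] using h2

theorem CkConv.fderiv {n : ℕ} {f : ℝ≥0 → E → F} {x : E} (h : CkConv (n + 1) f x) :
    CkConv n (fun e => fderiv ℝ (f e)) x := Eventually.mono h fun _ hy => hy.fderiv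

/-- The recursive description of `CkConvAt`, which all inductive proofs below rest on. -/
theorem CkConvAt.succ {n : ℕ} {f : ℝ≥0 → E → F} {x : E}
    (h0 : Tendsto (fun p : ℝ≥0 × E => f p.1 p.2) (𝓝 (0, x)) (𝓝 (f 0 x)))
    (hd : ∀ᶠ p in 𝓝 ((0 : ℝ≥0), x), DifferentiableAt ℝ (f p.1) p.2)
    (h : CkConvAt n (fun e => _root_.fderiv ℝ (f e)) x) : CkConvAt (n + 1) f x := by
  refine ⟨?_, ?_⟩
  · filter_upwards [eventually_eventually_snd hd, h.1] with p hp hp1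
    push_cast
    rw [contDiffAt_succ_iff_hasFDerivAt]
    refine ⟨_root_.fderiv ℝ (f p.1), ⟨_, hp, fun y hy => ?_⟩, hp1⟩
    exact DifferentiableAt.hasFDerivAt hy
  · rintro (_ | k) hk
    · simp only [iteratedFDeriv_zero_eq_comp, Function.comp_def]
      exact ((continuousMultilinearCurryFin0 ℝ E F).symm.continuous.tendsto _).comp h0
    · simp only [iteratedFDeriv_succ_eq_comp_right, Function.comp_apply]
      exact ((continuousMultilinearCurryRightEquiv' ℝ k E F).symm.continuous.tendsto _).comp
        (h.2 k (by omega))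

theorem CkConvAt.differentiableAt {n : ℕ} {f : ℝ≥0 → E → F} {x : E}
    (h : CkConvAt (n + 1) f x) : ∀ᶠ p in 𝓝 ((0 : ℝ≥0), x), DifferentiableAt ℝ (f p.1) p.2 :=
  h.1.mono fun _ hp => hp.differentiableAt (by simp)

theorem CkConvAt.clm {n : ℕ} (L : F →L[ℝ] G) {f : ℝ≥0 → E → F} {x : E} (h : CkConvAt n f x) :
    CkConvAt n (fun e y => L (f e y)) x := by
  induction n generalizing F G with
  | zero =>
    rw [ckConvAt_zero_iff] at h ⊢
    exact ⟨h.1.mono fun p hp => L.contDiff.contDiffAt.comp p.2 hp,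
      (L.continuous.tendsto _).comp h.2⟩
  | succ n ih =>
    refine CkConvAt.succ ((L.continuous.tendsto _).comp h.tendsto)
      (h.differentiableAt.mono fun p hp => L.differentiableAt.comp p.2 hp) ?_
    refine (ih (ContinuousLinearMap.compL ℝ E F G L) h.fderiv).congr ?_
    filter_upwards [h.differentiableAt] with p hp
    exact (L.hasFDerivAt.comp p.2 hp.hasFDerivAt).fderiv

theorem CkConvAt.prodMk {n : ℕ} {f : ℝ≥0 → E → F} {g : ℝ≥0 → E → G} {x : E}
    (hf : CkConvAt n f x) (hg : CkConvAt n g x) :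
    CkConvAt n (fun e y => (f e y, g e y)) x := by
  induction n generalizing F G with
  | zero =>
    rw [ckConvAt_zero_iff] at hf hg ⊢
    exact ⟨(hf.1.and hg.1).mono fun p hp => hp.1.prodMk hp.2, hf.2.prodMk_nhds hg.2⟩
  | succ n ih =>
    refine CkConvAt.succ (hf.tendsto.prodMk_nhds hg.tendsto)
      ((hf.differentiableAt.and hg.differentiableAt).mono fun p hp => hp.1.prodMk hp.2) ?_
    refine ((ih hf.fderiv hg.fderiv).clm
      (ContinuousLinearMap.prodL ℝ (E := E) (F := F) (G := G)).toContinuousLinearMap).congr ?_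
    filter_upwards [hf.differentiableAt, hg.differentiableAt] with p hp hp2
    exact (hp.hasFDerivAt.prodMk hp2.hasFDerivAt).fderiv

theorem tendsto_prodMk_fst {X Y : Type*} [TopologicalSpace X] [TopologicalSpace Y]
    {f : ℝ≥0 → X → Y} {x : X}
    (h : Tendsto (fun p : ℝ≥0 × X => f p.1 p.2) (𝓝 (0, x)) (𝓝 (f 0 x))) :
    Tendsto (fun p : ℝ≥0 × X => (p.1, f p.1 p.2)) (𝓝 (0, x)) (𝓝 (0, f 0 x)) :=
  (continuous_fst.tendsto ((0 : ℝ≥0), x)).prodMk_nhds h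

theorem CkConvAt.comp {n : ℕ} {g : ℝ≥0 → F → G} {f : ℝ≥0 → E → F} {x : E}
    (hg : CkConvAt n g (f 0 x)) (hf : CkConvAt n f x) :
    CkConvAt n (fun e y => g e (f e y)) x := by
  induction n generalizing E F G with
  | zero =>
    have ht := tendsto_prodMk_fst hf.tendsto
    rw [ckConvAt_zero_iff] at hf hg ⊢
    refine ⟨?_, (hg.2.comp ht :)⟩
    filter_upwards [ht.eventually hg.1, hf.1] with p hp hp1 using hp.comp p.2 hp1
  | succ n ih =>
    have ht := tendsto_prodMk_fst hf.tendsto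
    have hgd := ht.eventually hg.differentiableAt
    refine CkConvAt.succ (hg.tendsto.comp ht) ?_ ?_
    · filter_upwards [hgd, hf.differentiableAt] with p hp hp1 using hp.comp p.2 hp1
    · have h1 := (ih hg.fderiv (hf.mono n.le_succ)).prodMk hf.fderiv
      have h2 : ContDiff ℝ n (fun q : (F →L[ℝ] G) × (E →L[ℝ] F) => q.1.comp q.2) :=
        contDiff_fst.clm_comp contDiff_snd
      refine (ih (ContDiffAt.ckConvAt (h2.contDiffAt (x := _))) h1).congr ?_
      filter_upwards [hgd, hf.differentiableAt] with p hp hp1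
      exact (hp.hasFDerivAt.comp p.2 hp1.hasFDerivAt).fderiv

theorem CkConv.comp {n : ℕ} {g : ℝ≥0 → F → G} {f : ℝ≥0 → E → F} {x : E}
    (hg : CkConv n g (f 0 x)) (hf : CkConv n f x) :
    CkConv n (fun e y => g e (f e y)) x := by
  filter_upwards [hf.at.continuousAt.eventually hg, hf] with y h1 h2 using h1.comp h2

theorem CkConv.comp_of_eq {n : ℕ} {g : ℝ≥0 → F → G} {f : ℝ≥0 → E → F} {x : E} {y : F}
    (hg : CkConv n g y) (hf : CkConv n f x) (h : f 0 x = y) :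
    CkConv n (fun e y => g e (f e y)) x := by
  subst h; exact hg.comp hf

theorem CkConv.prodMk {n : ℕ} {f : ℝ≥0 → E → F} {g : ℝ≥0 → E → G} {x : E}
    (hf : CkConv n f x) (hg : CkConv n g x) :
    CkConv n (fun e y => (f e y, g e y)) x := by
  filter_upwards [hf, hg] with y h1 h2 using h1.prodMk h2

/-- Composition with a smooth map that does not depend on the parameter. -/
theorem CkConv.contDiff_comp {n : ℕ} {g : F → G} {f : ℝ≥0 → E → F} {x : E}
    (hg : ContDiffAt ℝ n g (f 0 x)) (hf : CkConv n f x) :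
    CkConv n (fun e y => g (f e y)) x :=
  (ContDiffAt.ckConv hg).comp hf

theorem CkConv.comp_contDiff {n : ℕ} {g : ℝ≥0 → F → G} {f : E → F} {x : E}
    (hg : CkConv n g (f x)) (hf : ContDiffAt ℝ n f x) :
    CkConv n (fun e y => g e (f y)) x :=
  CkConv.comp (f := fun _ => f) hg (ContDiffAt.ckConv hf)

theorem CkConv.sub {n : ℕ} {f g : ℝ≥0 → E → F} {x : E}
    (hf : CkConv n f x) (hg : CkConv n g x) : CkConv n (fun e y => f e y - g e y) x :=
  (hf.prodMk hg).contDiff_comp (g := fun q : F × F => q.1 - q.2)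
    (contDiff_fst.sub contDiff_snd).contDiffAt

theorem CkConv.neg {n : ℕ} {f : ℝ≥0 → E → F} {x : E}
    (hf : CkConv n f x) : CkConv n (fun e y => -f e y) x :=
  hf.contDiff_comp (g := fun q : F => -q) contDiff_neg.contDiffAt

theorem CkConv.smul {n : ℕ} {a : ℝ≥0 → E → ℝ} {f : ℝ≥0 → E → F} {x : E}
    (ha : CkConv n a x) (hf : CkConv n f x) : CkConv n (fun e y => a e y • f e y) x :=
  (ha.prodMk hf).contDiff_comp (g := fun q : ℝ × F => q.1 • q.2)
    (contDiff_fst.smul contDiff_snd).contDiffAt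

theorem CkConv.fst {n : ℕ} {f : ℝ≥0 → E → F × G} {x : E}
    (hf : CkConv n f x) : CkConv n (fun e y => (f e y).1) x :=
  hf.contDiff_comp (g := Prod.fst) contDiff_fst.contDiffAt

theorem CkConv.snd {n : ℕ} {f : ℝ≥0 → E → F × G} {x : E}
    (hf : CkConv n f x) : CkConv n (fun e y => (f e y).2) x :=
  hf.contDiff_comp (g := Prod.snd) contDiff_snd.contDiffAt

theorem CkConv.inv {n : ℕ} {a : ℝ≥0 → E → ℝ} {x : E}
    (ha : CkConv n a x) (h : a 0 x ≠ 0) : CkConv n (fun e y => (a e y)⁻¹) x :=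
  ha.contDiff_comp (g := fun q : ℝ => q⁻¹) (contDiffAt_inv ℝ h)

theorem CkConv.inner {n : ℕ} {H : Type} [NormedAddCommGroup H] [InnerProductSpace ℝ H]
    {f g : ℝ≥0 → E → H} {x : E} (hf : CkConv n f x) (hg : CkConv n g x) :
    CkConv n (fun e y => Inner.inner ℝ (f e y) (g e y)) x :=
  (hf.prodMk hg).contDiff_comp (g := fun q : H × H => Inner.inner ℝ q.1 q.2)
    (contDiff_inner.contDiffAt)

theorem ckConv_id {n : ℕ} (x : E) : CkConv n (fun _ (y : E) => y) x :=
  ContDiffAt.ckConv contDiffAt_id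

/-- A property that holds near `(0, f 0 x)` holds at `(e, f e y)` for `(e, y)` near `(0, x)`. -/
theorem CkConv.eventually_comp {n : ℕ} {f : ℝ≥0 → E → F} {x : E} (hf : CkConv n f x)
    {P : ℝ≥0 × F → Prop} (h : ∀ᶠ p in 𝓝 ((0 : ℝ≥0), f 0 x), P p) :
    ∀ᶠ p in 𝓝 ((0 : ℝ≥0), x), P (p.1, f p.1 p.2) :=
  (tendsto_prodMk_fst hf.at.tendsto).eventually h

/-- On a compact set, convergence at each point is uniform. -/
theorem tendstoUniformlyOn_of_ckConvAt {n : ℕ} {f : ℝ≥0 → E → F} {K : Set E} (hK : IsCompact K)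
    (h : ∀ x ∈ K, CkConvAt n f x) {k : ℕ} (hk : k ≤ n) :
    TendstoUniformlyOn (fun e => iteratedFDeriv ℝ k (f e)) (iteratedFDeriv ℝ k (f 0)) (𝓝 0) K := by
  rw [Metric.tendstoUniformlyOn_iff]
  intro δ hδ
  refine hK.eventually_forall_of_forall_eventually
    (P := fun e x => dist (iteratedFDeriv ℝ k (f 0) x) (iteratedFDeriv ℝ k (f e) x) < δ) ?_
  intro x hx
  have h1 := (h x hx).2 k hk
  have h2 : Tendsto (fun p : ℝ≥0 × E => iteratedFDeriv ℝ k (f 0) p.2) (𝓝 (0, x))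
      (𝓝 (iteratedFDeriv ℝ k (f 0) x)) := by
    have h3 : Tendsto (fun p : ℝ≥0 × E => ((0 : ℝ≥0), p.2)) (𝓝 (0, x)) (𝓝 (0, x)) :=
      Continuous.tendsto (f := fun p : ℝ≥0 × E => ((0 : ℝ≥0), p.2)) (by fun_prop) (0, x)
    exact (h1.comp h3 :)
  have h3 := h2.dist h1
  rw [dist_self] at h3
  exact h3.eventually (gt_mem_nhds hδ)

theorem eventually_contDiffAt_of_ckConvAt {n : ℕ} {f : ℝ≥0 → E → F} {K : Set E} (hK : IsCompact K)
    (h : ∀ x ∈ K, CkConvAt n f x) : ∀ᶠ e in 𝓝 0, ∀ x ∈ K, ContDiffAt ℝ n (f e) x :=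
  hK.eventually_forall_of_forall_eventually (P := fun e x => ContDiffAt ℝ n (f e) x)
    fun x hx => (h x hx).1

end Families

/-! ### The implicit function theorem for convergent families -/

section Implicit

variable {X Y Z : Type} [NormedAddCommGroup X] [NormedSpace ℝ X] [CompleteSpace X]
  [NormedAddCommGroup Y] [NormedSpace ℝ Y] [CompleteSpace Y]
  [NormedAddCommGroup Z] [NormedSpace ℝ Z] [CompleteSpace Z]

/-- A continuous solution `g` of a `C^n` equation with invertible partial derivative is the implicit
function of the equation; this gives its regularity and its derivative. -/
theorem contDiffAt_of_implicit {n : ℕ} (hn : n ≠ 0) {f : X × Y → Z} {g : X → Y} {x : X}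
    (hf : ContDiffAt ℝ n f (x, g x))
    (hinv : (fderiv ℝ f (x, g x) ∘L .inr ℝ X Y).IsInvertible) (hg : ContinuousAt g x)
    (h0 : ∀ᶠ y in 𝓝 x, f (y, g y) = 0) :
    ContDiffAt ℝ n g x ∧ fderiv ℝ g x =
      -(fderiv ℝ f (x, g x) ∘L .inr ℝ X Y).inverse ∘L (fderiv ℝ f (x, g x) ∘L .inl ℝ X Y) := by
  have hn' : (n : WithTop ℕ∞) ≠ 0 := by exact_mod_cast hn
  have h1 := hf.eventually_apply_eq_iff_implicitFunction hn' hinv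
  have h2 : Tendsto (fun y => (y, g y)) (𝓝 x) (𝓝 (x, g x)) := tendsto_id.prodMk_nhds hg
  have h3 : g =ᶠ[𝓝 x] hf.implicitFunction hn' hinv := by
    filter_upwards [h2.eventually h1, h0] with y hy hy0
    exact (hy.1 (by rw [hy0, h0.self_of_nhds])).symm
  refine ⟨(hf.contDiffAt_implicitFunction hn' hinv).congr_of_eventuallyEq h3, ?_⟩
  rw [h3.fderiv_eq]
  exact (hf.hasStrictFDerivAt_implicitFunction hn' hinv).hasFDerivAt.fderiv

/-- The derivative of an implicit function is a smooth expression in the derivative of the equation at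
the graph, so convergence of order `n` follows from order zero by induction. -/
theorem ckConvAt_of_implicit {n : ℕ} (hn : n ≠ 0) {F : ℝ≥0 → X × Y → Z} {g : ℝ≥0 → X → Y} {x : X}
    (hF : CkConvAt n F (x, g 0 x))
    (hinv : (fderiv ℝ (F 0) (x, g 0 x) ∘L .inr ℝ X Y).IsInvertible)
    (hg : Tendsto (fun p : ℝ≥0 × X => g p.1 p.2) (𝓝 (0, x)) (𝓝 (g 0 x)))
    (hgc : ∀ᶠ p in 𝓝 ((0 : ℝ≥0), x), ContinuousAt (g p.1) p.2)
    (h0 : ∀ᶠ p in 𝓝 ((0 : ℝ≥0), x), F p.1 (p.2, g p.1 p.2) = 0) :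
    CkConvAt n g x := by
  obtain ⟨m, rfl⟩ := Nat.exists_eq_succ_of_ne_zero hn
  have hgx : Tendsto (fun p : ℝ≥0 × X => (p.1, (p.2, g p.1 p.2))) (𝓝 (0, x))
      (𝓝 (0, (x, g 0 x))) :=
    (continuous_fst.tendsto ((0 : ℝ≥0), x)).prodMk_nhds
      ((continuous_snd.tendsto ((0 : ℝ≥0), x)).prodMk_nhds hg)
  -- the partial derivative stays invertible near the base point
  have hinv' : ∀ᶠ p in 𝓝 ((0 : ℝ≥0), x),
      (fderiv ℝ (F p.1) (p.2, g p.1 p.2) ∘L .inr ℝ X Y).IsInvertible := by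
    obtain ⟨T, hT⟩ := hinv
    have h1 : Tendsto (fun p : ℝ≥0 × X => fderiv ℝ (F p.1) (p.2, g p.1 p.2) ∘L .inr ℝ X Y)
        (𝓝 (0, x)) (𝓝 (T : Y →L[ℝ] Z)) := by
      rw [hT]
      exact (((ContinuousLinearMap.compL ℝ Y (X × Y) Z).flip (.inr ℝ X Y)).continuous.tendsto
        _).comp ((hF.fderiv).tendsto.comp hgx)
    filter_upwards [h1.eventually (ContinuousLinearEquiv.nhds T)] with p hp
    obtain ⟨S, hS⟩ := hp
    exact ⟨S, hS⟩
  have hreg : ∀ᶠ p in 𝓝 ((0 : ℝ≥0), x), ContDiffAt ℝ (m + 1 : ℕ) (g p.1) p.2 ∧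
      fderiv ℝ (g p.1) p.2 = -(fderiv ℝ (F p.1) (p.2, g p.1 p.2) ∘L .inr ℝ X Y).inverse ∘L
        (fderiv ℝ (F p.1) (p.2, g p.1 p.2) ∘L .inl ℝ X Y) := by
    filter_upwards [hinv', hgc, eventually_eventually_snd h0, hgx.eventually hF.1]
      with p h1 h2 h3 h4 using contDiffAt_of_implicit (by simp) h4 h1 h2 h3
  have key : ∀ k ≤ m + 1, CkConvAt k g x := by
    intro k
    induction k with
    | zero =>
      intro _
      rw [ckConvAt_zero_iff]
      exact ⟨hreg.mono fun p hp => hp.1.of_le (by simp), hg⟩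
    | succ k ih =>
      intro hk
      have ihk := ih (by omega)
      refine CkConvAt.succ hg (hreg.mono fun p hp => hp.1.differentiableAt (by simp)) ?_
      have hΨ : ContDiffAt ℝ k (fun A : X × Y →L[ℝ] Z =>
          -(A ∘L .inr ℝ X Y).inverse ∘L (A ∘L .inl ℝ X Y)) (fderiv ℝ (F 0) (x, g 0 x)) := by
        obtain ⟨T, hT⟩ := hinv
        have hc : ContDiffAt ℝ k (fun A : X × Y →L[ℝ] Z => A ∘L .inr ℝ X Y)
            (fderiv ℝ (F 0) (x, g 0 x)) :=
          (((ContinuousLinearMap.compL ℝ Y (X × Y) Z).flip (.inr ℝ X Y)).contDiff).contDiffAt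
        have hc2 : ContDiffAt ℝ k (fun A : X × Y →L[ℝ] Z => A ∘L .inl ℝ X Y)
            (fderiv ℝ (F 0) (x, g 0 x)) :=
          (((ContinuousLinearMap.compL ℝ X (X × Y) Z).flip (.inl ℝ X Y)).contDiff).contDiffAt
        have hi : ContDiffAt ℝ k (ContinuousLinearMap.inverse (R := ℝ) (M := Y) (M₂ := Z))
            (fderiv ℝ (F 0) (x, g 0 x) ∘L .inr ℝ X Y) := by
          rw [← hT]; exact contDiffAt_map_inverse T
        have hi2 := hi.comp (fderiv ℝ (F 0) (x, g 0 x)) hc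
        exact hi2.neg.clm_comp hc2
      have hid : CkConvAt k (fun _ (y : X) => y) x := (ckConv_id x).at
      have h1 : CkConvAt k (fun e y => fderiv ℝ (F e) (y, g e y)) x :=
        CkConvAt.comp (g := fun e => fderiv ℝ (F e)) (f := fun e y => (y, g e y))
          (CkConvAt.fderiv (hF.mono hk)) (hid.prodMk ihk)
      refine (CkConvAt.comp (g := fun _ => _) (ContDiffAt.ckConvAt hΨ) h1).congr ?_
      filter_upwards [hreg] with p hp using hp.2
  exact key _ le_rfl

/-- **Implicit function theorem** for families converging in `C^n`: the solutions of
`F e (x, y) = 0` near a nondegenerate solution of the limit equation form a family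
that converges in `C^n`. -/
theorem exists_implicit_of_ckConv {n : ℕ} (hn : n ≠ 0) {F : ℝ≥0 → X × Y → Z} {x₀ : X} {y₀ : Y}
    (hF : CkConv n F (x₀, y₀)) (h0 : F 0 (x₀, y₀) = 0)
    (hinv : (fderiv ℝ (F 0) (x₀, y₀) ∘L .inr ℝ X Y).IsInvertible) :
    ∃ g : ℝ≥0 → X → Y, g 0 x₀ = y₀ ∧ CkConv n g x₀ ∧
      ∀ᶠ p in 𝓝 ((0 : ℝ≥0), x₀), F p.1 (p.2, g p.1 p.2) = 0 := by
  have hF1 : CkConvAt 1 F (x₀, y₀) := hF.at.mono (by omega)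
  obtain ⟨T, hT⟩ := id hinv
  set N : ℝ≥0 := ‖(T.symm : Z →L[ℝ] Y)‖₊ + 1 with hN
  have hNpos : 0 < N := by positivity
  set c : ℝ≥0 := (2 * N)⁻¹ with hc
  have hcN : (N : ℝ) * c = 1 / 2 := by
    rw [hc]; push_cast; field_simp
  have hTN : ∀ z, ‖T.symm z‖ ≤ N * ‖z‖ := fun z => by
    refine ((T.symm : Z →L[ℝ] Y).le_opNorm z).trans ?_
    gcongr
    rw [hN]; push_cast; simp
  -- a neighbourhood where the partial derivative differs from `T` by at most `c`
  have hnear : ∀ᶠ p in 𝓝 ((0 : ℝ≥0), (x₀, y₀)), DifferentiableAt ℝ (F p.1) p.2 ∧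
      ‖fderiv ℝ (F p.1) p.2 ∘L .inr ℝ X Y - T‖ ≤ c := by
    have h1 : Tendsto (fun p : ℝ≥0 × (X × Y) => fderiv ℝ (F p.1) p.2 ∘L .inr ℝ X Y - T)
        (𝓝 (0, (x₀, y₀))) (𝓝 0) := by
      have h2 : Tendsto (fun p : ℝ≥0 × (X × Y) => fderiv ℝ (F p.1) p.2 ∘L .inr ℝ X Y)
          (𝓝 (0, (x₀, y₀))) (𝓝 (T : Y →L[ℝ] Z)) := by
        rw [hT]
        exact (((ContinuousLinearMap.compL ℝ Y (X × Y) Z).flip (.inr ℝ X Y)).continuous.tendsto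
          _).comp (hF1.fderiv).tendsto
      simpa using h2.sub_const (T : Y →L[ℝ] Z)
    have h3 : ∀ᶠ A : Y →L[ℝ] Z in 𝓝 0, ‖A‖ ≤ c := by
      have : (0 : ℝ) < c := by rw [hc]; positivity
      filter_upwards [Metric.closedBall_mem_nhds (0 : Y →L[ℝ] Z) this] with A hA
      simpa using hA
    exact hF1.differentiableAt.and (h1.eventually h3)
  obtain ⟨R, hR, hball⟩ := Metric.eventually_nhds_iff_ball.1 hnear
  set ρ := R / 2 with hρ
  have hρpos : 0 < ρ := by positivity
  have happrox : ∀ e : ℝ≥0, ∀ x, dist e 0 < R → dist x x₀ < R →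
      ApproximatesLinearOn (fun y => F e (x, y)) (T : Y →L[ℝ] Z) (Metric.closedBall y₀ ρ) c := by
    intro e x he hx y hy y' hy'
    have hd : ∀ w ∈ Metric.closedBall y₀ ρ, HasFDerivWithinAt (fun y => F e (x, y))
        (fderiv ℝ (F e) (x, w) ∘L .inr ℝ X Y) (Metric.closedBall y₀ ρ) w := by
      intro w hw
      have hw' : dist w y₀ < R := lt_of_le_of_lt (Metric.mem_closedBall.1 hw) (by linarith)
      have := (hball (e, (x, w)) (by simp [Prod.dist_eq, he, hx, hw'])).1
      have h2 : HasFDerivAt (fun y : Y => (x, y)) (.inr ℝ X Y) w := hasFDerivAt_prodMk_right x w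
      exact (HasFDerivAt.comp w this.hasFDerivAt h2).hasFDerivWithinAt
    have := (convex_closedBall y₀ ρ).norm_image_sub_le_of_norm_hasFDerivWithin_le' (C := c)
      (φ := (T : Y →L[ℝ] Z)) hd (fun w hw => ?_) hy' hy
    · simpa using this
    · have hw' : dist w y₀ < R := lt_of_le_of_lt (Metric.mem_closedBall.1 hw) (by linarith)
      exact (hball (e, (x, w)) (by simp [Prod.dist_eq, he, hx, hw'])).2
  have hanti : ∀ e : ℝ≥0, ∀ x, dist e 0 < R → dist x x₀ < R → ∀ y ∈ Metric.closedBall y₀ ρ,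
      ∀ y' ∈ Metric.closedBall y₀ ρ, dist y y' ≤ 2 * N * ‖F e (x, y) - F e (x, y')‖ := by
    intro e x he hx y hy y' hy'
    have h1 := happrox e x he hx y hy y' hy'
    have h2 : y - y' = T.symm ((F e (x, y) - F e (x, y')) -
        (F e (x, y) - F e (x, y') - T (y - y'))) := by simp
    have h3 : ‖y - y'‖ ≤ N * (‖F e (x, y) - F e (x, y')‖ + c * ‖y - y'‖) := by
      calc ‖y - y'‖ ≤ N * ‖(F e (x, y) - F e (x, y')) -
            (F e (x, y) - F e (x, y') - T (y - y'))‖ := by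
              conv_lhs => rw [h2]
              exact hTN _
        _ ≤ _ := by
              gcongr
              exact (norm_sub_le _ _).trans (by gcongr; exact h1)
    rw [dist_eq_norm]
    rw [mul_add, ← mul_assoc, hcN] at h3
    linarith
  let S : (T : Y →L[ℝ] Z).NonlinearRightInverse :=
    { toFun := T.symm, nnnorm := N, bound' := hTN, right_inv' := fun z => T.apply_symm_apply z }
  have hex : ∀ᶠ p in 𝓝 ((0 : ℝ≥0), x₀), ∃ y ∈ Metric.closedBall y₀ ρ, F p.1 (p.2, y) = 0 := by
    have hr : 0 < ((N : ℝ)⁻¹ - c) * ρ := by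
      have : (N : ℝ)⁻¹ - c = (2 * N)⁻¹ := by
        rw [hc]; push_cast; field_simp; norm_num
      rw [this]; positivity
    have h1 : Tendsto (fun p : ℝ≥0 × X => F p.1 (p.2, y₀)) (𝓝 (0, x₀)) (𝓝 0) := by
      rw [← h0]
      refine hF1.tendsto.comp (x := 𝓝 (0, x₀)) (f := fun p : ℝ≥0 × X => (p.1, (p.2, y₀))) ?_
      exact Continuous.tendsto (f := fun p : ℝ≥0 × X => (p.1, (p.2, y₀))) (by fun_prop) (0, x₀)
    filter_upwards [h1.eventually (Metric.closedBall_mem_nhds _ hr),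
      Metric.ball_mem_nhds ((0 : ℝ≥0), x₀) hR] with p hp hpR
    rw [Metric.mem_ball, Prod.dist_eq, max_lt_iff] at hpR
    obtain ⟨y, hy, hy0⟩ := (happrox p.1 p.2 hpR.1 hpR.2).surjOn_closedBall_of_nonlinearRightInverse S
      hρpos.le subset_rfl (show (0 : Z) ∈ _ by
        rw [Metric.mem_closedBall, dist_comm]; exact hp)
    exact ⟨y, hy, hy0⟩
  classical
  let g : ℝ≥0 → X → Y := fun e x =>
    if h : ∃ y ∈ Metric.closedBall y₀ ρ, F e (x, y) = 0 then h.choose else y₀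
  have hgmem : ∀ e x, g e x ∈ Metric.closedBall y₀ ρ := by
    intro e x
    by_cases h : ∃ y ∈ Metric.closedBall y₀ ρ, F e (x, y) = 0
    · simp only [g, dif_pos h]; exact h.choose_spec.1
    · simp only [g, dif_neg h]; exact Metric.mem_closedBall_self hρpos.le
  have hg0 : ∀ᶠ p in 𝓝 ((0 : ℝ≥0), x₀), F p.1 (p.2, g p.1 p.2) = 0 := by
    filter_upwards [hex] with p hp
    simp only [g, dif_pos hp]; exact hp.choose_spec.2
  have hg00 : g 0 x₀ = y₀ := by
    have := hanti 0 x₀ (by simpa using hR) (by simpa using hR) _ (hgmem 0 x₀) y₀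
      (Metric.mem_closedBall_self hρpos.le)
    rw [hg0.self_of_nhds, h0] at this
    simpa using this
  have hballX : ∀ᶠ p in 𝓝 ((0 : ℝ≥0), x₀), dist p.1 0 < R ∧ dist p.2 x₀ < R := by
    filter_upwards [Metric.ball_mem_nhds ((0 : ℝ≥0), x₀) hR] with p hpR
    rwa [Metric.mem_ball, Prod.dist_eq, max_lt_iff] at hpR
  -- convergence and continuity of the solutions
  have htend : ∀ x : X, (∀ᶠ p in 𝓝 ((0 : ℝ≥0), x), F p.1 (p.2, g p.1 p.2) = 0) →
      (∀ᶠ p in 𝓝 ((0 : ℝ≥0), x), dist p.1 0 < R ∧ dist p.2 x₀ < R) →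
      CkConvAt n F (x, g 0 x) →
      Tendsto (fun p : ℝ≥0 × X => g p.1 p.2) (𝓝 (0, x)) (𝓝 (g 0 x)) := by
    intro x hx hxR hxF
    have h1 : Tendsto (fun p : ℝ≥0 × X => 2 * N * ‖0 - F p.1 (p.2, g 0 x)‖) (𝓝 (0, x)) (𝓝 0) := by
      have h2 : Tendsto (fun p : ℝ≥0 × X => F p.1 (p.2, g 0 x)) (𝓝 (0, x))
          (𝓝 (F 0 (x, g 0 x))) := by
        refine hxF.tendsto.comp (x := 𝓝 (0, x)) (f := fun p : ℝ≥0 × X => (p.1, (p.2, g 0 x))) ?_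
        exact Continuous.tendsto (f := fun p : ℝ≥0 × X => (p.1, (p.2, g 0 x))) (by fun_prop) (0, x)
      have h3 := (h2.const_sub 0).norm.const_mul (2 * (N : ℝ))
      rw [hx.self_of_nhds] at h3
      simpa using h3
    rw [tendsto_iff_dist_tendsto_zero]
    refine squeeze_zero' (Eventually.of_forall fun _ => dist_nonneg) ?_ h1
    filter_upwards [hx, hxR] with p hp hpR
    have := hanti p.1 p.2 hpR.1 hpR.2 _ (hgmem p.1 p.2) _ (hgmem 0 x)
    rwa [hp] at this
  have hcont : ∀ᶠ p in 𝓝 ((0 : ℝ≥0), x₀), ContinuousAt (g p.1) p.2 := by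
    have hFc : ∀ᶠ p in 𝓝 ((0 : ℝ≥0), x₀), ContinuousAt (F p.1) (p.2, g p.1 p.2) := by
      filter_upwards [hballX] with p hpR
      have hw' : dist (g p.1 p.2) y₀ < R :=
        lt_of_le_of_lt (Metric.mem_closedBall.1 (hgmem _ _)) (by linarith)
      exact (hball (p.1, (p.2, g p.1 p.2))
        (by simp [Prod.dist_eq, hpR.1, hpR.2, hw'])).1.continuousAt
    filter_upwards [eventually_eventually_snd hg0, eventually_eventually_snd hballX, hFc]
      with p hp hpR hpF
    rw [ContinuousAt, tendsto_iff_dist_tendsto_zero]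
    have h1 : Tendsto (fun x => 2 * N * ‖0 - F p.1 (x, g p.1 p.2)‖) (𝓝 p.2) (𝓝 0) := by
      have h2 : Tendsto (fun x => F p.1 (x, g p.1 p.2)) (𝓝 p.2)
          (𝓝 (F p.1 (p.2, g p.1 p.2))) := by
        exact hpF.tendsto.comp (tendsto_id.prodMk_nhds tendsto_const_nhds)
      have h3 := (h2.const_sub 0).norm.const_mul (2 * (N : ℝ))
      rw [hp.self_of_nhds] at h3
      simpa using h3
    refine squeeze_zero' (Eventually.of_forall fun _ => dist_nonneg) ?_ h1
    filter_upwards [hp, hpR] with x hx hxR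
    have := hanti p.1 x hxR.1 hxR.2 _ (hgmem p.1 x) _ (hgmem p.1 p.2)
    rwa [hx] at this
  refine ⟨g, hg00, ?_, hg0⟩
  have hFg : CkConv n F (x₀, g 0 x₀) := by rw [hg00]; exact hF
  have hg0c : Tendsto (fun x => (x, g 0 x)) (𝓝 x₀) (𝓝 (x₀, g 0 x₀)) :=
    tendsto_id.prodMk_nhds hcont.self_of_nhds
  have hinv' : ∀ᶠ x in 𝓝 x₀, (fderiv ℝ (F 0) (x, g 0 x) ∘L .inr ℝ X Y).IsInvertible := by
    have h1 : Tendsto (fun x : X => fderiv ℝ (F 0) (x, g 0 x) ∘L .inr ℝ X Y)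
        (𝓝 x₀) (𝓝 (T : Y →L[ℝ] Z)) := by
      rw [hT, ← hg00]
      exact (((ContinuousLinearMap.compL ℝ Y (X × Y) Z).flip (.inr ℝ X Y)).continuous.tendsto
        _).comp (((hFg.at.mono (m := 1) (by omega)).fderiv).continuousAt.tendsto.comp hg0c)
    filter_upwards [h1.eventually (ContinuousLinearEquiv.nhds T)] with p hp
    obtain ⟨S, hS⟩ := hp
    exact ⟨S, hS⟩
  filter_upwards [hg0c.eventually hFg, eventually_zero_mem hg0.eventually_nhds,
    eventually_zero_mem hballX.eventually_nhds, eventually_zero_mem hcont.eventually_nhds, hinv']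
    with x h1 h2 h3 h4 h5
  exact ckConvAt_of_implicit hn h1 h5 (htend x h2 h3 h1) h4 h2

end Implicit

/-! ### Superposition operators on spaces of curves -/

section Superposition

variable {E F : Type} [NormedAddCommGroup E] [NormedSpace ℝ E]
  [NormedAddCommGroup F] [NormedSpace ℝ F]

open Classical in
/-- The superposition operator `α ↦ f ∘ α` on curves (with value `0` if `f ∘ α` is not
continuous). -/
def superpose (f : E → F) (α : C(unitInterval, E)) : C(unitInterval, F) :=
  if h : Continuous (f ∘ α) then ⟨f ∘ α, h⟩ else 0

omit [NormedSpace ℝ E] [NormedSpace ℝ F] in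
theorem superpose_apply {f : E → F} {α : C(unitInterval, E)} (h : ∀ s, ContinuousAt f (α s))
    (s : unitInterval) : superpose f α s = f (α s) := by
  have hc : Continuous (f ∘ α) :=
    continuous_iff_continuousAt.2 fun s => (h s).comp α.continuous.continuousAt
  simp [superpose, hc]

omit [NormedSpace ℝ E] in
/-- A property that holds near each point of a compact curve holds along all nearby curves. -/
theorem eventually_forall_curve {P : ℝ≥0 × E → Prop} {α : C(unitInterval, E)}
    (h : ∀ s, ∀ᶠ p in 𝓝 ((0 : ℝ≥0), α s), P p) :
    ∀ᶠ p in 𝓝 ((0 : ℝ≥0), α), ∀ s, P (p.1, p.2 s) := by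
  have := isCompact_univ.eventually_forall_of_forall_eventually (X := ℝ≥0 × C(unitInterval, E))
    (Y := unitInterval) (x₀ := ((0 : ℝ≥0), α)) (P := fun p s => P (p.1, p.2 s)) ?_
  · simpa using this
  · intro s _
    have hc : Tendsto (fun z : (ℝ≥0 × C(unitInterval, E)) × unitInterval => (z.1.1, z.1.2 z.2))
        (𝓝 ((0, α), s)) (𝓝 (0, α s)) :=
      Continuous.tendsto (f := fun z : (ℝ≥0 × C(unitInterval, E)) × unitInterval =>
        (z.1.1, z.1.2 z.2)) (by fun_prop) ((0, α), s)
    exact hc.eventually (h s)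

omit [NormedSpace ℝ E] in
theorem eventually_forall_curve_pair {P : E × E → Prop} {α : C(unitInterval, E)}
    (h : ∀ s, ∀ᶠ p in 𝓝 (α s, α s), P p) :
    ∀ᶠ β in 𝓝 α, ∀ s, P (β s, α s) := by
  have := isCompact_univ.eventually_forall_of_forall_eventually (X := C(unitInterval, E))
    (Y := unitInterval) (x₀ := α) (P := fun β s => P (β s, α s)) ?_
  · simpa using this
  · intro s _
    have hc : Tendsto (fun z : C(unitInterval, E) × unitInterval => (z.1 z.2, α z.2))
        (𝓝 (α, s)) (𝓝 (α s, α s)) :=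
      Continuous.tendsto (f := fun z : C(unitInterval, E) × unitInterval => (z.1 z.2, α z.2))
        (by fun_prop) (α, s)
    exact hc.eventually (h s)

/-- Pointwise application of a curve of operators to a curve of vectors. -/
def curveApply : C(unitInterval, E →L[ℝ] F) →L[ℝ] C(unitInterval, E) →L[ℝ] C(unitInterval, F) :=
  LinearMap.mkContinuous₂
    (LinearMap.mk₂ ℝ (fun (A : C(unitInterval, E →L[ℝ] F)) (β : C(unitInterval, E)) =>
       (⟨fun s => A s (β s), by fun_prop⟩ : C(unitInterval, F)))
      (fun A A' β => by ext s; simp) (fun c A β => by ext s; simp)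
      (fun A β β' => by ext s; simp) (fun c A β => by ext s; simp)) 1
    (fun A β => by
      rw [ContinuousMap.norm_le _ (by positivity)]
      intro s
      refine ((A s).le_opNorm _).trans ?_
      rw [one_mul]
      gcongr
      · exact A.norm_coe_le_norm s
      · exact β.norm_coe_le_norm s)

@[simp] theorem curveApply_apply (A : C(unitInterval, E →L[ℝ] F)) (β : C(unitInterval, E))
    (s : unitInterval) : curveApply A β s = A s (β s) := rfl

omit [NormedSpace ℝ E] [NormedSpace ℝ F] in
theorem continuousAt_superpose {f : E → F} {α : C(unitInterval, E)}
    (h : ∀ s, ∀ᶠ y in 𝓝 (α s), ContinuousAt f y) : ContinuousAt (superpose f) α := by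
  have hα : ∀ s, ContinuousAt f (α s) := fun s => (h s).self_of_nhds
  have h1 : ∀ᶠ β in 𝓝 α, ∀ s, ContinuousAt f (β s) :=
    eventually_forall_curve_pair (P := fun p => ContinuousAt f p.1)
      fun s => (continuous_fst.tendsto (α s, α s)).eventually (h s)
  refine Metric.tendsto_nhds.2 fun η hη => ?_
  have h2 : ∀ᶠ β in 𝓝 α, ∀ s, dist (f (β s)) (f (α s)) < η := by
    refine eventually_forall_curve_pair (P := fun p => dist (f p.1) (f p.2) < η) fun s => ?_
    have h3 : Tendsto (fun p : E × E => dist (f p.1) (f p.2)) (𝓝 (α s, α s))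
        (𝓝 (dist (f (α s)) (f (α s)))) :=
      ((hα s).tendsto.comp (continuous_fst.tendsto (α s, α s))).dist
        ((hα s).tendsto.comp (continuous_snd.tendsto (α s, α s)))
    rw [dist_self] at h3
    exact h3.eventually (gt_mem_nhds hη)
  filter_upwards [h1, h2] with β hβ hβ2
  rw [ContinuousMap.dist_lt_iff hη]
  intro s
  rw [superpose_apply hβ, superpose_apply hα]
  exact hβ2 s

theorem hasFDerivAt_superpose {f : E → F} {α : C(unitInterval, E)}
    (h : ∀ s, ContDiffAt ℝ 1 f (α s)) :
    HasFDerivAt (superpose f) (curveApply (superpose (fderiv ℝ f) α)) α := by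
  have hα : ∀ s, ContinuousAt f (α s) := fun s => (h s).continuousAt
  have hα' : ∀ s, ContinuousAt (fderiv ℝ f) (α s) := fun s =>
    ((h s).fderiv_right (m := 0) (by norm_num)).continuousAt
  have h1 : ∀ᶠ β in 𝓝 α, ∀ s, ContinuousAt f (β s) :=
    eventually_forall_curve_pair (P := fun p => ContinuousAt f p.1)
      fun s => (continuous_fst.tendsto (α s, α s)).eventually
        (((h s).eventually (by simp)).mono fun _ hy => hy.continuousAt)
  rw [hasFDerivAt_iff_isLittleO, Asymptotics.isLittleO_iff]
  intro η hη
  have h2 : ∀ᶠ β in 𝓝 α, ∀ s,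
      ‖f (β s) - f (α s) - fderiv ℝ f (α s) (β s - α s)‖ ≤ η * ‖β s - α s‖ := by
    refine eventually_forall_curve_pair
      (P := fun p => ‖f p.1 - f p.2 - fderiv ℝ f p.2 (p.1 - p.2)‖ ≤ η * ‖p.1 - p.2‖) fun s => ?_
    have h3 := ((h s).hasStrictFDerivAt (by simp)).isLittleO.def (half_pos hη)
    have h4 : ∀ᶠ p : E × E in 𝓝 (α s, α s),
        dist (fderiv ℝ f p.2) (fderiv ℝ f (α s)) < η / 2 :=
      ((hα' s).tendsto.comp (continuous_snd.tendsto (α s, α s))).eventually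
        (Metric.ball_mem_nhds _ (half_pos hη))
    filter_upwards [h3, h4] with p hp hp2
    calc ‖f p.1 - f p.2 - fderiv ℝ f p.2 (p.1 - p.2)‖
        = ‖(f p.1 - f p.2 - fderiv ℝ f (α s) (p.1 - p.2)) -
            (fderiv ℝ f p.2 - fderiv ℝ f (α s)) (p.1 - p.2)‖ := by
          congr 1; simp only [sub_apply]; abel
      _ ≤ η / 2 * ‖p.1 - p.2‖ + η / 2 * ‖p.1 - p.2‖ := by
          refine (norm_sub_le _ _).trans (add_le_add hp ?_)
          refine (ContinuousLinearMap.le_opNorm _ _).trans ?_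
          gcongr
          rw [← dist_eq_norm]; exact hp2.le
      _ = η * ‖p.1 - p.2‖ := by ring
  filter_upwards [h1, h2] with β hβ hβ2
  rw [ContinuousMap.norm_le _ (by positivity)]
  intro s
  simp only [ContinuousMap.sub_apply, curveApply_apply]
  rw [superpose_apply hβ, superpose_apply hα, superpose_apply hα']
  refine (hβ2 s).trans ?_
  gcongr
  exact (β - α).norm_coe_le_norm s

/-- Superposition operators inherit `C^n` convergence from the maps they are built from. -/
theorem ckConvAt_superpose {n : ℕ} {f : ℝ≥0 → E → F} {α : C(unitInterval, E)}
    (h : ∀ s, CkConvAt n f (α s)) : CkConvAt n (fun e => superpose (f e)) α := by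
  induction n generalizing F with
  | zero =>
    have h0 : ∀ s, ContinuousAt (f 0) (α s) := fun s => (h s).continuousAt
    have h1 : ∀ᶠ p in 𝓝 ((0 : ℝ≥0), α), ∀ s, ContDiffAt ℝ 0 (f p.1) (p.2 s) :=
      eventually_forall_curve (P := fun p => ContDiffAt ℝ 0 (f p.1) p.2)
        fun s => (ckConvAt_zero_iff.1 (h s)).1
    rw [ckConvAt_zero_iff]
    constructor
    · have h2 : ∀ᶠ p in 𝓝 ((0 : ℝ≥0), α), ContinuousAt (superpose (f p.1)) p.2 := by
        filter_upwards [h1] with p hp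
        exact continuousAt_superpose fun s =>
          ((hp s).eventually (by simp)).mono fun y hy => hy.continuousAt
      filter_upwards [eventually_eventually_snd h2] with p hp
      rw [contDiffAt_zero]
      exact ⟨_, hp, fun β hβ => ContinuousAt.continuousWithinAt hβ⟩
    · refine Metric.tendsto_nhds.2 fun η hη => ?_
      have h2 : ∀ᶠ p in 𝓝 ((0 : ℝ≥0), α), ∀ s, dist (f p.1 (p.2 s)) (f 0 (α s)) < η := by
        have := isCompact_univ.eventually_forall_of_forall_eventually
          (X := ℝ≥0 × C(unitInterval, E))
          (Y := unitInterval) (x₀ := ((0 : ℝ≥0), α))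
          (P := fun p s => dist (f p.1 (p.2 s)) (f 0 (α s)) < η) ?_
        · simpa using this
        intro s _
        have h3 : Tendsto (fun z : (ℝ≥0 × C(unitInterval, E)) × unitInterval =>
            (z.1.1, z.1.2 z.2)) (𝓝 ((0, α), s)) (𝓝 (0, α s)) :=
          Continuous.tendsto (f := fun z : (ℝ≥0 × C(unitInterval, E)) × unitInterval =>
            (z.1.1, z.1.2 z.2)) (by fun_prop) ((0, α), s)
        have h4 : Tendsto (fun z : (ℝ≥0 × C(unitInterval, E)) × unitInterval => α z.2)
            (𝓝 ((0, α), s)) (𝓝 (α s)) :=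
          Continuous.tendsto (f := fun z : (ℝ≥0 × C(unitInterval, E)) × unitInterval =>
            α z.2) (by fun_prop) ((0, α), s)
        have h5 := ((h s).tendsto.comp h3).dist ((h0 s).tendsto.comp h4)
        rw [dist_self] at h5
        exact h5.eventually (gt_mem_nhds hη)
      filter_upwards [h1, h2] with p hp hp2
      rw [ContinuousMap.dist_lt_iff hη]
      intro s
      rw [superpose_apply (fun s => (hp s).continuousAt), superpose_apply h0]
      exact hp2 s
  | succ n ih =>
    have h1 : ∀ᶠ p in 𝓝 ((0 : ℝ≥0), α), ∀ s, ContDiffAt ℝ 1 (f p.1) (p.2 s) :=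
      eventually_forall_curve (P := fun p => ContDiffAt ℝ 1 (f p.1) p.2)
        fun s => ((h s).mono (m := 1) (by omega)).1.mono fun p hp => by simpa using hp
    refine CkConvAt.succ (ih fun s => (h s).mono n.le_succ).tendsto
      (h1.mono fun p hp => (hasFDerivAt_superpose hp).differentiableAt) ?_
    refine ((ih fun s => (h s).fderiv).clm curveApply).congr ?_
    exact h1.mono fun p hp => (hasFDerivAt_superpose hp).fderiv

theorem ckConv_superpose {n : ℕ} {f : ℝ≥0 → E → F} {α : C(unitInterval, E)}
    (h : ∀ s, CkConv n f (α s)) : CkConv n (fun e => superpose (f e)) α := by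
  have h1 : ∀ᶠ β in 𝓝 α, ∀ s, CkConvAt n f (β s) :=
    eventually_forall_curve_pair (P := fun p => CkConvAt n f p.1)
      fun s => (continuous_fst.tendsto (α s, α s)).eventually (h s)
  exact h1.mono fun β hβ => ckConvAt_superpose hβ

end Superposition

/-! ### Integral operators -/

section Integral

variable {E : Type} [NormedAddCommGroup E] [NormedSpace ℝ E]

/-- The extension of a curve on `[0, 1]` to the line, constant outside `[0, 1]`. -/
def curveExt {F : Type} [TopologicalSpace F] (α : C(unitInterval, F)) : ℝ → F :=
  IccExtend zero_le_one α

theorem continuous_curveExt {F : Type} [TopologicalSpace F] (α : C(unitInterval, F)) :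
    Continuous (curveExt α) := α.continuous.Icc_extend'

theorem curveExt_coe {F : Type} [TopologicalSpace F] (α : C(unitInterval, F))
    (s : unitInterval) : curveExt α s = α s := IccExtend_val _ _ s

theorem curveExt_of_mem {F : Type} [TopologicalSpace F] (α : C(unitInterval, F)) {s : ℝ}
    (hs : s ∈ Icc (0 : ℝ) 1) : curveExt α s = α ⟨s, hs⟩ := IccExtend_of_mem _ _ hs

omit [NormedSpace ℝ E] in
theorem norm_curveExt_le (α : C(unitInterval, E)) (s : ℝ) : ‖curveExt α s‖ ≤ ‖α‖ :=
  α.norm_coe_le_norm _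

theorem integral_norm_le_of_le {f : ℝ → ℝ} (hf : Continuous f) (h0 : ∀ s, 0 ≤ f s)
    (t : unitInterval) : ∫ s in (0 : ℝ)..t, f s ≤ ∫ s in (0 : ℝ)..1, f s := by
  have := intervalIntegral.integral_add_adjacent_intervals (hf.intervalIntegrable
    (μ := MeasureTheory.volume) (0 : ℝ) t) (hf.intervalIntegrable (t : ℝ) 1)
  have h2 : 0 ≤ ∫ s in (t : ℝ)..1, f s :=
    intervalIntegral.integral_nonneg t.2.2 fun s _ => h0 s
  linarith

/-- The operator `β ↦ ∫₀ᵗ a(s) β(s) ds`, bounded by the `L¹` norm of `a`. -/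
def weightedPrimitive (a : C(unitInterval, ℝ)) : C(unitInterval, E) →L[ℝ] C(unitInterval, E) :=
  LinearMap.mkContinuous
    { toFun := fun β => ⟨fun t => ∫ s in (0 : ℝ)..t, curveExt a s • curveExt β s,
        (intervalIntegral.continuous_primitive (fun _ _ =>
          ((continuous_curveExt a).smul (continuous_curveExt β)).intervalIntegrable _ _) 0).comp
          continuous_subtype_val⟩
      map_add' := fun β β' => by
        ext t
        simp only [ContinuousMap.coe_mk, ContinuousMap.add_apply]
        rw [← intervalIntegral.integral_add]
        · refine intervalIntegral.integral_congr fun s _ => ?_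
          simp [curveExt, IccExtend, smul_add]
        · exact ((continuous_curveExt a).smul (continuous_curveExt β)).intervalIntegrable _ _
        · exact ((continuous_curveExt a).smul (continuous_curveExt β')).intervalIntegrable _ _
      map_smul' := fun c β => by
        ext t
        simp only [ContinuousMap.coe_mk, ContinuousMap.smul_apply, RingHom.id_apply]
        rw [← intervalIntegral.integral_smul]
        refine intervalIntegral.integral_congr fun s _ => ?_
        simp [curveExt, IccExtend, smul_comm c] }
    (∫ s in (0 : ℝ)..1, |curveExt a s|) (fun β => by
      have h0 : 0 ≤ ∫ s in (0 : ℝ)..1, |curveExt a s| :=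
        intervalIntegral.integral_nonneg zero_le_one fun _ _ => abs_nonneg _
      rw [ContinuousMap.norm_le _ (by positivity)]
      intro t
      calc ‖∫ s in (0 : ℝ)..t, curveExt a s • curveExt β s‖
          ≤ ∫ s in (0 : ℝ)..t, |curveExt a s| * ‖β‖ := by
            refine intervalIntegral.norm_integral_le_of_norm_le t.2.1 ?_ ?_
            · refine Eventually.of_forall fun s _ => ?_
              rw [norm_smul, Real.norm_eq_abs]
              gcongr
              exact norm_curveExt_le β s
            · exact ((continuous_curveExt a).abs.mul continuous_const).intervalIntegrable _ _
        _ = (∫ s in (0 : ℝ)..t, |curveExt a s|) * ‖β‖ := intervalIntegral.integral_mul_const _ _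
        _ ≤ _ := by
            gcongr
            exact integral_norm_le_of_le (continuous_curveExt a).abs (fun _ => abs_nonneg _) t)

theorem weightedPrimitive_apply (a : C(unitInterval, ℝ)) (β : C(unitInterval, E))
    (t : unitInterval) :
    weightedPrimitive a β t = ∫ s in (0 : ℝ)..t, curveExt a s • curveExt β s := rfl

theorem norm_weightedPrimitive_le (a : C(unitInterval, ℝ)) :
    ‖(weightedPrimitive a : C(unitInterval, E) →L[ℝ] C(unitInterval, E))‖ ≤
      ∫ s in (0 : ℝ)..1, |curveExt a s| :=
  LinearMap.mkContinuous_norm_le _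
    (intervalIntegral.integral_nonneg zero_le_one fun _ _ => abs_nonneg _) _

theorem weightedPrimitive_sub (a b : C(unitInterval, ℝ)) :
    (weightedPrimitive (a - b) : C(unitInterval, E) →L[ℝ] C(unitInterval, E)) =
      weightedPrimitive a - weightedPrimitive b := by
  ext β t
  simp only [sub_apply, ContinuousMap.sub_apply, weightedPrimitive_apply]
  rw [← intervalIntegral.integral_sub]
  · refine intervalIntegral.integral_congr fun s _ => ?_
    simp [curveExt, IccExtend, sub_smul]
  · exact ((continuous_curveExt a).smul (continuous_curveExt β)).intervalIntegrable _ _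
  · exact ((continuous_curveExt b).smul (continuous_curveExt β)).intervalIntegrable _ _

/-- Convergence of the weights in `L¹` is enough for convergence of the operators. -/
theorem tendsto_weightedPrimitive {a : ℝ≥0 → C(unitInterval, ℝ)}
    (ha : Tendsto (fun e => ∫ s in (0 : ℝ)..1, |curveExt (a e) s - curveExt (a 0) s|) (𝓝 0)
      (𝓝 0)) :
    Tendsto (fun e => (weightedPrimitive (a e) : C(unitInterval, E) →L[ℝ] C(unitInterval, E)))
      (𝓝 0) (𝓝 (weightedPrimitive (a 0))) := by
  refine (tendsto_iff_norm_sub_tendsto_zero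
    (E := C(unitInterval, E) →L[ℝ] C(unitInterval, E))).2 ?_
  refine squeeze_zero (fun e => norm_nonneg
    (weightedPrimitive (a e) - weightedPrimitive (a 0) :
      C(unitInterval, E) →L[ℝ] C(unitInterval, E))) (fun e => ?_) ha
  rw [← weightedPrimitive_sub]
  exact norm_weightedPrimitive_le _

/-- Operators of Volterra type are quasi-nilpotent, so `1 - K` is invertible. -/
theorem isUnit_one_sub_volterra [CompleteSpace E] {C : ℝ} (hC : 0 ≤ C)
    (K : C(unitInterval, E) →L[ℝ] C(unitInterval, E))
    (hK : ∀ β (t : unitInterval), ‖K β t‖ ≤ C * ∫ s in (0 : ℝ)..t, ‖curveExt β s‖) :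
    IsUnit (1 - K) := by
  have hpow : ∀ (n : ℕ) (β : C(unitInterval, E)) (t : unitInterval),
      ‖(K ^ n) β t‖ ≤ (C * t) ^ n / n.factorial * ‖β‖ := by
    intro n
    induction n with
    | zero => intro β t; simpa using β.norm_coe_le_norm t
    | succ n ih =>
      intro β t
      rw [pow_succ', mul_apply_eq_comp]
      refine (hK _ t).trans ?_
      have h1 : ∫ s in (0 : ℝ)..t, ‖curveExt ((K ^ n) β) s‖ ≤
          ∫ s in (0 : ℝ)..t, (C ^ n / n.factorial * ‖β‖) * s ^ n := by
        refine intervalIntegral.integral_mono_on t.2.1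
          (continuous_curveExt _).norm.continuousOn.intervalIntegrable
          (by fun_prop : Continuous fun s : ℝ => _).continuousOn.intervalIntegrable ?_
        intro s hs
        have hs' : s ∈ Icc (0 : ℝ) 1 := ⟨hs.1, hs.2.trans t.2.2⟩
        rw [curveExt_of_mem _ hs']
        refine (ih β ⟨s, hs'⟩).trans (le_of_eq ?_)
        simp only [mul_pow]; ring
      calc C * ∫ s in (0 : ℝ)..t, ‖curveExt ((K ^ n) β) s‖
          ≤ C * ∫ s in (0 : ℝ)..t, (C ^ n / n.factorial * ‖β‖) * s ^ n := by gcongr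
        _ = (C * t) ^ (n + 1) / (n + 1).factorial * ‖β‖ := by
          rw [intervalIntegral.integral_const_mul, integral_pow, Nat.factorial_succ]
          push_cast
          field_simp
          ring
  have hnorm : ∀ n : ℕ, ‖K ^ n‖ ≤ C ^ n / n.factorial := by
    intro n
    refine ContinuousLinearMap.opNorm_le_bound _ (by positivity) fun β => ?_
    rw [ContinuousMap.norm_le _ (by positivity)]
    intro t
    refine (hpow n β t).trans ?_
    gcongr
    · exact mul_nonneg hC t.2.1
    · exact mul_le_of_le_one_right hC t.2.2
  obtain ⟨n, hn⟩ := ((FloorSemiring.tendsto_pow_div_factorial_atTop C).eventually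
    (gt_mem_nhds zero_lt_one)).exists
  have h1 : IsUnit (1 - K ^ n) := isUnit_one_sub_of_norm_lt_one
    (R := C(unitInterval, E) →L[ℝ] C(unitInterval, E)) ((hnorm n).trans_lt hn)
  rw [← mul_neg_geom_sum] at h1
  refine ((Commute.isUnit_mul_iff ?_).1 h1).1
  exact Commute.sum_right _ _ _ fun i _ =>
    ((Commute.one_left _).sub_left ((Commute.refl K).pow_right i))

end Integral

/-! ### Flows of convergent families of vector fields -/

section ODE

variable {E : Type} [NormedAddCommGroup E] [NormedSpace ℝ E]

/-- The curve `α` solves `α' = a(s) Y(α) + b(s) Z(α)` on `[0, 1]`. -/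
def IsSolution (a b : C(unitInterval, ℝ)) (Y Z : E → E) (α : C(unitInterval, E)) : Prop :=
  ∀ s : unitInterval,
    HasDerivWithinAt (curveExt α) (a s • Y (α s) + b s • Z (α s)) (Icc 0 1) s

/-- The constant curves. -/
def constCurve : E →L[ℝ] C(unitInterval, E) :=
  LinearMap.mkContinuous
    { toFun := fun x => ContinuousMap.const _ x
      map_add' := fun _ _ => rfl
      map_smul' := fun _ _ => rfl } 1
    (fun x => by
      rw [ContinuousMap.norm_le _ (by positivity)]
      intro s; exact (one_mul ‖x‖).ge)

@[simp] theorem constCurve_apply (x : E) (s : unitInterval) : constCurve x s = x := rfl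

/-- The integral equation `α - x - ∫ (a Y(α) + b Z(α)) = 0` as a map on pairs `(x, α)`. -/
def integralDefect (a b : C(unitInterval, ℝ)) (Y Z : E → E) (q : E × C(unitInterval, E)) :
    C(unitInterval, E) :=
  q.2 - constCurve q.1 - weightedPrimitive a (superpose Y q.2)
    - weightedPrimitive b (superpose Z q.2)

theorem integralDefect_eq_zero_iff [CompleteSpace E] {a b : C(unitInterval, ℝ)} {Y Z : E → E}
    {x : E} {α : C(unitInterval, E)} (hY : ∀ s, ContinuousAt Y (α s))
    (hZ : ∀ s, ContinuousAt Z (α s)) :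
    integralDefect a b Y Z (x, α) = 0 ↔ α 0 = x ∧ IsSolution a b Y Z α := by
  set v : ℝ → E := fun s => curveExt a s • curveExt (superpose Y α) s +
    curveExt b s • curveExt (superpose Z α) s with hv
  have hvc : Continuous v :=
    ((continuous_curveExt a).smul (continuous_curveExt _)).add
      ((continuous_curveExt b).smul (continuous_curveExt _))
  have hv1 : ∀ s : unitInterval, v s = a s • Y (α s) + b s • Z (α s) := fun s => by
    simp only [hv, curveExt_coe, superpose_apply hY, superpose_apply hZ]
  have hint : ∀ t : unitInterval, weightedPrimitive a (superpose Y α) t +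
      weightedPrimitive b (superpose Z α) t = ∫ s in (0 : ℝ)..t, v s := fun t => by
    rw [weightedPrimitive_apply, weightedPrimitive_apply, ← intervalIntegral.integral_add]
    · exact ((continuous_curveExt a).smul (continuous_curveExt _)).intervalIntegrable _ _
    · exact ((continuous_curveExt b).smul (continuous_curveExt _)).intervalIntegrable _ _
  have hiff : integralDefect a b Y Z (x, α) = 0 ↔
      ∀ t : unitInterval, α t = x + ∫ s in (0 : ℝ)..t, v s := by
    rw [ContinuousMap.ext_iff]
    refine forall_congr' fun t => ?_
    simp only [integralDefect, ContinuousMap.sub_apply, constCurve_apply, ContinuousMap.zero_apply,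
      ← hint]
    constructor
    · intro h; rw [sub_sub, sub_sub, sub_eq_zero] at h; rw [h]
    · intro h; rw [h]; abel
  rw [hiff]
  constructor
  · intro h
    refine ⟨by simpa using h 0, fun s => ?_⟩
    rw [← hv1]
    have h1 : HasDerivAt (fun t => x + ∫ s in (0 : ℝ)..t, v s) (v s) s :=
      (intervalIntegral.integral_hasDerivAt_right (hvc.intervalIntegrable _ _)
        (hvc.stronglyMeasurableAtFilter _ _) hvc.continuousAt).const_add x
    refine h1.hasDerivWithinAt.congr (fun t ht => ?_) ?_
    · rw [curveExt_of_mem _ ht]; exact h ⟨t, ht⟩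
    · rw [curveExt_coe]; exact h s
  · rintro ⟨h0, h⟩ t
    have h1 : ∫ s in (0 : ℝ)..t, v s = curveExt α t - curveExt α 0 := by
      refine intervalIntegral.integral_eq_sub_of_hasDerivAt_of_le t.2.1
        (continuous_curveExt α).continuousOn (fun s hs => ?_) (hvc.intervalIntegrable _ _)
      have hs' : s ∈ Ioo (0 : ℝ) 1 := ⟨hs.1, hs.2.trans_le t.2.2⟩
      have h2 := (h ⟨s, Ioo_subset_Icc_self hs'⟩).hasDerivAt (Icc_mem_nhds hs'.1 hs'.2)
      rw [← hv1] at h2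
      exact h2
    rw [h1, curveExt_coe]
    have h3 : curveExt α 0 = α 0 := curveExt_coe α 0
    rw [h3, h0]; abel

/-- **Convergence of flows.** If the fields `Y e`, `Z e` converge in `C^n` along a solution `α` of
the limit equation and the weights converge in `L¹`, the solutions through the points near `α 0`
exist on the whole of `[0, 1]` and converge in `C^n`, as curves, with respect to the initial
point. -/
theorem exists_flow [CompleteSpace E] {n : ℕ} (hn : n ≠ 0) {a b : ℝ≥0 → C(unitInterval, ℝ)}
    {Y Z : ℝ≥0 → E → E} {α : C(unitInterval, E)} {x : E}
    (ha : Tendsto (fun e => ∫ s in (0 : ℝ)..1, |curveExt (a e) s - curveExt (a 0) s|) (𝓝 0)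
      (𝓝 0))
    (hb : Tendsto (fun e => ∫ s in (0 : ℝ)..1, |curveExt (b e) s - curveExt (b 0) s|) (𝓝 0)
      (𝓝 0))
    (hY : ∀ s, CkConv n Y (α s)) (hZ : ∀ s, CkConv n Z (α s)) (hx : α 0 = x)
    (hα : IsSolution (a 0) (b 0) (Y 0) (Z 0) α) :
    ∃ Φ : ℝ≥0 → E → C(unitInterval, E), Φ 0 x = α ∧ CkConv n Φ x ∧
      ∀ᶠ p in 𝓝 ((0 : ℝ≥0), x), Φ p.1 p.2 0 = p.2 ∧
        IsSolution (a p.1) (b p.1) (Y p.1) (Z p.1) (Φ p.1 p.2) := by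
  have hsY := ckConv_superpose hY
  have hsZ := ckConv_superpose hZ
  set F : ℝ≥0 → E × C(unitInterval, E) → C(unitInterval, E) :=
    fun e => integralDefect (a e) (b e) (Y e) (Z e) with hF
  have hc1 : CkConv n (fun _ (q : E × C(unitInterval, E)) => q.2) (x, α) :=
    ContDiffAt.ckConv contDiffAt_snd
  have hprim : ∀ {a : ℝ≥0 → C(unitInterval, ℝ)} {Y : ℝ≥0 → E → E},
      Tendsto (fun e => ∫ s in (0 : ℝ)..1, |curveExt (a e) s - curveExt (a 0) s|) (𝓝 0) (𝓝 0) →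
      CkConv n (fun e => superpose (Y e)) α →
      CkConv n (fun e (q : E × C(unitInterval, E)) => weightedPrimitive (a e)
        (superpose (Y e) q.2)) (x, α) := by
    intro a Y ha hs
    have h1 : CkConv n (fun e (q : E × C(unitInterval, E)) => superpose (Y e) q.2) (x, α) :=
      CkConv.comp (g := fun e => superpose (Y e))
        (f := fun _ (q : E × C(unitInterval, E)) => q.2) hs hc1
    have h0 : CkConv n (fun e (_ : E × C(unitInterval, E)) =>
        (weightedPrimitive (a e) : C(unitInterval, E) →L[ℝ] C(unitInterval, E))) (x, α) :=
      ckConv_const (F := C(unitInterval, E) →L[ℝ] C(unitInterval, E))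
        (c := fun e => weightedPrimitive (a e)) (tendsto_weightedPrimitive ha) (x, α)
    have h2 := h0.prodMk h1
    exact CkConv.contDiff_comp (g := fun q : (C(unitInterval, E) →L[ℝ] C(unitInterval, E)) ×
      C(unitInterval, E) => q.1 q.2) (contDiff_fst.clm_apply contDiff_snd).contDiffAt h2
  have hFc : CkConv n F (x, α) := by
    have h1 : CkConv n (fun _ (q : E × C(unitInterval, E)) => constCurve q.1) (x, α) :=
      CkConv.contDiff_comp (f := fun _ (q : E × C(unitInterval, E)) => q.1)
        (constCurve (E := E)).contDiff.contDiffAt (ContDiffAt.ckConv contDiffAt_fst)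
    exact ((hc1.sub h1).sub (hprim ha hsY)).sub (hprim hb hsZ)
  have hYc : ∀ s, ContinuousAt (Y 0) (α s) := fun s => (hY s).at.continuousAt
  have hZc : ∀ s, ContinuousAt (Z 0) (α s) := fun s => (hZ s).at.continuousAt
  have h0 : F 0 (x, α) = 0 := (integralDefect_eq_zero_iff hYc hZc).2 ⟨hx, hα⟩
  have hinv : (fderiv ℝ (F 0) (x, α) ∘L .inr ℝ E C(unitInterval, E)).IsInvertible := by
    set MY := curveApply (superpose (fderiv ℝ (Y 0)) α)
    set MZ := curveApply (superpose (fderiv ℝ (Z 0)) α)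
    set K : C(unitInterval, E) →L[ℝ] C(unitInterval, E) :=
      weightedPrimitive (a 0) ∘L MY + weightedPrimitive (b 0) ∘L MZ with hK
    have hder : HasFDerivAt (fun β => F 0 (x, β)) (1 - K) α := by
      have h1 : ∀ s, ContDiffAt ℝ 1 (Y 0) (α s) := fun s => by
        simpa using ((hY s).at.mono (m := 1) (by omega)).1.self_of_nhds
      have h2 : ∀ s, ContDiffAt ℝ 1 (Z 0) (α s) := fun s => by
        simpa using ((hZ s).at.mono (m := 1) (by omega)).1.self_of_nhds
      have h3 := ((((hasFDerivAt_id (𝕜 := ℝ) α).sub_const (constCurve x)).sub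
        ((weightedPrimitive (a 0)).hasFDerivAt.comp α (hasFDerivAt_superpose h1))).sub
        ((weightedPrimitive (b 0)).hasFDerivAt.comp α (hasFDerivAt_superpose h2)))
      refine h3.congr_fderiv ?_
      rw [hK, sub_sub]; rfl
    have hchain : fderiv ℝ (F 0) (x, α) ∘L .inr ℝ E C(unitInterval, E) = 1 - K := by
      have hd : DifferentiableAt ℝ (F 0) (x, α) :=
        ((hFc.at.mono (m := 1) (by omega)).differentiableAt).self_of_nhds
      have h2 : HasFDerivAt (fun β : C(unitInterval, E) => (x, β))
          (.inr ℝ E C(unitInterval, E)) α := hasFDerivAt_prodMk_right x α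
      exact (HasFDerivAt.comp α hd.hasFDerivAt h2).unique hder
    have hunit : IsUnit (1 - K) := by
      set A := superpose (fderiv ℝ (Y 0)) α
      set B := superpose (fderiv ℝ (Z 0)) α
      have hb1 : ∀ (c : C(unitInterval, ℝ)) (A : C(unitInterval, E →L[ℝ] E)) (β : C(unitInterval, E))
          (t : unitInterval), ‖weightedPrimitive c (curveApply A β) t‖ ≤
            ‖c‖ * ‖A‖ * ∫ s in (0 : ℝ)..t, ‖curveExt β s‖ := by
        intro c A β t
        rw [weightedPrimitive_apply, ← intervalIntegral.integral_const_mul]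
        refine intervalIntegral.norm_integral_le_of_norm_le t.2.1 ?_
          ((continuous_const.mul (continuous_curveExt β).norm).intervalIntegrable _ _)
        refine Eventually.of_forall fun s _ => ?_
        rw [norm_smul, mul_assoc]
        refine mul_le_mul (norm_curveExt_le c s) ?_ (norm_nonneg _) (norm_nonneg _)
        refine ((A _).le_opNorm _).trans ?_
        exact mul_le_mul_of_nonneg_right (A.norm_coe_le_norm _) (norm_nonneg _)
      refine isUnit_one_sub_volterra (C := ‖a 0‖ * ‖A‖ + ‖b 0‖ * ‖B‖) (by positivity) K ?_
      intro β t
      refine (norm_add_le _ _).trans ?_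
      rw [add_mul]
      exact add_le_add (hb1 _ _ _ _) (hb1 _ _ _ _)
    rw [hchain]
    obtain ⟨u, hu⟩ := hunit
    exact ⟨ContinuousLinearEquiv.unitsEquiv ℝ _ u, by rw [← hu]; rfl⟩
  obtain ⟨Φ, hΦ0, hΦ, hΦF⟩ := exists_implicit_of_ckConv hn hFc h0 hinv
  refine ⟨Φ, hΦ0, hΦ, ?_⟩
  have hcY : ∀ {Y : ℝ≥0 → E → E}, (∀ s, CkConv n Y (α s)) →
      ∀ᶠ p in 𝓝 ((0 : ℝ≥0), x), ∀ s, ContinuousAt (Y p.1) (Φ p.1 p.2 s) := by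
    intro Y hY
    refine hΦ.eventually_comp (P := fun q => ∀ s, ContinuousAt (Y q.1) (q.2 s)) ?_
    rw [hΦ0]
    exact eventually_forall_curve (P := fun q => ContinuousAt (Y q.1) q.2)
      fun s => (hY s).at.1.mono fun p hp => hp.continuousAt
  filter_upwards [hΦF, hcY hY, hcY hZ] with p hp h1 h2
  exact (integralDefect_eq_zero_iff h1 h2).1 hp

/-- Evaluation of a convergent family of curves. -/
theorem CkConv.eval {n : ℕ} {X : Type} [NormedAddCommGroup X] [NormedSpace ℝ X]
    {Φ : ℝ≥0 → X → C(unitInterval, E)} {x : X} (h : CkConv n Φ x)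
    (s : unitInterval) : CkConv n (fun e y => Φ e y s) x :=
  h.contDiff_comp (g := fun α : C(unitInterval, E) => α s)
    ((ContinuousMap.evalCLM ℝ s : C(unitInterval, E) →L[ℝ] E).contDiff.contDiffAt)

/-- A property that holds near each point of the limit curve holds along the nearby curves. -/
theorem CkConv.eventually_forall_curve {n : ℕ} {X : Type} [NormedAddCommGroup X] [NormedSpace ℝ X]
    {Φ : ℝ≥0 → X → C(unitInterval, E)} {x : X} (h : CkConv n Φ x)
    {P : ℝ≥0 × E → Prop} (hP : ∀ s, ∀ᶠ p in 𝓝 ((0 : ℝ≥0), Φ 0 x s), P p) :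
    ∀ᶠ p in 𝓝 ((0 : ℝ≥0), x), ∀ s, P (p.1, Φ p.1 p.2 s) :=
  h.eventually_comp (P := fun q => ∀ s, P (q.1, q.2 s)) (SoftBilliard.eventually_forall_curve hP)

end ODE

/-! ### Changes of time and concatenation of curves -/

theorem hasDerivWithinAt_inverse {f g : ℝ → ℝ} {f' y : ℝ} {s t : Set ℝ}
    (hg : Tendsto g (𝓝[s] y) (𝓝[t] (g y))) (hf : HasDerivWithinAt f f' t (g y)) (hf' : f' ≠ 0)
    (hy : y ∈ s) (hfg : ∀ᶠ x in 𝓝[s] y, f (g x) = x) : HasDerivWithinAt g f'⁻¹ s y := by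
  have h1 : HasFDerivWithinAt f
      (ContinuousLinearEquiv.unitsEquivAut ℝ (Units.mk0 f' hf') : ℝ →L[ℝ] ℝ) t (g y) := by
    refine hf.hasFDerivWithinAt.congr_fderiv ?_
    ext; simp
  have h2 := HasFDerivWithinAt.of_local_left_inverse hg h1 hy hfg
  exact h2.hasDerivWithinAt.congr_deriv (by simp)

/-- The inverse of a function on an interval with positive derivative. -/
theorem exists_inverse_of_deriv_pos {f f' : ℝ → ℝ} {a b : ℝ} (hab : a ≤ b)
    (hf : ∀ s ∈ Icc a b, HasDerivWithinAt f (f' s) (Icc a b) s) (hpos : ∀ s ∈ Icc a b, 0 < f' s) :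
    StrictMonoOn f (Icc a b) ∧ ∃ g : ℝ → ℝ, (∀ s ∈ Icc a b, g (f s) = s) ∧
      ∀ y ∈ Icc (f a) (f b), g y ∈ Icc a b ∧ f (g y) = y ∧
        HasDerivWithinAt g (f' (g y))⁻¹ (Icc (f a) (f b)) y := by
  have hc : ContinuousOn f (Icc a b) := fun s hs => (hf s hs).continuousWithinAt
  have hmono : StrictMonoOn f (Icc a b) := by
    refine strictMonoOn_of_hasDerivWithinAt_pos (f' := f') (convex_Icc a b) hc ?_ ?_
    · exact fun s hs => (hf s (interior_subset hs)).mono interior_subset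
    · exact fun s hs => hpos s (interior_subset hs)
  refine ⟨hmono, Function.invFunOn f (Icc a b), fun s hs => hmono.injOn.leftInvOn_invFunOn hs, ?_⟩
  set g := Function.invFunOn f (Icc a b)
  have hgf : ∀ s ∈ Icc a b, g (f s) = s := fun s hs => hmono.injOn.leftInvOn_invFunOn hs
  have himg : f '' Icc a b = Icc (f a) (f b) := by
    refine Subset.antisymm ?_ (intermediate_value_Icc hab hc)
    rintro _ ⟨s, hs, rfl⟩
    exact ⟨hmono.monotoneOn (left_mem_Icc.2 hab) hs hs.1,
      hmono.monotoneOn hs (right_mem_Icc.2 hab) hs.2⟩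
  have hmem : ∀ y ∈ Icc (f a) (f b), g y ∈ Icc a b ∧ f (g y) = y := by
    intro y hy
    rw [← himg] at hy
    exact ⟨Function.invFunOn_mem hy, Function.invFunOn_eq hy⟩
  have hgc : ContinuousOn g (Icc (f a) (f b)) := by
    have hoc : OrdConnected (f '' Icc a b) := by rw [himg]; exact ordConnected_Icc
    have h1 := (hmono.orderIso f (Icc a b)).symm.continuous
    rw [← himg, continuousOn_iff_continuous_domRestrict]
    refine (continuous_subtype_val.comp h1).congr fun y => ?_
    obtain ⟨y, s, hs, rfl⟩ := y
    simp only [Function.comp_apply, Set.domRestrict_apply]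
    rw [hgf s hs]
    have : (⟨f s, ⟨s, hs, rfl⟩⟩ : f '' Icc a b) = hmono.orderIso f (Icc a b) ⟨s, hs⟩ := rfl
    rw [this, OrderIso.symm_apply_apply]
  intro y hy
  refine ⟨(hmem y hy).1, (hmem y hy).2, ?_⟩
  refine hasDerivWithinAt_inverse (t := Icc a b) ?_ (hf _ (hmem y hy).1)
    (hpos _ (hmem y hy).1).ne' hy ?_
  · exact tendsto_nhdsWithin_iff.2 ⟨hgc y hy, eventually_mem_nhdsWithin.mono
      fun x hx => (hmem x hx).1⟩
  · exact eventually_mem_nhdsWithin.mono fun x hx => (hmem x hx).2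

section Concat

variable {E : Type*} [NormedAddCommGroup E] [NormedSpace ℝ E]

/-- The curve `f` on `(-∞, a]` followed by the curve `g`, restarted at time `a`. -/
def concat {X : Type*} (a : ℝ) (f g : ℝ → X) (u : ℝ) : X := if u ≤ a then f u else g (u - a)

theorem concat_of_le {X : Type*} {a : ℝ} {f g : ℝ → X} {u : ℝ} (h : u ≤ a) :
    concat a f g u = f u := if_pos h

theorem concat_of_ge {X : Type*} {a : ℝ} {f g : ℝ → X} (hm : f a = g 0) {u : ℝ} (h : a ≤ u) :
    concat a f g u = g (u - a) := by
  rcases h.eq_or_lt with rfl | h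
  · simp [concat, hm]
  · exact if_neg h.not_ge

theorem hasDerivWithinAt_concat {f g : ℝ → E} {a b : ℝ} (ha : 0 ≤ a) (hb : 0 ≤ b) (hm : f a = g 0)
    {u : ℝ} {v : E} (h1 : u ≤ a → HasDerivWithinAt f v (Icc 0 a) u)
    (h2 : a ≤ u → HasDerivWithinAt g v (Icc 0 b) (u - a)) :
    HasDerivWithinAt (concat a f g) v (Icc 0 (a + b)) u := by
  have hU : Icc 0 (a + b) = Icc 0 a ∪ Icc a (a + b) :=
    (Icc_union_Icc_eq_Icc ha (by linarith)).symm
  rw [hU]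
  refine HasDerivWithinAt.union ?_ ?_
  · by_cases hu : u ≤ a
    · exact (h1 hu).congr (fun x hx => concat_of_le hx.2) (concat_of_le hu)
    · refine hasDerivWithinAt_iff_hasFDerivWithinAt.2 (HasFDerivWithinAt.of_notMem_closure ?_)
      rw [isClosed_Icc.closure_eq]
      exact fun h => hu h.2
  · by_cases hu : a ≤ u
    · have h3 : HasDerivWithinAt (fun x : ℝ => x - a) 1 (Icc a (a + b)) u :=
        (hasDerivAt_id u).sub_const a |>.hasDerivWithinAt
      have h4 := HasDerivWithinAt.scomp (h := fun x : ℝ => x - a) u (h2 hu) h3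
        (fun x hx => ⟨by linarith [hx.1], by linarith [hx.2]⟩)
      rw [one_smul] at h4
      exact h4.congr (fun x hx => concat_of_ge hm hx.1) (concat_of_ge hm hu)
    · refine hasDerivWithinAt_iff_hasFDerivWithinAt.2 (HasFDerivWithinAt.of_notMem_closure ?_)
      rw [isClosed_Icc.closure_eq]
      exact fun h => hu h.1

end Concat

/-! ### Hamiltonian trajectories -/

section Hamiltonian

variable {d : ℕ} {V : Config d → EReal}

theorem gradient_hamiltonian_momentum (q p : Config d) :
    gradient (fun p => hamiltonian V q p) p = p := by
  have h1 : HasFDerivAt (fun p : Config d => hamiltonian V q p) (innerSL ℝ p) p := by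
    have h2 := ((hasStrictFDerivAt_norm_sq p).hasFDerivAt.const_mul (2⁻¹ : ℝ)).add_const
      (V q).toReal
    have h3 : (fun p : Config d => hamiltonian V q p) =
        fun p => 2⁻¹ * ‖p‖ ^ 2 + (V q).toReal := by
      ext p; rw [hamiltonian]; ring
    rw [h3]
    refine h2.congr_fderiv ?_
    ext x; simp
  rw [gradient, h1.fderiv]
  exact (InnerProductSpace.toDual ℝ (Config d)).symm_apply_apply p

theorem gradient_hamiltonian_position (q p : Config d) :
    gradient (fun q => hamiltonian V q p) q = gradient (fun q => (V q).toReal) q := by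
  simp only [gradient, hamiltonian, fderiv_const_add]

theorem isHamiltonianSolution_iff {t : ℝ} {γ : ℝ → Phase d} :
    IsHamiltonianSolution V t γ ↔ ∀ s ∈ Icc 0 t, V (γ s).1 ≠ ⊤ ∧
      HasDerivWithinAt (fun u => (γ u).1) (γ s).2 (Icc 0 t) s ∧
      HasDerivWithinAt (fun u => (γ u).2) (-gradient (fun q => (V q).toReal) (γ s).1)
        (Icc 0 t) s := by
  simp only [IsHamiltonianSolution, gradient_hamiltonian_momentum, gradient_hamiltonian_position]

/-- The Hamiltonian flow of `V` moves `z` to `z'` in time `τ ≥ 0`. -/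
def HamStep (V : Config d → EReal) (τ : ℝ) (z z' : Phase d) : Prop :=
  0 ≤ τ ∧ ∃ γ, IsHamiltonianSolution V τ γ ∧ γ 0 = z ∧ γ τ = z'

theorem HamStep.trans {τ₁ τ₂ : ℝ} {z₁ z₂ z₃ : Phase d} (h : HamStep V τ₁ z₁ z₂)
    (h' : HamStep V τ₂ z₂ z₃) : HamStep V (τ₁ + τ₂) z₁ z₃ := by
  obtain ⟨h0, γ₁, hγ₁, h1, h2⟩ := h
  obtain ⟨h0', γ₂, hγ₂, h3, h4⟩ := h'
  have hm : γ₁ τ₁ = γ₂ 0 := by rw [h2, h3]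
  refine ⟨by positivity, concat τ₁ γ₁ γ₂, ?_, ?_, ?_⟩
  · rw [isHamiltonianSolution_iff] at hγ₁ hγ₂ ⊢
    intro s hs
    have hfst : ∀ u, (concat τ₁ γ₁ γ₂ u).1 =
        concat τ₁ (fun u => (γ₁ u).1) (fun u => (γ₂ u).1) u := fun u => by
      unfold concat; split_ifs <;> rfl
    have hsnd : ∀ u, (concat τ₁ γ₁ γ₂ u).2 =
        concat τ₁ (fun u => (γ₁ u).2) (fun u => (γ₂ u).2) u := fun u => by
      unfold concat; split_ifs <;> rfl
    refine ⟨?_, ?_, ?_⟩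
    · rcases le_total s τ₁ with hle | hle
      · rw [concat_of_le hle]; exact (hγ₁ s ⟨hs.1, hle⟩).1
      · rw [concat_of_ge hm hle]
        exact (hγ₂ (s - τ₁) ⟨by linarith, by linarith [hs.2]⟩).1
    · simp only [hfst]
      refine hasDerivWithinAt_concat h0 h0' (by rw [hm]) (fun hle => ?_) (fun hle => ?_)
      · rw [concat_of_le hle]; exact (hγ₁ s ⟨hs.1, hle⟩).2.1
      · rw [concat_of_ge hm hle]
        exact (hγ₂ (s - τ₁) ⟨by linarith, by linarith [hs.2]⟩).2.1
    · simp only [hsnd]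
      refine hasDerivWithinAt_concat h0 h0' (by rw [hm]) (fun hle => ?_) (fun hle => ?_)
      · rw [concat_of_le hle]; exact (hγ₁ s ⟨hs.1, hle⟩).2.2
      · rw [concat_of_ge hm hle]
        exact (hγ₂ (s - τ₁) ⟨by linarith, by linarith [hs.2]⟩).2.2
  · rw [concat_of_le h0, h1]
  · rw [concat_of_ge hm (by linarith), add_sub_cancel_left, h4]

/-- A solution of Hamilton's equations run with a variable positive speed `θ = t'` is, up to the
change of time, a Hamiltonian trajectory. -/
theorem hamStep_of_timeChange {q p : ℝ → Config d} {t θ : ℝ → ℝ}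
    (hθ : ∀ s ∈ Icc (0 : ℝ) 1, 0 < θ s)
    (ht : ∀ s ∈ Icc (0 : ℝ) 1, HasDerivWithinAt t (θ s) (Icc 0 1) s)
    (hq : ∀ s ∈ Icc (0 : ℝ) 1, HasDerivWithinAt q (θ s • p s) (Icc 0 1) s)
    (hp : ∀ s ∈ Icc (0 : ℝ) 1,
      HasDerivWithinAt p (-(θ s • gradient (fun q => (V q).toReal) (q s))) (Icc 0 1) s)
    (hV : ∀ s ∈ Icc (0 : ℝ) 1, V (q s) ≠ ⊤) :
    HamStep V (t 1 - t 0) (q 0, p 0) (q 1, p 1) := by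
  obtain ⟨hmono, g, hgf, hg⟩ := exists_inverse_of_deriv_pos zero_le_one ht hθ
  have h01 : t 0 ≤ t 1 :=
    hmono.monotoneOn (left_mem_Icc.2 zero_le_one) (right_mem_Icc.2 zero_le_one) zero_le_one
  refine ⟨by linarith, fun u => (q (g (u + t 0)), p (g (u + t 0))), ?_, ?_, ?_⟩
  · rw [isHamiltonianSolution_iff]
    intro u hu
    have hu' : u + t 0 ∈ Icc (t 0) (t 1) := ⟨by linarith [hu.1], by linarith [hu.2]⟩
    obtain ⟨hgm, hfg, hgd⟩ := hg _ hu'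
    have hshift : HasDerivWithinAt (fun u => g (u + t 0)) (θ (g (u + t 0)))⁻¹
        (Icc 0 (t 1 - t 0)) u := by
      have h3 : HasDerivWithinAt (fun x : ℝ => x + t 0) 1 (Icc 0 (t 1 - t 0)) u :=
        (hasDerivAt_id u).add_const _ |>.hasDerivWithinAt
      have h4 := HasDerivWithinAt.scomp (h := fun x : ℝ => x + t 0) u hgd h3
        (fun x hx => ⟨by linarith [hx.1], by linarith [hx.2]⟩)
      rwa [one_smul] at h4
    have hmaps : MapsTo (fun u => g (u + t 0)) (Icc 0 (t 1 - t 0)) (Icc 0 1) :=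
      fun x hx => (hg (x + t 0) ⟨by linarith [hx.1], by linarith [hx.2]⟩).1
    have hne := (hθ _ hgm).ne'
    refine ⟨hV _ hgm, ?_, ?_⟩
    · have h5 := HasDerivWithinAt.scomp (h := fun u => g (u + t 0)) u (hq _ hgm) hshift hmaps
      rwa [smul_smul, inv_mul_cancel₀ hne, one_smul] at h5
    · have h5 := HasDerivWithinAt.scomp (h := fun u => g (u + t 0)) u (hp _ hgm) hshift hmaps
      rwa [smul_neg, smul_smul, inv_mul_cancel₀ hne, one_smul] at h5
  · simp [hgf 0 (left_mem_Icc.2 zero_le_one)]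
  · simp [hgf 1 (right_mem_Icc.2 zero_le_one)]

/-- Trajectories are determined by their initial point where the potential is `C²`. -/
theorem IsHamiltonianSolution.eq_of_eq {t : ℝ} {γ₁ γ₂ : ℝ → Phase d} (hVc : Continuous V)
    (hV : ContDiffOn ℝ 2 (fun q => (V q).toReal) {q | V q ≠ ⊤})
    (h₁ : IsHamiltonianSolution V t γ₁) (h₂ : IsHamiltonianSolution V t γ₂) (h0 : γ₁ 0 = γ₂ 0) :
    EqOn γ₁ γ₂ (Icc 0 t) := by
  rw [isHamiltonianSolution_iff] at h₁ h₂
  set U : Config d → ℝ := fun q => (V q).toReal with hU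
  set v : Phase d → Phase d := fun z => (z.2, -gradient U z.1) with hv
  have hopen : IsOpen {q | V q ≠ ⊤} := isOpen_ne.preimage hVc
  have hvsmooth : ∀ z : Phase d, V z.1 ≠ ⊤ → ContDiffAt ℝ 1 v z := by
    intro z hz
    have h1 : ContDiffAt ℝ 2 U z.1 := hV.contDiffAt (hopen.mem_nhds hz)
    have h2 : ContDiffAt ℝ 1 (gradient U) z.1 :=
      (InnerProductSpace.toDual ℝ (Config d)).symm.contDiff.contDiffAt.comp z.1
        (h1.fderiv_right (by norm_num))
    exact contDiffAt_snd.prodMk (h2.comp z contDiffAt_fst).neg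
  have hder : ∀ {γ : ℝ → Phase d}, (∀ s ∈ Icc 0 t, V (γ s).1 ≠ ⊤ ∧
      HasDerivWithinAt (fun u => (γ u).1) (γ s).2 (Icc 0 t) s ∧
      HasDerivWithinAt (fun u => (γ u).2) (-gradient U (γ s).1) (Icc 0 t) s) →
      ∀ s ∈ Icc 0 t, HasDerivWithinAt γ (v (γ s)) (Icc 0 t) s := by
    intro γ h s hs
    exact (h s hs).2.1.prodMk (h s hs).2.2
  have hd₁ := hder h₁
  have hd₂ := hder h₂
  have hc₁ : ContinuousOn γ₁ (Icc 0 t) := fun s hs => (hd₁ s hs).continuousWithinAt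
  have hc₂ : ContinuousOn γ₂ (Icc 0 t) := fun s hs => (hd₂ s hs).continuousWithinAt
  set K := γ₁ '' Icc 0 t ∪ γ₂ '' Icc 0 t with hK
  have hKc : IsCompact K := (isCompact_Icc.image_of_continuousOn hc₁).union
    (isCompact_Icc.image_of_continuousOn hc₂)
  have hKV : ∀ z ∈ K, V z.1 ≠ ⊤ := by
    rintro z (⟨s, hs, rfl⟩ | ⟨s, hs, rfl⟩)
    · exact (h₁ s hs).1
    · exact (h₂ s hs).1
  obtain ⟨C, hC⟩ : ∃ C, LipschitzOnWith C v K := by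
    refine LocallyLipschitzOn.exists_lipschitzOnWith_of_compact hKc fun z hz => ?_
    obtain ⟨C, u, hu, hCu⟩ := (hvsmooth z (hKV z hz)).exists_lipschitzOnWith
    exact ⟨C, u, mem_nhdsWithin_of_mem_nhds hu, hCu⟩
  have hIci : ∀ {γ : ℝ → Phase d}, (∀ s ∈ Icc 0 t, HasDerivWithinAt γ (v (γ s)) (Icc 0 t) s) →
      ∀ s ∈ Ico 0 t, HasDerivWithinAt γ (v (γ s)) (Ici s) s := by
    intro γ h s hs
    refine (h s (Ico_subset_Icc_self hs)).mono_of_mem_nhdsWithin ?_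
    exact mem_of_superset (Icc_mem_nhdsGE hs.2) (Icc_subset_Icc_left hs.1)
  exact ODE_solution_unique_of_mem_Icc_right (v := fun _ => v) (s := fun _ => K) (K := C)
    (fun _ _ => hC) hc₁ (hIci hd₁)
    (fun s hs => Or.inl ⟨s, Ico_subset_Icc_self hs, rfl⟩) hc₂ (hIci hd₂)
    (fun s hs => Or.inr ⟨s, Ico_subset_Icc_self hs, rfl⟩) h0

theorem HamStep.flowDefined {τ : ℝ} {z z' : Phase d} (h : HamStep V τ z z') :
    HamiltonianFlowDefined V τ z := by
  obtain ⟨-, γ, hγ, h1, -⟩ := h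
  exact ⟨γ, hγ, h1⟩

theorem HamStep.flow_eq {τ : ℝ} {z z' : Phase d} (hVc : Continuous V)
    (hV : ContDiffOn ℝ 2 (fun q => (V q).toReal) {q | V q ≠ ⊤}) (h : HamStep V τ z z') :
    hamiltonianFlow V τ z = z' := by
  have hdef := h.flowDefined
  obtain ⟨h0, γ, hγ, h1, h2⟩ := h
  rw [hamiltonianFlow, dif_pos hdef]
  have := hdef.choose_spec.1.eq_of_eq hVc hV hγ (by rw [hdef.choose_spec.2, h1])
    (right_mem_Icc.2 h0)
  rw [this, h2]

end Hamiltonian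

/-! ### Billiard trajectories -/

section Billiard

variable {d : ℕ}

/-- If `{f ≥ f q} ⊆ {g ≥ g q}` near `q`, the gradient of `g` is nonnegative in all directions in
which `f` increases. -/
theorem inner_gradient_nonneg_of_superlevel {f g : Config d → ℝ} {q v : Config d}
    (hf : DifferentiableAt ℝ f q) (hg : DifferentiableAt ℝ g q)
    (hfg : ∀ᶠ x in 𝓝 q, f q ≤ f x → g q ≤ g x) (hv : 0 < inner ℝ (gradient f q) v) :
    0 ≤ inner ℝ (gradient g q) v := by
  have hline : ∀ {h : Config d → ℝ}, DifferentiableAt ℝ h q →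
      HasDerivAt (fun t : ℝ => h (q + t • v)) (inner ℝ (gradient h q) v) 0 := by
    intro h hh
    have h1 : HasDerivAt (fun t : ℝ => q + t • v) v 0 := by
      simpa using ((hasDerivAt_id (0 : ℝ)).smul_const v).const_add q
    have h2 : HasFDerivAt h (fderiv ℝ h q) (q + (0 : ℝ) • v) := by simpa using hh.hasFDerivAt
    have h3 := h2.comp_hasDerivAt (0 : ℝ) h1
    have h4 : fderiv ℝ h q v = inner ℝ (gradient h q) v := by
      rw [gradient, InnerProductSpace.toDual_symm_apply]
    rw [← h4]; exact h3
  have hfl := hline hf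
  have hgl := hline hg
  have hcont : Tendsto (fun t : ℝ => q + t • v) (𝓝[>] 0) (𝓝 q) := by
    have : ContinuousAt (fun t : ℝ => q + t • v) 0 := by fun_prop
    have h2 := this.tendsto
    simp only [zero_smul, add_zero] at h2
    exact h2.mono_left nhdsWithin_le_nhds
  have hfpos : ∀ᶠ t in 𝓝[>] (0 : ℝ), f q ≤ f (q + t • v) := by
    have h1 := (hasDerivAt_iff_tendsto_slope.1 hfl).mono_left
      (nhdsWithin_mono (0 : ℝ) (s := Ioi 0) fun t (ht : 0 < t) => ht.ne')
    filter_upwards [h1.eventually (lt_mem_nhds hv), self_mem_nhdsWithin] with t ht ht0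
    rw [slope_def_field, sub_zero] at ht
    have := (div_pos_iff_of_pos_right (show (0 : ℝ) < t from ht0)).1 ht
    simp only [zero_smul, add_zero] at this
    linarith
  have h1 := (hasDerivAt_iff_tendsto_slope.1 hgl).mono_left
    (nhdsWithin_mono (0 : ℝ) (s := Ioi 0) fun t (ht : 0 < t) => ht.ne')
  refine ge_of_tendsto h1 ?_
  filter_upwards [hfpos, hcont.eventually hfg, self_mem_nhdsWithin] with t ht ht1 ht0
  rw [slope_def_field, sub_zero]
  have := ht1 ht
  simp only [zero_smul, add_zero]
  exact div_nonneg (by linarith) (show (0 : ℝ) < t from ht0).le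

/-- The inward normal is determined by the region. -/
theorem IsInwardNormal.unique {D : Set (Config d)} {q n n' : Config d}
    (h : IsInwardNormal D q n) (h' : IsInwardNormal D q n') : n = n' := by
  obtain ⟨f, hf, hf0, hfD, rfl⟩ := h
  obtain ⟨g, hg, hg0, hgD, rfl⟩ := h'
  have hfd := hf.differentiableAt (by simp)
  have hgd := hg.differentiableAt (by simp)
  by_contra hne
  set a := ‖gradient f q‖⁻¹ • gradient f q
  set b := ‖gradient g q‖⁻¹ • gradient g q
  have ha : ‖a‖ = 1 := norm_smul_inv_norm (𝕜 := ℝ) hf0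
  have hb : ‖b‖ = 1 := norm_smul_inv_norm (𝕜 := ℝ) hg0
  -- the direction `a - b` enters the region according to `f` and leaves it according to `g`
  have hlt : inner ℝ a b < 1 := inner_lt_one_iff_real_of_norm_eq_one ha hb |>.2 hne
  have h1 : 0 < inner ℝ a (a - b) := by
    rw [inner_sub_right, real_inner_self_eq_norm_sq, ha]; linarith
  have h2 : inner ℝ b (a - b) < 0 := by
    rw [inner_sub_right, real_inner_self_eq_norm_sq, hb, real_inner_comm]; linarith
  have h3 : 0 < inner ℝ (gradient f q) (a - b) := by
    rw [real_inner_smul_left] at h1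
    exact pos_of_mul_pos_right h1 (by positivity)
  have h4 := inner_gradient_nonneg_of_superlevel hfd hgd
    (by filter_upwards [hfD, hgD] with x hx hx' h using hx'.1 (hx.2 h)) h3
  rw [real_inner_smul_left] at h2
  have : 0 ≤ ‖gradient g q‖⁻¹ * inner ℝ (gradient g q) (a - b) := by positivity
  linarith

variable {r : ℕ} {ι : Type*} {B : BilliardTable d r ι}

theorem BilliardTable.IsTrajectory.mono {T T' : ℝ} {γ : ℝ → Phase d} (h : B.IsTrajectory T γ)
    (hT : T' ≤ T) : B.IsTrajectory T' γ where
  mem_domain t ht := h.mem_domain t ⟨ht.1, ht.2.trans hT⟩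
  continuousOn := h.continuousOn.mono (Icc_subset_Icc_right hT)
  finite_collisions := h.finite_collisions.subset fun _ ht => ⟨⟨ht.1.1, ht.1.2.trans hT⟩, ht.2⟩
  free s t h0 hst htT := h.free s t h0 hst (htT.trans hT)
  collision t ht := h.collision t ⟨ht.1, ht.2.trans hT⟩

/-- Collision times are isolated. -/
theorem BilliardTable.IsTrajectory.eventually_free {T : ℝ} {γ : ℝ → Phase d}
    (h : B.IsTrajectory T γ) (t : ℝ) :
    ∃ η > 0, ∀ u ∈ Icc 0 T, |u - t| < η → u ≠ t → (γ u).1 ∉ frontier B.domain := by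
  have hfin := h.finite_collisions.subset
    (sdiff_subset : {u | u ∈ Icc 0 T ∧ (γ u).1 ∈ frontier B.domain} \ {t} ⊆ _)
  have hmem : ({u | u ∈ Icc 0 T ∧ (γ u).1 ∈ frontier B.domain} \ {t})ᶜ ∈ 𝓝 t :=
    hfin.isClosed.isOpen_compl.mem_nhds (by simp)
  obtain ⟨η, hη, hball⟩ := Metric.mem_nhds_iff.1 hmem
  refine ⟨η, hη, fun u hu hut hne hfr => ?_⟩
  have := hball (show u ∈ Metric.ball t η by rw [Metric.mem_ball, Real.dist_eq]; exact hut)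
  exact this ⟨⟨hu, hfr⟩, hne⟩

/-- On a stretch without collisions the momentum has a left limit at the end. -/
theorem BilliardTable.IsTrajectory.tendsto_momentum {T s t : ℝ} {γ : ℝ → Phase d}
    (h : B.IsTrajectory T γ) (hs : 0 ≤ s) (hst : s < t) (htT : t ≤ T)
    (hfree : ∀ u ∈ Ioo s t, (γ u).1 ∉ frontier B.domain) :
    Tendsto (fun u => (γ u).2) (𝓝[<] t) (𝓝 (γ s).2) := by
  refine tendsto_const_nhds.congr' ?_
  filter_upwards [Ioo_mem_nhdsLT hst] with u hu
  exact ((h.free s u hs hu.1.le (hu.2.le.trans htT)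
    fun v hv => hfree v ⟨hv.1, hv.2.trans_lt hu.2⟩).1).symm

/-- A billiard trajectory is determined by its initial point. -/
theorem BilliardTable.IsTrajectory.eq_of_eq {T : ℝ} {γ₁ γ₂ : ℝ → Phase d}
    (h₁ : B.IsTrajectory T γ₁) (h₂ : B.IsTrajectory T γ₂) (h0 : γ₁ 0 = γ₂ 0) :
    EqOn γ₁ γ₂ (Icc 0 T) := by
  rcases lt_or_ge T 0 with hT | hT
  · rw [Icc_eq_empty hT.not_ge]; exact eqOn_empty _ _
  -- agreement up to a time propagates beyond it
  have hright : ∀ s ∈ Ico 0 T, EqOn γ₁ γ₂ (Icc 0 s) → ∃ η > 0, ∀ u ∈ Icc 0 T, u < s + η →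
      γ₁ u = γ₂ u := by
    intro s hs heq
    obtain ⟨η₁, hη₁, hf₁⟩ := h₁.eventually_free s
    obtain ⟨η₂, hη₂, hf₂⟩ := h₂.eventually_free s
    refine ⟨min η₁ η₂, by positivity, fun u hu hlt => ?_⟩
    rcases le_or_gt u s with hus | hus
    · exact heq ⟨hu.1, hus⟩
    have hlt1 : u < s + η₁ := hlt.trans_le (by gcongr; exact min_le_left _ _)
    have hlt2 : u < s + η₂ := hlt.trans_le (by gcongr; exact min_le_right _ _)
    have e₁ := h₁.free s u hs.1 hus.le hu.2 fun v hv => hf₁ v ⟨hs.1.trans hv.1.le, hv.2.trans hu.2⟩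
      (by rw [abs_of_pos (by linarith [hv.1])]; linarith [hv.2]) hv.1.ne'
    have e₂ := h₂.free s u hs.1 hus.le hu.2 fun v hv => hf₂ v ⟨hs.1.trans hv.1.le, hv.2.trans hu.2⟩
      (by rw [abs_of_pos (by linarith [hv.1])]; linarith [hv.2]) hv.1.ne'
    have es := heq (right_mem_Icc.2 hs.1)
    exact Prod.ext (by rw [e₁.2, e₂.2, es]) (by rw [e₁.1, e₂.1, es])
  -- agreement before a time implies agreement at that time
  have hleft : ∀ s ∈ Ioc 0 T, EqOn γ₁ γ₂ (Ico 0 s) → γ₁ s = γ₂ s := by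
    intro s hs heq
    have hpos : (γ₁ s).1 = (γ₂ s).1 := by
      have hlim : ∀ {γ : ℝ → Phase d}, B.IsTrajectory T γ →
          Tendsto (fun u => (γ u).1) (𝓝[<] s) (𝓝 (γ s).1) := fun h =>
        (h.continuousOn s (Ioc_subset_Icc_self hs)).tendsto.mono_left
          (nhdsWithin_le_of_mem (mem_of_superset (Ioo_mem_nhdsLT hs.1)
            fun u hu => ⟨hu.1.le, hu.2.le.trans hs.2⟩))
      refine tendsto_nhds_unique (hlim h₁) ((hlim h₂).congr' ?_)
      filter_upwards [Ioo_mem_nhdsLT hs.1] with u hu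
      rw [heq ⟨hu.1.le, hu.2⟩]
    obtain ⟨η₁, hη₁, hf₁⟩ := h₁.eventually_free s
    obtain ⟨η₂, hη₂, hf₂⟩ := h₂.eventually_free s
    set u := max (s / 2) (s - min η₁ η₂ / 2) with hu
    have hmin : 0 < min η₁ η₂ := by positivity
    have hu0 : 0 < u := lt_of_lt_of_le (half_pos hs.1) (le_max_left _ _)
    have hus : u < s := max_lt (by linarith [hs.1]) (by linarith)
    have hug : s - min η₁ η₂ / 2 ≤ u := le_max_right _ _
    have hg₁ : ∀ v ∈ Ioo u s, (γ₁ v).1 ∉ frontier B.domain := fun v hv =>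
      hf₁ v ⟨hu0.le.trans hv.1.le, hv.2.le.trans hs.2⟩
        (by rw [abs_of_neg (by linarith [hv.2])]; linarith [hv.1, min_le_left η₁ η₂]) hv.2.ne
    have hg₂ : ∀ v ∈ Ioo u s, (γ₂ v).1 ∉ frontier B.domain := fun v hv =>
      hf₂ v ⟨hu0.le.trans hv.1.le, hv.2.le.trans hs.2⟩
        (by rw [abs_of_neg (by linarith [hv.2])]; linarith [hv.1, min_le_right η₁ η₂]) hv.2.ne
    have eu := heq ⟨hu0.le, hus⟩
    refine Prod.ext hpos ?_
    by_cases hfr : (γ₁ s).1 ∈ frontier B.domain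
    · obtain ⟨-, n₁, p₁, hn₁, hp₁, e₁⟩ := h₁.collision s hs hfr
      obtain ⟨-, n₂, p₂, hn₂, hp₂, e₂⟩ := h₂.collision s hs (hpos ▸ hfr)
      rw [← hpos] at hn₂
      rw [e₁, e₂, hn₁.unique hn₂,
        tendsto_nhds_unique hp₁ (h₁.tendsto_momentum hu0.le hus hs.2 hg₁),
        tendsto_nhds_unique hp₂ (h₂.tendsto_momentum hu0.le hus hs.2 hg₂), eu]
    · have key : ∀ {γ : ℝ → Phase d}, (∀ v ∈ Ioo u s, (γ v).1 ∉ frontier B.domain) →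
          (γ s).1 ∉ frontier B.domain → ∀ v ∈ Ioc u s, (γ v).1 ∉ frontier B.domain := by
        intro γ h hs v hv
        rcases hv.2.eq_or_lt with rfl | hlt
        · exact hs
        · exact h v ⟨hv.1, hlt⟩
      rw [(h₁.free u s hu0.le hus.le hs.2 (key hg₁ hfr)).1,
        (h₂.free u s hu0.le hus.le hs.2 (key hg₂ (hpos ▸ hfr))).1, eu]
  set S : Set ℝ := {s | s ∈ Icc 0 T ∧ EqOn γ₁ γ₂ (Icc 0 s)} with hS
  have h0S : (0 : ℝ) ∈ S := ⟨left_mem_Icc.2 hT, by simpa using h0⟩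
  have hbdd : BddAbove S := ⟨T, fun s hs => hs.1.2⟩
  set σ := sSup S with hσ
  have hσ0 : 0 ≤ σ := le_csSup hbdd h0S
  have hσT : σ ≤ T := csSup_le ⟨0, h0S⟩ fun s hs => hs.1.2
  have hlt : EqOn γ₁ γ₂ (Ico 0 σ) := by
    intro u hu
    obtain ⟨s, hs, hus⟩ := exists_lt_of_lt_csSup ⟨0, h0S⟩ hu.2
    exact hs.2 ⟨hu.1, hus.le⟩
  have hσS : EqOn γ₁ γ₂ (Icc 0 σ) := by
    intro u hu
    rcases hu.2.eq_or_lt with rfl | h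
    · rcases hσ0.eq_or_lt with h | h
      · rw [← h]; exact h0
      · exact hleft _ ⟨h, hσT⟩ hlt
    · exact hlt ⟨hu.1, h⟩
  rcases hσT.eq_or_lt with h | h
  · rw [← h]; exact hσS
  · exfalso
    obtain ⟨η, hη, hext⟩ := hright σ ⟨hσ0, h⟩ hσS
    have : min T (σ + η / 2) ∈ S := by
      refine ⟨⟨le_min hT (by linarith), min_le_left _ _⟩, fun u hu => hext u ⟨hu.1, ?_⟩ ?_⟩
      · exact hu.2.trans (min_le_left _ _)
      · linarith [hu.2.trans (min_le_right _ _)]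
    have h2 := le_csSup hbdd this
    rcases min_choice T (σ + η / 2) with h3 | h3 <;> rw [h3] at h2 <;> linarith

/-- The billiard moves `z` to `z'` in time `τ ≥ 0`. -/
def BilliardStep (B : BilliardTable d r ι) (τ : ℝ) (z z' : Phase d) : Prop :=
  0 ≤ τ ∧ ∃ γ, B.IsTrajectory τ γ ∧ γ 0 = z ∧ γ τ = z'

theorem BilliardStep.flowDefined {τ : ℝ} {z z' : Phase d} (h : BilliardStep B τ z z') :
    B.FlowDefined τ z := by
  obtain ⟨-, γ, hγ, h1, -⟩ := h
  exact ⟨γ, hγ, h1⟩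

theorem BilliardStep.flow_eq {τ : ℝ} {z z' : Phase d} (h : BilliardStep B τ z z') :
    B.flow τ z = z' := by
  have hdef := h.flowDefined
  obtain ⟨h0, γ, hγ, h1, h2⟩ := h
  rw [BilliardTable.flow, dif_pos hdef]
  have := hdef.choose_spec.1.eq_of_eq hγ (by rw [hdef.choose_spec.2, h1]) (right_mem_Icc.2 h0)
  rw [this, h2]

/-- The concatenation of two billiard trajectories. -/
theorem BilliardStep.trans {τ₁ τ₂ : ℝ} {z₁ z₂ z₃ : Phase d} (h : BilliardStep B τ₁ z₁ z₂)
    (h' : BilliardStep B τ₂ z₂ z₃) : BilliardStep B (τ₁ + τ₂) z₁ z₃ := by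
  obtain ⟨h0, γ₁, hγ₁, h1, h2⟩ := h
  obtain ⟨h0', γ₂, hγ₂, h3, h4⟩ := h'
  have hm : γ₁ τ₁ = γ₂ 0 := by rw [h2, h3]
  have hle : ∀ {u}, u ≤ τ₁ → concat τ₁ γ₁ γ₂ u = γ₁ u := concat_of_le
  have hge : ∀ {u}, τ₁ ≤ u → concat τ₁ γ₁ γ₂ u = γ₂ (u - τ₁) := concat_of_ge hm
  refine ⟨by positivity, concat τ₁ γ₁ γ₂, ⟨?_, ?_, ?_, ?_, ?_⟩, by rw [hle h0, h1],
    by rw [hge (by linarith), add_sub_cancel_left, h4]⟩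
  · intro t ht
    rcases le_total t τ₁ with h | h
    · rw [hle h]; exact hγ₁.mem_domain t ⟨ht.1, h⟩
    · rw [hge h]; exact hγ₂.mem_domain _ ⟨by linarith, by linarith [ht.2]⟩
  · have hU : Icc 0 (τ₁ + τ₂) = Icc 0 τ₁ ∪ Icc τ₁ (τ₁ + τ₂) :=
      (Icc_union_Icc_eq_Icc h0 (by linarith)).symm
    rw [hU]
    refine ContinuousOn.union_of_isClosed ?_ ?_ isClosed_Icc isClosed_Icc
    · exact hγ₁.continuousOn.congr fun u hu => by rw [hle hu.2]
    · have : ContinuousOn (fun u => (γ₂ (u - τ₁)).1) (Icc τ₁ (τ₁ + τ₂)) :=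
        hγ₂.continuousOn.comp (f := fun u => u - τ₁) (by fun_prop)
          fun u hu => ⟨by linarith [hu.1], by linarith [hu.2]⟩
      exact this.congr fun u hu => by rw [hge hu.1]
  · refine (hγ₁.finite_collisions.union
      (hγ₂.finite_collisions.image fun u => u + τ₁)).subset ?_
    rintro t ⟨ht, hfr⟩
    rcases le_total t τ₁ with h | h
    · rw [hle h] at hfr; exact Or.inl ⟨⟨ht.1, h⟩, hfr⟩
    · rw [hge h] at hfr
      exact Or.inr ⟨t - τ₁, ⟨⟨by linarith, by linarith [ht.2]⟩, hfr⟩, by ring⟩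
  · intro s t hs hst ht hfree
    have hfirst : ∀ {s t}, 0 ≤ s → s ≤ t → t ≤ τ₁ →
        (∀ u ∈ Ioc s t, (concat τ₁ γ₁ γ₂ u).1 ∉ frontier B.domain) →
        (concat τ₁ γ₁ γ₂ t).2 = (concat τ₁ γ₁ γ₂ s).2 ∧ (concat τ₁ γ₁ γ₂ t).1 =
          (concat τ₁ γ₁ γ₂ s).1 + (t - s) • (concat τ₁ γ₁ γ₂ s).2 := by
      intro s t hs hst ht hfree
      rw [hle ht, hle (hst.trans ht)]
      refine hγ₁.free s t hs hst ht fun u hu => ?_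
      have := hfree u hu
      rwa [hle (hu.2.trans ht)] at this
    have hsecond : ∀ {s t}, τ₁ ≤ s → s ≤ t → t ≤ τ₁ + τ₂ →
        (∀ u ∈ Ioc s t, (concat τ₁ γ₁ γ₂ u).1 ∉ frontier B.domain) →
        (concat τ₁ γ₁ γ₂ t).2 = (concat τ₁ γ₁ γ₂ s).2 ∧ (concat τ₁ γ₁ γ₂ t).1 =
          (concat τ₁ γ₁ γ₂ s).1 + (t - s) • (concat τ₁ γ₁ γ₂ s).2 := by
      intro s t hs hst ht hfree
      rw [hge (hs.trans hst), hge hs]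
      have := hγ₂.free (s - τ₁) (t - τ₁) (by linarith) (by linarith) (by linarith) fun u hu => ?_
      · rwa [sub_sub_sub_cancel_right] at this
      · have := hfree (u + τ₁) ⟨by linarith [hu.1], by linarith [hu.2]⟩
        rwa [hge (by linarith [hu.1]), add_sub_cancel_right] at this
    rcases le_total t τ₁ with htτ | htτ
    · exact hfirst hs hst htτ hfree
    rcases le_total τ₁ s with hsτ | hsτ
    · exact hsecond hsτ hst ht hfree
    have e₁ := hfirst hs hsτ le_rfl fun u hu => hfree u ⟨hu.1, hu.2.trans htτ⟩
    have e₂ := hsecond le_rfl htτ ht fun u hu => hfree u ⟨hsτ.trans_lt hu.1, hu.2⟩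
    refine ⟨e₂.1.trans e₁.1, ?_⟩
    rw [e₂.2, e₁.1, e₁.2, add_assoc, ← add_smul]
    congr 2; ring
  · intro t ht hfr
    rcases le_or_gt t τ₁ with htτ | htτ
    · rw [hle htτ] at hfr ⊢
      obtain ⟨hc, n, p, hn, hp, e⟩ := hγ₁.collision t ⟨ht.1, htτ⟩ hfr
      refine ⟨hc, n, p, hn, hp.congr' ?_, e⟩
      filter_upwards [self_mem_nhdsWithin] with u hu
      rw [hle (le_of_lt (lt_of_lt_of_le hu htτ))]
    · rw [hge htτ.le] at hfr ⊢
      obtain ⟨hc, n, p, hn, hp, e⟩ := hγ₂.collision (t - τ₁) ⟨by linarith, by linarith [ht.2]⟩ hfr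
      refine ⟨hc, n, p, hn, ?_, e⟩
      have h5 : Tendsto (fun u => u - τ₁) (𝓝[<] t) (𝓝[<] (t - τ₁)) := by
        refine tendsto_nhdsWithin_iff.2 ⟨?_, ?_⟩
        · exact ((continuous_id.sub continuous_const).tendsto t).mono_left nhdsWithin_le_nhds
        · filter_upwards [self_mem_nhdsWithin] with u hu
          exact sub_lt_sub_right (show u < t from hu) τ₁
      refine (hp.comp h5).congr' ?_
      filter_upwards [Ioo_mem_nhdsLT htτ] with u hu
      rw [hge hu.1.le]; rfl

theorem notMem_frontier_of_mem_interior {X : Type*} [TopologicalSpace X] {D : Set X} {q : X}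
    (h : q ∈ interior D) : q ∉ frontier D := fun h' => h'.2 h

theorem mem_interior_of_notMem_frontier {D : Set (Config d)} {q : Config d} (h : q ∈ D)
    (h' : q ∉ frontier D) : q ∈ interior D := by
  by_contra hq
  exact h' ⟨subset_closure h, hq⟩

/-- Free motion inside the table. -/
theorem billiardStep_free {q p : Config d} {τ : ℝ} (hτ : 0 ≤ τ)
    (h : ∀ s ∈ Icc 0 τ, q + s • p ∈ interior B.domain) :
    BilliardStep B τ (q, p) (q + τ • p, p) := by
  have hnf : ∀ s ∈ Icc 0 τ, q + s • p ∉ frontier B.domain :=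
    fun s hs => notMem_frontier_of_mem_interior (h s hs)
  refine ⟨hτ, fun s => (q + s • p, p), ⟨fun t ht => interior_subset (h t ht), by fun_prop, ?_,
    fun s t _ _ _ _ => ⟨rfl, ?_⟩, fun t ht hfr => (hnf t ⟨ht.1.le, ht.2⟩ hfr).elim⟩,
    by simp, rfl⟩
  · convert Set.finite_empty
    ext t; simp only [mem_ofPred_eq, mem_empty_iff_false, iff_false]
    exact fun h => hnf t h.1 h.2
  · simp only [sub_smul]; abel

/-- Free motion up to a wall, a reflection, and free motion away from the wall. -/
theorem billiardStep_collision {q p n : Config d} {t τ : ℝ} (ht : 0 < t) (htτ : t ≤ τ)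
    (hbefore : ∀ s ∈ Ico 0 t, q + s • p ∈ interior B.domain)
    (hafter : ∀ s ∈ Ioc t τ, q + t • p + (s - t) • reflect n p ∈ interior B.domain)
    (hwall : q + t • p ∈ frontier B.domain) (hcorner : q + t • p ∉ B.corner)
    (hn : IsInwardNormal B.domain (q + t • p) n) :
    BilliardStep B τ (q, p) (q + t • p + (τ - t) • reflect n p, reflect n p) := by
  classical
  set q' : ℝ → Config d := fun s => q + (min s t) • p + (max (s - t) 0) • reflect n p with hq'
  set γ : ℝ → Phase d := fun s => (q' s, if s < t then p else reflect n p) with hγ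
  have hlt : ∀ {s}, s ≤ t → q' s = q + s • p := fun {s} hs => by
    simp [hq', min_eq_left hs, max_eq_right (sub_nonpos.2 hs)]
  have hge : ∀ {s}, t ≤ s → q' s = q + t • p + (s - t) • reflect n p := fun {s} hs => by
    simp [hq', min_eq_right hs, max_eq_left (sub_nonneg.2 hs)]
  have hint : ∀ s ∈ Icc 0 τ, s ≠ t → q' s ∈ interior B.domain := by
    intro s hs hne
    rcases lt_or_gt_of_ne hne with h | h
    · rw [hlt h.le]; exact hbefore s ⟨hs.1, h⟩
    · rw [hge h.le]; exact hafter s ⟨h, hs.2⟩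
  have hcoll : ∀ s ∈ Icc 0 τ, q' s ∈ frontier B.domain → s = t := fun s hs hfr => by
    by_contra hne
    exact notMem_frontier_of_mem_interior (hint s hs hne) hfr
  refine ⟨ht.le.trans htτ, γ, ⟨?_, ?_, ?_, ?_, ?_⟩, ?_, ?_⟩
  · intro s hs
    rcases eq_or_ne s t with rfl | hne
    · change q' s ∈ _
      rw [hlt le_rfl]
      exact B.isClosed_domain.frontier_subset hwall
    · exact interior_subset (hint s hs hne)
  · have : Continuous q' := by fun_prop
    exact this.continuousOn
  · exact (Set.finite_singleton t).subset fun s hs => hcoll s hs.1 hs.2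
  · intro s u hs hsu hu hfree
    rcases lt_or_ge u t with hut | hut
    · have hst : s < t := hsu.trans_lt hut
      refine ⟨by simp [hγ, hut, hst], ?_⟩
      simp only [hγ, if_pos hst, hlt hut.le, hlt hst.le, sub_smul]; abel
    · have hst : t ≤ s := by
        by_contra hst
        exact hfree t ⟨not_le.1 hst, hut⟩ (by change q' t ∈ _; rw [hlt le_rfl]; exact hwall)
      refine ⟨by simp [hγ, hut.not_gt, hst.not_gt], ?_⟩
      simp only [hγ, if_neg hst.not_gt, hge hut, hge hst, sub_smul]; abel
  · intro s hs hfr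
    obtain rfl : s = t := hcoll s ⟨hs.1.le, hs.2⟩ hfr
    have e : (γ s).1 = q + s • p := hlt le_rfl
    rw [e]
    refine ⟨hcorner, n, p, hn, ?_, by simp [hγ]⟩
    refine tendsto_const_nhds.congr' ?_
    filter_upwards [self_mem_nhdsWithin] with u hu
    simp only [hγ, if_pos (show u < s from hu)]
  · simp only [hγ, if_pos ht, hlt ht.le, zero_smul, add_zero]
  · simp only [hγ, if_neg htτ.not_gt, hge htτ]

end Billiard

/-! ### Families of potentials, pattern functions and barriers -/

theorem eventually_nnreal_of_nhdsGT {p : ℝ → Prop} (h : ∀ᶠ ε in 𝓝[>] (0 : ℝ), p ε) :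
    ∀ᶠ e : ℝ≥0 in 𝓝 0, e ≠ 0 → p e := by
  have h1 : ∀ᶠ ε in 𝓝 (0 : ℝ), 0 < ε → p ε := eventually_nhdsWithin_iff.1 h
  have h2 : Tendsto (fun e : ℝ≥0 => (e : ℝ)) (𝓝 0) (𝓝 0) := NNReal.continuous_coe.tendsto 0
  exact (h2.eventually h1).mono fun e he he0 => he (by positivity)

theorem eventually_nhdsGT_of_nnreal {p : ℝ≥0 → Prop} (h : ∀ᶠ e in 𝓝 (0 : ℝ≥0), p e) :
    ∀ᶠ ε in 𝓝[>] (0 : ℝ), p ε.toNNReal := by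
  have h1 : Tendsto Real.toNNReal (𝓝[>] 0) (𝓝 0) := by
    have := (continuous_real_toNNReal.tendsto 0).mono_left
      (nhdsWithin_le_nhds (s := Ioi (0 : ℝ)))
    simpa using this
  exact h1.eventually h

theorem eventually_prod_of_forall_mem {X : Type*} [TopologicalSpace X] {p : ℝ≥0 → X → Prop} {x : X}
    {K : Set X} (hK : K ∈ 𝓝 x) (h : ∀ᶠ e in 𝓝 (0 : ℝ≥0), ∀ y ∈ K, p e y) :
    ∀ᶠ q in 𝓝 ((0 : ℝ≥0), x), p q.1 q.2 := by
  rw [nhds_prod_eq]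
  filter_upwards [h.prod_mk hK] with q hq using hq.1 _ hq.2

section Uniform

variable {E F : Type} [NormedAddCommGroup E] [NormedSpace ℝ E] [NormedAddCommGroup F]
  [NormedSpace ℝ F]

/-- Uniform convergence of the derivatives on a neighbourhood gives `CkConvAt`. -/
theorem ckConvAt_of_tendstoUniformlyOn {n : ℕ} {f : ℝ≥0 → E → F} {g : ℝ → E → F} {x : E} {K : Set E}
    (hK : K ∈ 𝓝 x) (hfg : ∀ e : ℝ≥0, e ≠ 0 → f e = g e)
    (hc : ∀ᶠ e : ℝ≥0 in 𝓝 0, e ≠ 0 → ∀ y ∈ K, ContDiffAt ℝ n (f e) y)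
    (h0 : ContDiffAt ℝ n (f 0) x)
    (hu : ∀ k ≤ n, TendstoUniformlyOn (fun ε => iteratedFDeriv ℝ k (g ε))
      (iteratedFDeriv ℝ k (f 0)) (𝓝[>] 0) K) : CkConvAt n f x := by
  constructor
  · have h1 := eventually_prod_of_forall_mem (p := fun e y => e ≠ 0 → ContDiffAt ℝ n (f e) y) hK
      (hc.mono fun e he y hy h => he h y hy)
    have h2 : ∀ᶠ q in 𝓝 ((0 : ℝ≥0), x), ContDiffAt ℝ n (f 0) q.2 :=
      (continuous_snd.tendsto ((0 : ℝ≥0), x)).eventually (h0.eventually (by simp))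
    filter_upwards [h1, h2] with q hq hq2
    rcases eq_or_ne q.1 0 with h | h
    · rw [h]; exact hq2
    · exact hq h
  · intro k hk
    refine Metric.tendsto_nhds.2 fun η hη => ?_
    have h1 := eventually_nnreal_of_nhdsGT
      (Metric.tendstoUniformlyOn_iff.1 (hu k hk) (η / 2) (half_pos hη))
    have h2 := eventually_prod_of_forall_mem (p := fun (e : ℝ≥0) y => e ≠ 0 →
      dist (iteratedFDeriv ℝ k (f 0) y) (iteratedFDeriv ℝ k (g e) y) < η / 2) hK
      (h1.mono fun e he y hy h => he h y hy)
    have h3 : ∀ᶠ q in 𝓝 ((0 : ℝ≥0), x),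
        dist (iteratedFDeriv ℝ k (f 0) q.2) (iteratedFDeriv ℝ k (f 0) x) < η / 2 :=
      ((h0.continuousAt_iteratedFDeriv (by exact_mod_cast hk)).tendsto.comp
        (continuous_snd.tendsto ((0 : ℝ≥0), x))).eventually (Metric.ball_mem_nhds _ (half_pos hη))
    filter_upwards [h2, h3] with q hq hq2
    rcases eq_or_ne q.1 0 with h | h
    · rw [h]; linarith
    · have := hq h
      rw [hfg _ h]
      rw [dist_comm] at this
      linarith [dist_triangle (iteratedFDeriv ℝ k (g q.1) q.2) (iteratedFDeriv ℝ k (f 0) q.2)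
        (iteratedFDeriv ℝ k (f 0) x)]

end Uniform

/-- A diagonal argument: if for each `ν > 0` a property holds for all small `e`, it holds along
some `ν e → 0`. -/
theorem exists_diagonal {P : ℝ → ℝ≥0 → Prop} (h : ∀ ν > 0, ∀ᶠ e in 𝓝 0, e ≠ 0 → P ν e) :
    ∃ ν : ℝ≥0 → ℝ, ν 0 = 0 ∧ Tendsto ν (𝓝 0) (𝓝 0) ∧ (∀ e, e ≠ 0 → 0 < ν e) ∧
      ∀ᶠ e in 𝓝 0, e ≠ 0 → P (ν e) e := by
  classical
  set m : ℝ≥0 → ℕ := fun e => Nat.findGreatest (fun k : ℕ => P (1 / ((k : ℝ) + 1)) e) ⌊(e : ℝ)⁻¹⌋₊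
    with hm
  set ν : ℝ≥0 → ℝ := fun e => if e = 0 then 0 else 1 / ((m e : ℝ) + 1) with hν
  have hpos : ∀ k : ℕ, (0 : ℝ) < 1 / ((k : ℝ) + 1) := fun k => by positivity
  have hbig : ∀ k : ℕ, ∀ᶠ e in 𝓝 (0 : ℝ≥0), e ≠ 0 → k ≤ m e := by
    intro k
    have h1 : ∀ᶠ e in 𝓝 (0 : ℝ≥0), e < ((k : ℝ≥0) + 1)⁻¹ := gt_mem_nhds (by positivity)
    filter_upwards [h _ (hpos k), h1] with e he he1 he0
    refine Nat.le_findGreatest ?_ (he he0)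
    refine Nat.le_floor ?_
    have h2 : (e : ℝ) < ((k : ℝ) + 1)⁻¹ := by exact_mod_cast he1
    have h3 : (0 : ℝ) < e := by positivity
    rw [lt_inv_comm₀ h3 (by positivity)] at h2
    linarith
  refine ⟨ν, by simp [hν], ?_, fun e he => ?_, ?_⟩
  · refine Metric.tendsto_nhds.2 fun η hη => ?_
    obtain ⟨k, hk⟩ := exists_nat_one_div_lt hη
    filter_upwards [hbig k] with e he
    rw [Real.dist_eq, sub_zero]
    rcases eq_or_ne e 0 with h0 | h0
    · simp [hν, h0, hη]
    · simp only [hν, if_neg h0]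
      rw [abs_of_pos (hpos _)]
      refine lt_of_le_of_lt ?_ hk
      have : (k : ℝ) ≤ m e := by exact_mod_cast he h0
      gcongr
  · simp only [hν, if_neg he]; exact hpos _
  · filter_upwards [h _ (hpos 0)] with e he he0
    simp only [hν, if_neg he0]
    exact Nat.findGreatest_spec (P := fun k : ℕ => P (1 / ((k : ℝ) + 1)) e) (Nat.zero_le _)
      (by simpa using he he0)

section Barrier

variable {d r : ℕ} {ι : Type*} {B : BilliardTable d r ι} {P : PotentialData B} {i : ι}

/-- The part of `J i` where the barrier function is finite. -/
def finiteSet (P : PotentialData B) (i : ι) (ε : ℝ) : Set ℝ := {s | s ∈ P.J i ∧ P.W i ε s ≠ ⊤}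

theorem isOpen_finiteSet {ε : ℝ} (hε : ε ∈ Ioc 0 P.ε₀) : IsOpen (finiteSet P i ε) :=
  (P.continuousOn_W i ε hε).isOpen_inter_preimage (P.isOpen_J i) isOpen_ne

theorem contDiffAt_barrier {ε : ℝ} (hε : ε ∈ Ioc 0 P.ε₀) {s : ℝ} (hs : s ∈ finiteSet P i ε) :
    ContDiffAt ℝ (r + 1) (fun s => (P.W i ε s).toReal) s :=
  (P.contDiffOn_W i ε hε).contDiffAt ((isOpen_finiteSet hε).mem_nhds hs)

theorem coe_toReal_barrier {ε : ℝ} (hε : ε ∈ Ioc 0 P.ε₀) {s : ℝ} (hs : s ∈ finiteSet P i ε) :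
    ((P.W i ε s).toReal : EReal) = P.W i ε s :=
  EReal.coe_toReal hs.2 (P.W_ne_bot i ε hε s hs.1)

theorem hasDerivAt_barrier {ε : ℝ} (hε : ε ∈ Ioc 0 P.ε₀) {s : ℝ} (hs : s ∈ finiteSet P i ε) :
    HasDerivAt (fun s => (P.W i ε s).toReal) (deriv (fun s => (P.W i ε s).toReal) s) s :=
  ((contDiffAt_barrier hε hs).differentiableAt (by simp)).hasDerivAt

theorem toReal_barrier_le {ε : ℝ} (hIIc : P.ConditionIIc) (hε : ε ∈ Ioc 0 P.ε₀) {s s' : ℝ}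
    (hs : s ∈ finiteSet P i ε) (hs' : s' ∈ P.J i) (h : s ≤ s') :
    s' ∈ finiteSet P i ε ∧ (P.W i ε s').toReal ≤ (P.W i ε s).toReal := by
  have h1 := (hIIc.2 ε hε i).1 hs.1 hs' h
  have h2 : P.W i ε s' ≠ ⊤ := fun h3 => hs.2 (top_le_iff.1 (h3 ▸ h1))
  exact ⟨⟨hs', h2⟩, EReal.toReal_le_toReal h1 (P.W_ne_bot i ε hε s' hs') hs.2⟩

/-- The barrier function is decreasing where it is finite. -/
theorem deriv_barrier_neg {ε : ℝ} (hIIc : P.ConditionIIc) (hε : ε ∈ Ioc 0 P.ε₀) {s : ℝ}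
    (hs : s ∈ finiteSet P i ε) : deriv (fun s => (P.W i ε s).toReal) s < 0 := by
  refine lt_of_le_of_ne ?_ ((hIIc.2 ε hε i).2 s hs.1 hs.2)
  have h1 := (hasDerivAt_iff_tendsto_slope.1 (hasDerivAt_barrier hε hs)).mono_left
    (nhdsWithin_mono s (s := Ioi s) fun t (ht : s < t) => ht.ne')
  refine le_of_tendsto h1 ?_
  filter_upwards [nhdsWithin_le_nhds ((P.isOpen_J i).mem_nhds hs.1), self_mem_nhdsWithin]
    with t ht hst
  have hst' : s < t := hst
  rw [slope_def_field]
  have := (toReal_barrier_le hIIc hε hs ht hst'.le).2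
  exact div_nonpos_of_nonpos_of_nonneg (by linarith) (by linarith)

theorem barrier_injective {ε : ℝ} (hIIc : P.ConditionIIc) (hε : ε ∈ Ioc 0 P.ε₀) {s s' : ℝ}
    (hs : s ∈ finiteSet P i ε) (hs' : s' ∈ finiteSet P i ε) (h : P.W i ε s = P.W i ε s') :
    s = s' := by
  wlog hlt : s < s' generalizing s s'
  · rcases eq_or_lt_of_le (not_lt.1 hlt) with h1 | h1
    · exact h1.symm
    · exact (this hs' hs h.symm h1).symm
  exfalso
  have hIcc : ∀ u ∈ Icc s s', u ∈ finiteSet P i ε := fun u hu =>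
    (toReal_barrier_le hIIc hε hs ((P.ordConnected_J i).out hs.1 hs'.1 hu) hu.1).1
  have hanti : StrictAntiOn (fun s => (P.W i ε s).toReal) (Icc s s') := by
    refine strictAntiOn_of_deriv_neg (convex_Icc _ _)
      (fun u hu => (hasDerivAt_barrier hε (hIcc u hu)).continuousAt.continuousWithinAt)
      fun u hu => deriv_barrier_neg hIIc hε (hIcc u (interior_subset hu))
  have := hanti (left_mem_Icc.2 hlt.le) (right_mem_Icc.2 hlt.le) hlt
  simp only [h] at this
  exact lt_irrefl _ this

/-- The value `w` is taken by the barrier function. -/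
def IsBarrierValue (P : PotentialData B) (i : ι) (ε w : ℝ) : Prop :=
  ∃ s ∈ P.J i, P.W i ε s = (w : EReal)

theorem IsBarrierValue.inv_mem {ε w : ℝ} (h : IsBarrierValue P i ε w) :
    P.W i ε (P.barrierInv i ε w) = w ∧ P.barrierInv i ε w ∈ finiteSet P i ε := by
  have h1 : P.W i ε (P.barrierInv i ε w) = w := Function.invFunOn_eq h
  exact ⟨h1, Function.invFunOn_mem h, by rw [h1]; exact EReal.coe_ne_top _⟩

/-- The inverse barrier function is smooth, with the derivative given by the inverse function
theorem. -/
theorem contDiffAt_barrierInv {ε w : ℝ} (hIIc : P.ConditionIIc) (hε : ε ∈ Ioc 0 P.ε₀)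
    (h : IsBarrierValue P i ε w) :
    ContDiffAt ℝ (r + 1) (P.barrierInv i ε) w ∧ HasDerivAt (P.barrierInv i ε)
      (deriv (fun s => (P.W i ε s).toReal) (P.barrierInv i ε w))⁻¹ w := by
  obtain ⟨hW, hs⟩ := h.inv_mem
  set s := P.barrierInv i ε w
  set f : ℝ → ℝ := fun s => (P.W i ε s).toReal with hf
  have hfs : f s = w := by simp [hf, hW]
  have hne : deriv f s ≠ 0 := (deriv_barrier_neg hIIc hε hs).ne
  have hsm : ContDiffAt ℝ (r + 1) f s := contDiffAt_barrier hε hs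
  have hstrict : HasStrictDerivAt f (deriv f s) s := hsm.hasStrictDerivAt (by simp)
  set F := hstrict.hasStrictFDerivAt_equiv hne
  set g := F.localInverse with hg
  have hg1 : ∀ᶠ c in 𝓝 w, f (g c) = c := by
    have := F.eventually_right_inverse
    rwa [hfs] at this
  have hg2 : Tendsto g (𝓝 w) (𝓝 s) := by
    have := F.localInverse_tendsto
    rwa [hfs] at this
  have heq : P.barrierInv i ε =ᶠ[𝓝 w] g := by
    filter_upwards [hg1, hg2.eventually ((isOpen_finiteSet hε).mem_nhds hs)] with c hc hc2
    have h1 : P.W i ε (g c) = (c : EReal) := by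
      rw [← coe_toReal_barrier hε hc2]; exact congrArg _ hc
    obtain ⟨h2, h3⟩ := IsBarrierValue.inv_mem (P := P) (i := i) ⟨g c, hc2.1, h1⟩
    exact barrier_injective hIIc hε h3 hc2 (h2.trans h1.symm)
  have hgd : HasStrictDerivAt g (deriv f s)⁻¹ w := by
    have := hstrict.to_localInverse hne
    rwa [hfs] at this
  have hgsm : ContDiffAt ℝ (r + 1) g w := by
    have := hsm.to_localInverse (f' := ContinuousLinearEquiv.unitsEquivAut ℝ
      (Units.mk0 (deriv f s) hne)) F.hasFDerivAt (by simp)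
    rwa [hfs] at this
  exact ⟨hgsm.congr_of_eventuallyEq heq, hgd.hasDerivAt.congr_of_eventuallyEq heq⟩

/-- By the intermediate value theorem, every value in a compact interval below the height of the
barrier is taken, once `ε` is small. -/
theorem eventually_isBarrierValue (hIII : P.ConditionIII) {w₁ w₂ : ℝ} (h1 : 0 < w₁)
    (h2 : (w₂ : EReal) < P.height i) :
    ∀ᶠ ε in 𝓝[>] (0 : ℝ), ∀ w ∈ Icc w₁ w₂, IsBarrierValue P i ε w := by
  obtain ⟨η, hη, hball⟩ := Metric.isOpen_iff.1 (P.isOpen_J i) 0 (P.zero_mem_J i)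
  have hhalf : |η / 2| < η := by rw [abs_of_pos (by positivity)]; linarith
  have hpJ : η / 2 ∈ P.J i := hball (by rwa [Metric.mem_ball, dist_zero_right, Real.norm_eq_abs])
  have hnJ : -(η / 2) ∈ P.J i := hball (by
    rwa [Metric.mem_ball, dist_zero_right, Real.norm_eq_abs, abs_neg])
  have e1 := ((hIII i _ hpJ).1 (by positivity)).eventually
    (gt_mem_nhds (show (0 : EReal) < (w₁ : EReal) by exact_mod_cast h1))
  have e2 := ((hIII i _ hnJ).2 (by linarith)).eventually (lt_mem_nhds h2)
  have e3 : ∀ᶠ ε in 𝓝[>] (0 : ℝ), ε ∈ Ioc 0 P.ε₀ := Ioc_mem_nhdsGT P.ε₀_pos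
  filter_upwards [e1, e2, e3] with ε h1 h2 hε w hw
  have hsub : Icc (-(η / 2)) (η / 2) ⊆ P.J i := (P.ordConnected_J i).out hnJ hpJ
  have := intermediate_value_Icc' (by linarith : -(η / 2) ≤ η / 2)
    ((P.continuousOn_W i ε hε).mono hsub)
  obtain ⟨s, hs, hsw⟩ := this (show (w : EReal) ∈ Icc _ _ from
    ⟨h1.le.trans (by exact_mod_cast hw.1), le_trans (by exact_mod_cast hw.2) h2.le⟩)
  exact ⟨s, hsub hs, hsw⟩

/-- The inverse barrier functions, with limit `0`. -/
def barrierInvFamily (P : PotentialData B) (i : ι) (e : ℝ≥0) (w : ℝ) : ℝ :=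
  if e = 0 then 0 else P.barrierInv i e w

theorem eventually_mem_Ioc (P : PotentialData B) :
    ∀ᶠ e : ℝ≥0 in 𝓝 0, e ≠ 0 → (e : ℝ) ∈ Ioc 0 P.ε₀ :=
  eventually_nnreal_of_nhdsGT (Ioc_mem_nhdsGT P.ε₀_pos)

theorem ckConvAt_barrierInv (hIIc : P.ConditionIIc) (hIII : P.ConditionIII) (hIV : P.ConditionIV)
    {w : ℝ} (hw : 0 < w) (hwE : (w : EReal) < P.height i) :
    CkConvAt (r + 1) (barrierInvFamily P i) w := by
  obtain ⟨w₂, hw₂, hw₂E⟩ : ∃ w₂ : ℝ, w < w₂ ∧ (w₂ : EReal) < P.height i := by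
    obtain ⟨c, hc1, hc2⟩ := EReal.lt_iff_exists_real_btwn.1 hwE
    exact ⟨c, by exact_mod_cast hc1, hc2⟩
  have h0 : barrierInvFamily P i 0 = fun _ => 0 := by ext; simp [barrierInvFamily]
  refine ckConvAt_of_tendstoUniformlyOn (g := fun ε => P.barrierInv i ε)
    (Icc_mem_nhds (half_lt_self hw) hw₂)
    (fun e he => by ext; simp [barrierInvFamily, he]) ?_ (by rw [h0]; exact contDiffAt_const)
    fun k hk => ?_
  · filter_upwards [eventually_nnreal_of_nhdsGT
      (eventually_isBarrierValue hIII (half_pos hw) hw₂E), eventually_mem_Ioc P]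
      with e he he2 he0 y hy
    have : barrierInvFamily P i e = P.barrierInv i e := by ext; simp [barrierInvFamily, he0]
    rw [this]
    exact_mod_cast (contDiffAt_barrierInv hIIc (he2 he0) (he he0 y hy)).1
  · have h1 := Metric.tendstoUniformlyOn_iff.1
      (hIV i (w / 2) w₂ (half_pos hw) (by linarith) hw₂E k hk)
    refine Metric.tendstoUniformlyOn_iff.2 fun η hη => ?_
    filter_upwards [h1 η hη] with ε hε x hx
    have := hε x hx
    rw [dist_zero_left] at this
    rw [h0]
    have h2 : iteratedFDeriv ℝ k (fun _ : ℝ => (0 : ℝ)) x = 0 := by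
      rw [iteratedFDeriv_fun_zero]; rfl
    rw [h2, dist_zero_left, norm_iteratedFDeriv_eq_norm_iteratedDeriv]
    exact this

/-- A smooth cutoff, `0` for `w ≤ ν / 2` and `1` for `w ≥ ν`. -/
def cutoff (ν w : ℝ) : ℝ := Real.smoothTransition (2 * w / ν - 1)

theorem cutoff_of_le {ν w : ℝ} (hν : 0 < ν) (h : w ≤ ν / 2) : cutoff ν w = 0 := by
  refine Real.smoothTransition.zero_of_nonpos ?_
  have : 2 * w / ν ≤ 1 := by rw [div_le_one hν]; linarith
  linarith

theorem cutoff_of_ge {ν w : ℝ} (hν : 0 < ν) (h : ν ≤ w) : cutoff ν w = 1 := by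
  refine Real.smoothTransition.one_of_one_le ?_
  have : 2 ≤ 2 * w / ν := by rw [le_div_iff₀ hν]; linarith
  linarith

theorem contDiff_cutoff {n : ℕ} (ν : ℝ) : ContDiff ℝ n (cutoff ν) := by
  have h : ContDiff ℝ n fun w : ℝ => 2 * w / ν - 1 :=
    ((contDiff_const.mul contDiff_id).div_const ν).sub contDiff_const
  exact Real.smoothTransition.contDiff.comp h

/-- The derivatives of the inverse barrier functions, cut off near `0`. -/
def cutBarrierInv (P : PotentialData B) (i : ι) (ν : ℝ) (e : ℝ≥0) (w : ℝ) : ℝ :=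
  cutoff ν w * fderiv ℝ (barrierInvFamily P i e) w 1

theorem ckConvAt_cutBarrierInv (hIIc : P.ConditionIIc) (hIII : P.ConditionIII)
    (hIV : P.ConditionIV) {ν w : ℝ} (hν : 0 < ν) (hwE : (w : EReal) < P.height i) :
    CkConvAt r (cutBarrierInv P i ν) w := by
  rcases lt_or_ge w (ν / 2) with h | h
  · refine (ContDiffAt.ckConvAt (contDiffAt_const (c := (0 : ℝ)))).congr ?_
    have : ∀ᶠ q in 𝓝 ((0 : ℝ≥0), w), q.2 < ν / 2 :=
      (continuous_snd.tendsto ((0 : ℝ≥0), w)).eventually (gt_mem_nhds h)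
    filter_upwards [this] with q hq
    rw [cutBarrierInv, cutoff_of_le hν hq.le, zero_mul]
  · have h1 := (ckConvAt_barrierInv hIIc hIII hIV (by linarith : 0 < w) hwE).fderiv
    have h2 := (ContDiffAt.ckConvAt ((contDiff_cutoff (n := r) ν).contDiffAt (x := w))).prodMk h1
    have h3 : ContDiff ℝ r fun q : ℝ × (ℝ →L[ℝ] ℝ) => q.1 * q.2 1 :=
      contDiff_fst.mul (contDiff_snd.clm_apply contDiff_const)
    exact CkConvAt.comp (g := fun _ (q : ℝ × (ℝ →L[ℝ] ℝ)) => q.1 * q.2 1)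
      (ContDiffAt.ckConvAt h3.contDiffAt) h2

/-- What the proof uses of the barrier at a wall: thresholds `ν e → 0` and a family
`G e → 0` in `C^r` (on a fixed interval around `0`, in spite of the singularity of the inverse
barrier function at `0`), such that `G e` is the derivative of the inverse barrier function `I e`
at all values above `ν e`. -/
structure BarrierInverse (P : PotentialData B) (i : ι) (w₀ : ℝ) where
  ν : ℝ≥0 → ℝ
  G : ℝ≥0 → ℝ → ℝ
  I : ℝ≥0 → ℝ → ℝ
  ν_zero : ν 0 = 0
  tendsto_ν : Tendsto ν (𝓝 0) (𝓝 0)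
  G_zero : ∀ w, G 0 w = 0
  ckConv_G : ∀ w ∈ Ioo (-1) w₀, CkConv r G w
  I_zero : I 0 (ν 0) = 0
  tendsto_I : Tendsto (fun e => I e (ν e)) (𝓝 0) (𝓝 0)
  inverse : ∀ᶠ e : ℝ≥0 in 𝓝 0, e ≠ 0 → ∀ w ∈ Ico (ν e) w₀,
    I e w ∈ finiteSet P i e ∧ P.W i e (I e w) = w ∧ HasDerivAt (I e) (G e w) w ∧
    HasDerivAt (fun s => (P.W i e s).toReal) (G e w)⁻¹ (I e w) ∧ G e w < 0

/-- For each fixed `ν > 0` condition IV makes the derivatives of the inverse barrier function, cut off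
below `ν`, tend to `0`; hence a threshold `ν e` that tends to `0` slowly enough has this property. -/
theorem exists_barrierInverse (hIIc : P.ConditionIIc) (hIII : P.ConditionIII)
    (hIV : P.ConditionIV) {w₀ : ℝ} (hw₀ : 0 < w₀) (hw₀E : (w₀ : EReal) < P.height i) :
    Nonempty (BarrierInverse P i w₀) := by
  have hE : ∀ w ≤ w₀, (w : EReal) < P.height i := fun w hw =>
    lt_of_le_of_lt (by exact_mod_cast hw) hw₀E
  have hzero : ∀ ν w, cutBarrierInv P i ν 0 w = 0 := fun ν w => by
    have : barrierInvFamily P i 0 = fun _ => 0 := by ext; simp [barrierInvFamily]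
    simp [cutBarrierInv, this]
  have hev : ∀ ν > 0, ∀ᶠ e : ℝ≥0 in 𝓝 0, e ≠ 0 →
      (∀ w ∈ Icc (-1) w₀, ContDiffAt ℝ r (cutBarrierInv P i ν e) w ∧
        ∀ k ≤ r, ‖iteratedFDeriv ℝ k (cutBarrierInv P i ν e) w‖ < ν) ∧
      (ν < w₀ → |barrierInvFamily P i e ν| < ν) ∧ ∀ w ∈ Icc ν w₀, IsBarrierValue P i e w := by
    intro ν hν
    have hK : ∀ w ∈ Icc (-1) w₀, CkConvAt r (cutBarrierInv P i ν) w := fun w hw =>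
      ckConvAt_cutBarrierInv hIIc hIII hIV hν (hE w hw.2)
    have h1 := eventually_contDiffAt_of_ckConvAt isCompact_Icc hK
    have h2 : ∀ᶠ e : ℝ≥0 in 𝓝 0, ∀ k ∈ Finset.range (r + 1), ∀ w ∈ Icc (-1) w₀,
        ‖iteratedFDeriv ℝ k (cutBarrierInv P i ν e) w‖ < ν := by
      rw [Filter.eventually_all_finset]
      intro k hk
      have := Metric.tendstoUniformlyOn_iff.1 (tendstoUniformlyOn_of_ckConvAt isCompact_Icc hK
        (Nat.lt_succ_iff.1 (Finset.mem_range.1 hk))) ν hν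
      filter_upwards [this] with e he w hw
      have h3 := he w hw
      have h4 : cutBarrierInv P i ν 0 = fun _ => 0 := funext (hzero ν)
      have h5 : iteratedFDeriv ℝ k (fun _ : ℝ => (0 : ℝ)) w = 0 := by
        rw [iteratedFDeriv_fun_zero]; rfl
      rwa [h4, h5, dist_zero_left] at h3
    have h3 : ∀ᶠ e : ℝ≥0 in 𝓝 0, ν < w₀ → |barrierInvFamily P i e ν| < ν := by
      by_cases hνw : ν < w₀
      · have h4 := (ckConvAt_barrierInv hIIc hIII hIV hν (hE ν hνw.le)).tendsto
        have h5 : Tendsto (fun e : ℝ≥0 => barrierInvFamily P i e ν) (𝓝 0) (𝓝 0) := by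
          have h6 := h4.comp (Continuous.tendsto (f := fun e : ℝ≥0 => (e, ν)) (by fun_prop) 0)
          simpa [barrierInvFamily, Function.comp_def] using h6
        have h6 := h5.abs
        rw [abs_zero] at h6
        filter_upwards [h6.eventually (gt_mem_nhds hν)] with e he _ using he
      · exact Eventually.of_forall fun e h => (hνw h).elim
    filter_upwards [h1, h2, h3, eventually_nnreal_of_nhdsGT (eventually_isBarrierValue hIII hν hw₀E)]
      with e e1 e2 e3 e4 he
    exact ⟨fun w hw => ⟨e1 w hw, fun k hk => e2 k (Finset.mem_range.2 (Nat.lt_succ_of_le hk)) w hw⟩,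
      e3, e4 he⟩
  obtain ⟨ν, hν0, hνt, hνpos, hνP⟩ := exists_diagonal hev
  have hνw : ∀ᶠ e in 𝓝 0, ν e < w₀ := hνt.eventually (gt_mem_nhds hw₀)
  set G : ℝ≥0 → ℝ → ℝ := fun e => cutBarrierInv P i (ν e) e with hG
  have hG0 : G 0 = fun _ => 0 := funext (hzero _)
  refine ⟨⟨ν, G, barrierInvFamily P i, hν0, hνt, hzero _, fun w hw => ?_,
    by simp [barrierInvFamily], ?_, ?_⟩⟩
  · filter_upwards [Ioo_mem_nhds hw.1 hw.2] with y hy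
    have hnear : Icc (-1) w₀ ∈ 𝓝 y := Icc_mem_nhds hy.1 hy.2
    refine ⟨?_, fun k hk => ?_⟩
    · have h1 := eventually_prod_of_forall_mem (p := fun e y => e ≠ 0 → ContDiffAt ℝ r (G e) y)
        hnear (hνP.mono fun e he y hy h => ((he h).1 y hy).1)
      filter_upwards [h1] with q hq
      rcases eq_or_ne q.1 0 with h | h
      · rw [h, hG0]; exact contDiffAt_const
      · exact hq h
    · have h5 : ∀ y, iteratedFDeriv ℝ k (fun _ : ℝ => (0 : ℝ)) y = 0 := fun y => by
        rw [iteratedFDeriv_fun_zero]; rfl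
      rw [hG0, h5]
      refine squeeze_zero_norm' (a := fun q : ℝ≥0 × ℝ => ν q.1) ?_ ?_
      · have h1 := eventually_prod_of_forall_mem
          (p := fun e y => e ≠ 0 → ‖iteratedFDeriv ℝ k (G e) y‖ < ν e)
          hnear (hνP.mono fun e he y hy h => ((he h).1 y hy).2 k hk)
        filter_upwards [h1] with q hq
        rcases eq_or_ne q.1 0 with h | h
        · rw [h, hG0, h5, norm_zero, hν0]
        · exact (hq h).le
      · exact hνt.comp (continuous_fst.tendsto ((0 : ℝ≥0), y))
  · refine squeeze_zero_norm' ?_ hνt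
    filter_upwards [hνP, hνw] with e he hw
    rcases eq_or_ne e 0 with h | h
    · simp [h, barrierInvFamily, hν0]
    · exact ((he h).2.1 hw).le
  · filter_upwards [hνP, eventually_mem_Ioc P] with e he hε he0 w hw
    have hval : IsBarrierValue P i e w := (he he0).2.2 w ⟨hw.1, hw.2.le⟩
    obtain ⟨h1, h2⟩ := hval.inv_mem
    have hfam : barrierInvFamily P i e = P.barrierInv i e := by ext; simp [barrierInvFamily, he0]
    obtain ⟨-, h3⟩ := contDiffAt_barrierInv hIIc (hε he0) hval
    have hGe : G e w = (deriv (fun s => (P.W i e s).toReal) (P.barrierInv i e w))⁻¹ := by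
      simp only [hG, cutBarrierInv, cutoff_of_ge (hνpos e he0) hw.1, one_mul, hfam]
      rw [h3.hasFDerivAt.fderiv]
      simp
    rw [hfam, hGe, inv_inv]
    exact ⟨h2, h1, h3, hasDerivAt_barrier (hε he0) h2,
      inv_lt_zero.2 (deriv_barrier_neg hIIc (hε he0) h2)⟩

end Barrier

/-! ### Free flights -/

section Curves

variable {E F G : Type} [NormedAddCommGroup E] [NormedSpace ℝ E] [NormedAddCommGroup F]
  [NormedSpace ℝ F] [NormedAddCommGroup G] [NormedSpace ℝ G]

/-- Two functions on `[0, 1]` with the same derivative and the same initial value agree. -/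
theorem eqOn_of_hasDerivWithinAt_eq {f g f' : ℝ → F}
    (hf : ∀ s ∈ Icc (0 : ℝ) 1, HasDerivWithinAt f (f' s) (Icc 0 1) s)
    (hg : ∀ s ∈ Icc (0 : ℝ) 1, HasDerivWithinAt g (f' s) (Icc 0 1) s) (h0 : f 0 = g 0) :
    ∀ s ∈ Icc (0 : ℝ) 1, f s = g s :=
  eq_of_has_deriv_right_eq (f' := f')
    (fun s hs => (hf s (Ico_subset_Icc_self hs)).mono_of_mem_nhdsWithin (Icc_mem_nhdsGE_of_mem hs))
    (fun s hs => (hg s (Ico_subset_Icc_self hs)).mono_of_mem_nhdsWithin (Icc_mem_nhdsGE_of_mem hs))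
    (fun s hs => (hf s hs).continuousWithinAt) (fun s hs => (hg s hs).continuousWithinAt) h0

theorem HasDerivWithinAt.prod_fst {f : ℝ → E × F} {f' : E × F} {s : Set ℝ} {t : ℝ}
    (h : HasDerivWithinAt f f' s t) : HasDerivWithinAt (fun u => (f u).1) f'.1 s t :=
  (ContinuousLinearMap.fst ℝ E F).hasFDerivAt.comp_hasDerivWithinAt t h

theorem HasDerivWithinAt.prod_snd {f : ℝ → E × F} {f' : E × F} {s : Set ℝ} {t : ℝ}
    (h : HasDerivWithinAt f f' s t) : HasDerivWithinAt (fun u => (f u).2) f'.2 s t :=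
  (ContinuousLinearMap.snd ℝ E F).hasFDerivAt.comp_hasDerivWithinAt t h

theorem exists_flow_autonomous [CompleteSpace E] {n : ℕ} (hn : n ≠ 0) {Y : ℝ≥0 → E → E}
    {α : C(unitInterval, E)} {x : E} (hY : ∀ s, CkConv n Y (α s)) (hx : α 0 = x)
    (hα : ∀ s ∈ Icc (0 : ℝ) 1, HasDerivWithinAt (curveExt α) (Y 0 (curveExt α s)) (Icc 0 1) s) :
    ∃ Φ : ℝ≥0 → E → C(unitInterval, E), Φ 0 x = α ∧ CkConv n Φ x ∧
      ∀ᶠ p in 𝓝 ((0 : ℝ≥0), x), Φ p.1 p.2 0 = p.2 ∧ ∀ s ∈ Icc (0 : ℝ) 1,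
        HasDerivWithinAt (curveExt (Φ p.1 p.2)) (Y p.1 (curveExt (Φ p.1 p.2) s)) (Icc 0 1) s := by
  obtain ⟨Φ, h1, h2, h3⟩ := exists_flow hn (a := fun _ => 1) (b := fun _ => 0) (Y := Y)
    (Z := fun _ _ => 0) (α := α) (x := x) (by simp) (by simp) hY
    (fun s => ContDiffAt.ckConv contDiffAt_const) hx (fun s => by
      have := hα s s.2
      rw [curveExt_coe] at this
      simpa using this)
  refine ⟨Φ, h1, h2, h3.mono fun p hp => ⟨hp.1, fun s hs => ?_⟩⟩
  have := hp.2 ⟨s, hs⟩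
  rw [curveExt_of_mem _ hs]
  simpa using this

end Curves

section Gradient

variable {d : ℕ} {E : Type} [NormedAddCommGroup E] [NormedSpace ℝ E]

theorem CkConv.gradient {n : ℕ} {f : ℝ≥0 → Config d → ℝ} {q : Config d}
    (h : CkConv (n + 1) f q) : CkConv n (fun e => gradient (f e)) q :=
  h.fderiv.contDiff_comp (g := fun L => (InnerProductSpace.toDual ℝ (Config d)).symm L)
    (InnerProductSpace.toDual ℝ (Config d)).symm.contDiff.contDiffAt

theorem hasDerivWithinAt_comp_gradient {f : Config d → ℝ} {c : ℝ → Config d} {v : Config d}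
    {s : Set ℝ} {t : ℝ} (hf : DifferentiableAt ℝ f (c t)) (hc : HasDerivWithinAt c v s t) :
    HasDerivWithinAt (fun u => f (c u)) (inner ℝ v (gradient f (c t))) s t := by
  have h := hf.hasFDerivAt.comp_hasDerivWithinAt t hc
  have h2 : fderiv ℝ f (c t) v = inner ℝ v (gradient f (c t)) := by
    rw [real_inner_comm, _root_.gradient, InnerProductSpace.toDual_symm_apply]
  rw [h2] at h
  exact h

end Gradient

section Families

variable {d r : ℕ} {ι : Type*} {B : BilliardTable d r ι} {P : PotentialData B} {i : ι}

/-- The potentials, with limit `0`. -/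
def potential (P : PotentialData B) (e : ℝ≥0) (q : Config d) : ℝ :=
  if e = 0 then 0 else (P.V e q).toReal

/-- The pattern functions. -/
def pattern (P : PotentialData B) (e : ℝ≥0) (q : Config d) : ℝ := P.Q e q

theorem potential_zero : potential P 0 = fun _ => 0 := by ext; simp [potential]

theorem potential_of_ne {e : ℝ≥0} (he : e ≠ 0) :
    potential P e = fun q => (P.V e q).toReal := by ext; simp [potential, he]

theorem isOpen_strip : IsOpen (P.strip i) := (P.isOpen_nhd i).sdiff P.isClosed_cornerNhd

theorem eventually_potential_ne_top (hI : P.ConditionI) {q : Config d}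
    (hq : q ∈ interior B.domain) :
    ∀ᶠ x in 𝓝 ((0 : ℝ≥0), q), x.1 ≠ 0 → P.V x.1 x.2 ≠ ⊤ := by
  obtain ⟨K, hK, hKs, hKc⟩ := local_compact_nhds (isOpen_interior.mem_nhds hq)
  refine eventually_prod_of_forall_mem (p := fun e q => e ≠ 0 → P.V e q ≠ ⊤) hK ?_
  filter_upwards [eventually_nnreal_of_nhdsGT (hI K hKs hKc).1] with e he q hq he0
    using he he0 q hq

theorem ckConv_potential (hI : P.ConditionI) {q : Config d} (hq : q ∈ interior B.domain) :
    CkConv (r + 1) (potential P) q := by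
  filter_upwards [isOpen_interior.mem_nhds hq] with q hq
  obtain ⟨K, hK, hKs, hKc⟩ := local_compact_nhds (isOpen_interior.mem_nhds hq)
  refine ckConvAt_of_tendstoUniformlyOn (g := fun ε q => (P.V ε q).toReal) hK
    (fun e he => potential_of_ne he) ?_ (by rw [potential_zero]; exact contDiffAt_const)
    fun k hk => ?_
  · filter_upwards [eventually_nnreal_of_nhdsGT (hI K hKs hKc).1, eventually_mem_Ioc P]
      with e he he2 he0 q hq
    rw [potential_of_ne he0]
    exact_mod_cast (P.contDiffOn_V e (he2 he0)).contDiffAt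
      ((isOpen_ne.preimage (P.continuous_V e (he2 he0))).mem_nhds (he he0 q hq))
  · have h : iteratedFDeriv ℝ k (potential P 0) = fun _ => 0 := by
      rw [potential_zero]; ext1 y; rw [iteratedFDeriv_fun_zero]; rfl
    rw [h]
    exact (hI K hKs hKc).2 k hk

theorem ckConv_pattern {q : Config d} (hq : q ∈ P.strip i) : CkConv (r + 1) (pattern P) q := by
  have hopen : IsOpen (P.strip i) := isOpen_strip
  filter_upwards [hopen.mem_nhds hq] with q hq
  obtain ⟨K, hK, hKs, hKc⟩ := local_compact_nhds (hopen.mem_nhds hq)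
  have hsm : ∀ ε ∈ Icc 0 P.ε₀, ∀ q ∈ P.strip i, ContDiffAt ℝ ((r + 1 : ℕ) : WithTop ℕ∞) (P.Q ε) q :=
    fun ε hε q hq => by exact_mod_cast (P.contDiffOn_Q ε hε i).contDiffAt (hopen.mem_nhds hq)
  have h0 : pattern P 0 = P.Q 0 := by ext; simp [pattern]
  refine ckConvAt_of_tendstoUniformlyOn (g := P.Q) hK (fun e he => rfl) ?_ ?_ fun k hk => ?_
  · filter_upwards [eventually_mem_Ioc P] with e he he0 q hq
    exact hsm e (Ioc_subset_Icc_self (he he0)) q (hKs hq)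
  · rw [h0]; exact hsm 0 ⟨le_rfl, P.ε₀_pos.le⟩ q hq
  · rw [h0]; exact P.tendsto_Q i K hKs hKc k hk

/-- The flow in the interior of the table, as a map of the initial point and the duration. -/
theorem exists_freeFlight (hr : 1 ≤ r) (hI : P.ConditionI) {q p : Config d} {τ : ℝ} (hτ : 0 < τ)
    (h : ∀ s ∈ Icc 0 τ, q + s • p ∈ interior B.domain) :
    ∃ C : ℝ≥0 → Phase d × ℝ → Phase d, CkConv r C ((q, p), τ) ∧
      C 0 ((q, p), τ) = (q + τ • p, p) ∧ ∀ᶠ x in 𝓝 ((0 : ℝ≥0), (((q, p), τ) : Phase d × ℝ)),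
        (x.1 ≠ 0 → HamStep (P.V x.1) x.2.2 x.2.1 (C x.1 x.2)) ∧
        (x.1 = 0 → 0 < x.2.2 ∧ C 0 x.2 = (x.2.1.1 + x.2.2 • x.2.1.2, x.2.1.2) ∧
          ∀ s ∈ Icc 0 x.2.2, x.2.1.1 + s • x.2.1.2 ∈ interior B.domain) := by
  -- the duration is a further state variable
  set Y : ℝ≥0 → Phase d × ℝ → Phase d × ℝ := fun e x =>
    ((x.2 • x.1.2, -(x.2 • gradient (potential P e) x.1.1)), 0) with hY
  set α : C(unitInterval, Phase d × ℝ) := ⟨fun s => ((q + (s * τ : ℝ) • p, p), τ), by fun_prop⟩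
    with hα
  have hmem : ∀ s : unitInterval, (α s).1.1 ∈ interior B.domain := fun s =>
    h _ ⟨mul_nonneg s.2.1 hτ.le, mul_le_of_le_one_left hτ.le s.2.2⟩
  have hgrad0 : ∀ q, gradient (potential P 0) q = 0 := fun q => by
    rw [potential_zero, gradient_fun_const]
  have hYc : ∀ s, CkConv r Y (α s) := fun s => by
    have h1 : CkConv r (fun e (x : Phase d × ℝ) => gradient (potential P e) x.1.1) (α s) :=
      (ckConv_potential hI (hmem s)).gradient.comp_contDiff
        (f := fun x : Phase d × ℝ => x.1.1) (by fun_prop)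
    have h2 : CkConv r (fun _ (x : Phase d × ℝ) => x) (α s) := ckConv_id _
    exact ((h2.snd.smul h2.fst.snd).prodMk (h2.snd.smul h1).neg).prodMk
      (ContDiffAt.ckConv contDiffAt_const)
  obtain ⟨Φ, hΦ0, hΦ, hsol⟩ := exists_flow_autonomous (by omega : r ≠ 0) (x := ((q, p), τ)) hYc
    (by simp [hα]) (fun s hs => by
      have h1 : HasDerivAt (fun s : ℝ => q + (s * τ) • p) (τ • p) s := by
        simpa using (((hasDerivAt_id s).mul_const τ).smul_const p).const_add q
      have h2 : HasDerivAt (fun s : ℝ => (((q + (s * τ) • p, p), τ) : Phase d × ℝ))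
          ((τ • p, 0), 0) s := (h1.prodMk (hasDerivAt_const _ _)).prodMk (hasDerivAt_const _ _)
      have h3 : Y 0 (curveExt α s) = ((τ • p, 0), 0) := by
        rw [curveExt_of_mem _ hs]
        simp [hY, hα, hgrad0]
      rw [h3]
      refine h2.hasDerivWithinAt.congr (fun u hu => ?_) ?_ <;>
        rw [curveExt_of_mem _ (by assumption)] <;> rfl)
  have hτev : ∀ᶠ x in 𝓝 ((0 : ℝ≥0), (((q, p), τ) : Phase d × ℝ)), 0 < x.2.2 :=
    (Continuous.tendsto (by fun_prop : Continuous fun x : ℝ≥0 × (Phase d × ℝ) => x.2.2) _).eventually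
      (lt_mem_nhds hτ)
  have hcurve := hΦ.eventually_forall_curve
    (P := fun x => x.2.1.1 ∈ interior B.domain ∧ (x.1 ≠ 0 → P.V x.1 x.2.1.1 ≠ ⊤)) (fun s => by
      rw [hΦ0]
      have hc : Tendsto (fun x : ℝ≥0 × (Phase d × ℝ) => (x.1, x.2.1.1)) (𝓝 (0, α s))
        (𝓝 (0, (α s).1.1)) := Continuous.tendsto (by fun_prop) _
      exact (hc.eventually ((continuous_snd.tendsto ((0 : ℝ≥0), (α s).1.1)).eventually
        (isOpen_interior.mem_nhds (hmem s)))).and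
        (hc.eventually (eventually_potential_ne_top hI (hmem s))))
  refine ⟨fun e x => (Φ e x 1).1, (hΦ.eval 1).fst, by simp [hΦ0, hα], ?_⟩
  filter_upwards [hsol, hτev, hcurve] with x hx hτ' hc
  obtain ⟨e, ⟨q', p'⟩, τ'⟩ := x
  obtain ⟨hx0, hx⟩ := hx
  simp only at hx0 hx hτ' hc ⊢
  set c := curveExt (Φ e ((q', p'), τ')) with hcdef
  have hc0 : c 0 = ((q', p'), τ') := by
    rw [hcdef, curveExt_of_mem _ ⟨le_rfl, zero_le_one⟩]; exact hx0
  have hc1 : c 1 = Φ e ((q', p'), τ') 1 := curveExt_of_mem _ ⟨zero_le_one, le_rfl⟩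
  have hcτ : ∀ s ∈ Icc (0 : ℝ) 1, (c s).2 = τ' :=
    eqOn_of_hasDerivWithinAt_eq (f' := fun _ => 0) (g := fun _ => τ') (fun s hs => (hx s hs).prod_snd)
      (fun s hs => hasDerivWithinAt_const _ _ _) (by rw [hc0])
  have hq : ∀ s ∈ Icc (0 : ℝ) 1, HasDerivWithinAt (fun u => (c u).1.1) (τ' • (c s).1.2) (Icc 0 1) s :=
    fun s hs => by
      have := (hx s hs).prod_fst.prod_fst
      simp only [hY, hcτ s hs] at this
      exact this
  have hp : ∀ s ∈ Icc (0 : ℝ) 1, HasDerivWithinAt (fun u => (c u).1.2)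
      (-(τ' • gradient (potential P e) (c s).1.1)) (Icc 0 1) s := fun s hs => by
    have := (hx s hs).prod_fst.prod_snd
    simp only [hY, hcτ s hs] at this
    exact this
  have hcs : ∀ s (hs : s ∈ Icc (0 : ℝ) 1), c s = Φ e ((q', p'), τ') ⟨s, hs⟩ := fun s hs =>
    curveExt_of_mem _ hs
  refine ⟨fun he => ?_, fun he => ?_⟩
  · have := hamStep_of_timeChange (V := P.V e) (t := fun s => s * τ') (θ := fun _ => τ')
      (fun _ _ => hτ') (fun s _ => by
        simpa using ((hasDerivAt_id s).mul_const τ').hasDerivWithinAt) hq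
      (by rw [potential_of_ne he] at hp; exact hp) (fun s hs => by
        rw [hcs s hs]; exact (hc ⟨s, hs⟩).2 he)
    simpa [hc0, hc1] using this
  · subst he
    have hp' : ∀ s ∈ Icc (0 : ℝ) 1, (c s).1.2 = p' :=
      eqOn_of_hasDerivWithinAt_eq (f' := fun _ => 0) (g := fun _ => p')
        (fun s hs => by simpa [hgrad0] using hp s hs)
        (fun s hs => hasDerivWithinAt_const _ _ _) (by rw [hc0])
    have hq' : ∀ s ∈ Icc (0 : ℝ) 1, (c s).1.1 = q' + (s * τ') • p' :=
      eqOn_of_hasDerivWithinAt_eq (f' := fun _ => τ' • p')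
        (fun s hs => by have := hq s hs; rwa [hp' s hs] at this)
        (fun s hs => by
          simpa using ((((hasDerivAt_id s).mul_const τ').smul_const p').const_add
            q').hasDerivWithinAt) (by rw [hc0]; simp)
    have h1 : (1 : ℝ) ∈ Icc (0 : ℝ) 1 := ⟨zero_le_one, le_rfl⟩
    refine ⟨hτ', ?_, fun s hs => ?_⟩
    · rw [← hc1]
      exact Prod.ext (by rw [hq' 1 h1, one_mul]) (hp' 1 h1)
    · have hs' : s / τ' ∈ Icc (0 : ℝ) 1 := ⟨div_nonneg hs.1 hτ'.le, (div_le_one hτ').2 hs.2⟩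
      have := (hc ⟨_, hs'⟩).1
      rw [← hcs, hq' _ hs', div_mul_cancel₀ _ hτ'.ne'] at this
      exact this

end Families

/-! ### Crossing the layer where the potential is small -/

variable {d r : ℕ} {ι : Type*} {B : BilliardTable d r ι} {P : PotentialData B} {i : ι}

/-- Near a wall the force is normal to the level surfaces of the pattern function. -/
theorem gradient_potential (hIIb : P.ConditionIIb) {e : ℝ≥0} (he : (e : ℝ) ∈ Ioc 0 P.ε₀)
    {q : Config d} (hq : q ∈ P.strip i) {s w : ℝ} (hs : pattern P e q - P.level i = s)
    (hfin : s ∈ finiteSet P i e) (hW : HasDerivAt (fun s => (P.W i e s).toReal) w s) :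
    P.V e q ≠ ⊤ ∧ gradient (fun q => (P.V e q).toReal) q = w • gradient (pattern P e) q := by
  have hs' : P.Q e q - P.level i = s := hs
  refine ⟨by rw [hIIb e he i q hq, hs']; exact hfin.2, ?_⟩
  have hd : DifferentiableAt ℝ (pattern P e) q :=
    ((P.contDiffOn_Q e (Ioc_subset_Icc_self he) i).contDiffAt
      ((isOpen_strip (P := P) (i := i)).mem_nhds hq)).differentiableAt (by simp)
  have h1 : HasFDerivAt (fun x => pattern P e x - P.level i) (fderiv ℝ (pattern P e) q) q :=
    hd.hasFDerivAt.sub_const _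
  have h2 : HasFDerivAt (fun q => (P.V e q).toReal) (w • fderiv ℝ (pattern P e) q) q := by
    subst hs
    refine (hW.comp_hasFDerivAt q h1).congr_of_eventuallyEq ?_
    filter_upwards [(isOpen_strip (P := P) (i := i)).mem_nhds hq] with x hx
    rw [hIIb e he i x hx]; rfl
  rw [gradient, h2.fderiv, map_smul]; rfl

/-- The weights `Δ W'(y(s))`, `y(s) = ya + s Δ`, `Δ = yb - ya`. They are unbounded in general, but
they have constant sign and their integral is the increment of `W`. -/
theorem exists_barrierWeights (hIIc : P.ConditionIIc) {ya yb : ℝ≥0 → ℝ}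
    (hfa : ∀ᶠ e : ℝ≥0 in 𝓝 0, e ≠ 0 → ya e ∈ finiteSet P i e)
    (hfb : ∀ᶠ e : ℝ≥0 in 𝓝 0, e ≠ 0 → yb e ∈ finiteSet P i e)
    (hD : Tendsto (fun e : ℝ≥0 => (P.W i e (yb e)).toReal - (P.W i e (ya e)).toReal) (𝓝[≠] 0)
      (𝓝 0)) :
    ∃ b : ℝ≥0 → C(unitInterval, ℝ), b 0 = 0 ∧
      Tendsto (fun e => ∫ s in (0 : ℝ)..1, |curveExt (b e) s - curveExt (b 0) s|) (𝓝 0) (𝓝 0) ∧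
      ∀ᶠ e : ℝ≥0 in 𝓝 0, e ≠ 0 → ∀ s : unitInterval,
        ya e + s * (yb e - ya e) ∈ finiteSet P i e ∧ ∃ w : ℝ,
          HasDerivAt (fun s => (P.W i e s).toReal) w (ya e + s * (yb e - ya e)) ∧
          b e s = (yb e - ya e) * w := by
  classical
  set W' : ℝ≥0 → ℝ → ℝ := fun e => deriv (fun s => (P.W i e s).toReal) with hW'
  have hex : ∀ e : ℝ≥0, ∃ b : C(unitInterval, ℝ), (e = 0 → b = 0) ∧
      (e ≠ 0 → (e : ℝ) ∈ Ioc 0 P.ε₀ → ya e ∈ finiteSet P i e → yb e ∈ finiteSet P i e →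
        (∀ s : unitInterval, ya e + s * (yb e - ya e) ∈ finiteSet P i e ∧
          b s = (yb e - ya e) * W' e (ya e + s * (yb e - ya e)))) := by
    intro e
    by_cases hc : e ≠ 0 ∧ (e : ℝ) ∈ Ioc 0 P.ε₀ ∧ ya e ∈ finiteSet P i e ∧ yb e ∈ finiteSet P i e
    · obtain ⟨he0, he, ha, hb⟩ := hc
      have hmem : ∀ s : unitInterval, ya e + s * (yb e - ya e) ∈ finiteSet P i e := by
        intro s
        have hseg : ya e + s * (yb e - ya e) ∈ uIcc (ya e) (yb e) := by
          have hs := s.2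
          rcases le_total (ya e) (yb e) with h | h
          · rw [uIcc_of_le h]; constructor <;> nlinarith [hs.1, hs.2]
          · rw [uIcc_of_ge h]; constructor <;> nlinarith [hs.1, hs.2]
        have hJ := (P.ordConnected_J i).uIcc_subset ha.1 hb.1 hseg
        rcases le_total (ya e) (yb e) with h | h
        · rw [uIcc_of_le h] at hseg
          exact (toReal_barrier_le hIIc he ha hJ hseg.1).1
        · rw [uIcc_of_ge h] at hseg
          exact (toReal_barrier_le hIIc he hb hJ hseg.1).1
      have hcont : Continuous fun s : unitInterval =>
          (yb e - ya e) * W' e (ya e + s * (yb e - ya e)) := by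
        refine continuous_const.mul ?_
        have h1 : ContinuousOn (W' e) (finiteSet P i e) :=
          (P.contDiffOn_W i e he).continuousOn_deriv_of_isOpen (isOpen_finiteSet he) (by simp)
        exact h1.comp_continuous (by fun_prop) hmem
      exact ⟨⟨_, hcont⟩, fun h => (he0 h).elim, fun _ _ _ _ s => ⟨hmem s, rfl⟩⟩
    · exact ⟨0, fun _ => rfl, fun h1 h2 h3 h4 => (hc ⟨h1, h2, h3, h4⟩).elim⟩
  choose b hb0 hb using hex
  have hev : ∀ᶠ e : ℝ≥0 in 𝓝 0, e ≠ 0 → (e : ℝ) ∈ Ioc 0 P.ε₀ ∧ ∀ s : unitInterval,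
      ya e + s * (yb e - ya e) ∈ finiteSet P i e ∧
        b e s = (yb e - ya e) * W' e (ya e + s * (yb e - ya e)) := by
    filter_upwards [hfa, hfb, eventually_mem_Ioc P] with e h1 h2 h3 h
    exact ⟨h3 h, hb e h (h3 h) (h1 h) (h2 h)⟩
  refine ⟨b, hb0 0 rfl, ?_, ?_⟩
  · have hD' : Tendsto (fun e : ℝ≥0 => if e = 0 then 0 else
        |(P.W i e (yb e)).toReal - (P.W i e (ya e)).toReal|) (𝓝 0) (𝓝 0) := by
      rw [← nhdsNE_sup_pure (0 : ℝ≥0), tendsto_sup]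
      refine ⟨?_, ?_⟩
      · have := hD.abs
        rw [abs_zero] at this
        refine this.congr' ?_
        filter_upwards [self_mem_nhdsWithin] with e he
        rw [if_neg (show e ≠ 0 from he)]
      · rw [tendsto_pure_left]
        intro s hs
        simpa using mem_of_mem_nhds hs
    refine hD'.congr' ?_
    filter_upwards [hev] with e he
    rcases eq_or_ne e 0 with h | h
    · simp [h]
    rw [if_neg h, hb0 0 rfl]
    obtain ⟨hε, he⟩ := he h
    set y : ℝ → ℝ := fun s => ya e + s * (yb e - ya e) with hy
    have hbs : ∀ s ∈ Icc (0 : ℝ) 1, y s ∈ finiteSet P i e ∧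
        curveExt (b e) s = (yb e - ya e) * W' e (y s) := fun s hs => by
      rw [curveExt_of_mem _ hs]; exact he ⟨s, hs⟩
    have hder : ∀ s ∈ uIcc (0 : ℝ) 1, HasDerivAt (fun s => (P.W i e (y s)).toReal)
        (curveExt (b e) s) s := fun s hs => by
      rw [uIcc_of_le zero_le_one] at hs
      have h1 : HasDerivAt y (yb e - ya e) s := by
        have := ((hasDerivAt_id s).mul_const (yb e - ya e)).const_add (ya e)
        rwa [one_mul] at this
      have h2 := (hasDerivAt_barrier hε (hbs s hs).1).comp s h1
      rw [(hbs s hs).2, mul_comm]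
      exact h2
    have hint : ∫ s in (0 : ℝ)..1, curveExt (b e) s =
        (P.W i e (yb e)).toReal - (P.W i e (ya e)).toReal := by
      rw [intervalIntegral.integral_eq_sub_of_hasDerivAt hder
        ((continuous_curveExt _).intervalIntegrable _ _)]
      simp [hy]
    have hz : ∀ s, curveExt (0 : C(unitInterval, ℝ)) s = 0 := fun s => rfl
    simp only [hz, sub_zero]
    rw [← hint]
    have hneg : ∀ s ∈ Icc (0 : ℝ) 1, W' e (y s) < 0 := fun s hs =>
      deriv_barrier_neg hIIc hε (hbs s hs).1
    rcases le_total 0 (yb e - ya e) with hΔ | hΔ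
    · have h1 : ∀ s ∈ Icc (0 : ℝ) 1, curveExt (b e) s ≤ 0 := fun s hs => by
        rw [(hbs s hs).2]; exact mul_nonpos_of_nonneg_of_nonpos hΔ (hneg s hs).le
      have h2 : ∫ s in (0 : ℝ)..1, |curveExt (b e) s| = -∫ s in (0 : ℝ)..1, curveExt (b e) s := by
        rw [← intervalIntegral.integral_neg]
        refine intervalIntegral.integral_congr fun s hs => ?_
        rw [uIcc_of_le zero_le_one] at hs
        exact abs_of_nonpos (h1 s hs)
      rw [h2, abs_of_nonpos]
      have : 0 ≤ ∫ s in (0 : ℝ)..1, |curveExt (b e) s| :=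
        intervalIntegral.integral_nonneg zero_le_one fun _ _ => abs_nonneg _
      linarith
    · have h1 : ∀ s ∈ Icc (0 : ℝ) 1, 0 ≤ curveExt (b e) s := fun s hs => by
        rw [(hbs s hs).2]; exact mul_nonneg_of_nonpos_of_nonpos hΔ (hneg s hs).le
      have h2 : ∫ s in (0 : ℝ)..1, |curveExt (b e) s| = ∫ s in (0 : ℝ)..1, curveExt (b e) s := by
        refine intervalIntegral.integral_congr fun s hs => ?_
        rw [uIcc_of_le zero_le_one] at hs
        exact abs_of_nonneg (h1 s hs)
      rw [h2, abs_of_nonneg (intervalIntegral.integral_nonneg zero_le_one h1)]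
  · filter_upwards [hev] with e he h s
    obtain ⟨hε, he⟩ := he h
    exact ⟨(he s).1, _, hasDerivAt_barrier hε (he s).1, (he s).2⟩

/-- Motion between two level surfaces of the pattern function, parametrized by the value of the
pattern function instead of time. It converges to free motion as long as the increment of the
barrier function between the two values tends to zero, even though the force need not be bounded.
The last component of the map is the duration. -/
theorem exists_crossing (hr : 1 ≤ r) (hIIb : P.ConditionIIb) (hIIc : P.ConditionIIc)
    {q p : Config d} {ℓ κ : ℝ} (hℓ : 0 < ℓ) {O : Set (Config d)} (hO : IsOpen O)
    (hOs : O ⊆ P.strip i) (hqO : ∀ u ∈ Icc 0 ℓ, q + u • p ∈ O)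
    (hκ : ∀ u ∈ Icc 0 ℓ, 0 < κ * inner ℝ p (gradient (pattern P 0) (q + u • p)))
    {ya yb : ℝ≥0 → ℝ} (hya : Tendsto ya (𝓝 0) (𝓝 (ya 0))) (hyb : Tendsto yb (𝓝 0) (𝓝 (yb 0)))
    (hya0 : pattern P 0 q - P.level i = ya 0) (hyb0 : pattern P 0 (q + ℓ • p) - P.level i = yb 0)
    (hfa : ∀ᶠ e : ℝ≥0 in 𝓝 0, e ≠ 0 → ya e ∈ finiteSet P i e)
    (hfb : ∀ᶠ e : ℝ≥0 in 𝓝 0, e ≠ 0 → yb e ∈ finiteSet P i e)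
    (hD : Tendsto (fun e : ℝ≥0 => (P.W i e (yb e)).toReal - (P.W i e (ya e)).toReal) (𝓝[≠] 0)
      (𝓝 0)) :
    ∃ A : ℝ≥0 → Phase d → Phase d × ℝ, CkConv r A (q, p) ∧ A 0 (q, p) = ((q + ℓ • p, p), ℓ) ∧
      ∀ᶠ x in 𝓝 ((0 : ℝ≥0), ((q, p) : Phase d)), pattern P x.1 x.2.1 - P.level i = ya x.1 →
        pattern P x.1 (A x.1 x.2).1.1 - P.level i = yb x.1 ∧
        (x.1 ≠ 0 → HamStep (P.V x.1) (A x.1 x.2).2 x.2 (A x.1 x.2).1) ∧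
        (x.1 = 0 → ∃ t, 0 < t ∧ A 0 x.2 = ((x.2.1 + t • x.2.2, x.2.2), t) ∧
          ∀ u ∈ Icc 0 t, x.2.1 + u • x.2.2 ∈ O ∧ ∃ s ∈ Icc (0 : ℝ) 1, (u < t → s < 1) ∧
            (0 < u → 0 < s) ∧
            pattern P 0 (x.2.1 + u • x.2.2) - P.level i = ya 0 + s * (yb 0 - ya 0)) := by
  obtain ⟨b, hb0, hbt, hb⟩ := exists_barrierWeights hIIc hfa hfb hD
  set Δ : ℝ≥0 → ℝ := fun e => yb e - ya e with hΔ
  have hΔt : Tendsto Δ (𝓝 0) (𝓝 (Δ 0)) := hyb.sub hya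
  set N : ℝ≥0 → Phase d × ℝ → Config d := fun e x => gradient (pattern P e) x.1.1 with hN
  set ν : ℝ≥0 → Phase d × ℝ → ℝ := fun e x => inner ℝ x.1.2 (N e x) with hν
  set Y : ℝ≥0 → Phase d × ℝ → Phase d × ℝ := fun e x =>
    (((Δ e * (ν e x)⁻¹) • x.1.2, 0), Δ e * (ν e x)⁻¹) with hY
  set Z : ℝ≥0 → Phase d × ℝ → Phase d × ℝ := fun e x =>
    ((0, -((ν e x)⁻¹ • N e x)), 0) with hZ
  have hdiff : ∀ u ∈ Icc 0 ℓ, DifferentiableAt ℝ (pattern P 0) (q + u • p) := fun u hu =>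
    (ckConv_pattern (hOs (hqO u hu))).at.differentiableAt.self_of_nhds
  -- the limit curve: inversion of the monotone function `u ↦ Q(q + u p; 0)`
  obtain ⟨hmono, g, hgl, hg⟩ := exists_inverse_of_deriv_pos hℓ.le
    (f := fun u => κ * (pattern P 0 (q + u • p) - P.level i))
    (f' := fun u => κ * inner ℝ p (gradient (pattern P 0) (q + u • p))) (fun u hu => by
      have h1 : HasDerivWithinAt (fun u : ℝ => q + u • p) p (Icc 0 ℓ) u := by
        simpa using (((hasDerivAt_id u).smul_const p).const_add q).hasDerivWithinAt
      exact ((hasDerivWithinAt_comp_gradient (hdiff u hu) h1).sub_const _).const_mul κ) hκ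
  have hlt := hmono (left_mem_Icc.2 hℓ.le) (right_mem_Icc.2 hℓ.le) hℓ
  simp only [zero_smul, add_zero, hya0, hyb0] at hlt hg
  set c : ℝ → ℝ := fun s => κ * (ya 0 + s * Δ 0) with hc
  have hcm : ∀ s ∈ Icc (0 : ℝ) 1, c s ∈ Icc (κ * ya 0) (κ * yb 0) := fun s hs => by
    simp only [hc, hΔ]; constructor <;> nlinarith [hs.1, hs.2]
  have hcd : ∀ s, HasDerivAt c (κ * Δ 0) s := fun s => by
    simpa using (((hasDerivAt_id s).mul_const (Δ 0)).const_add (ya 0)).const_mul κ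
  set u : ℝ → ℝ := fun s => g (c s) with hu
  have hum : ∀ s ∈ Icc (0 : ℝ) 1, u s ∈ Icc 0 ℓ := fun s hs => (hg _ (hcm s hs)).1
  set x₀ : ℝ → Phase d × ℝ := fun s => ((q + u s • p, p), u s) with hx₀
  have hud : ∀ s ∈ Icc (0 : ℝ) 1, HasDerivWithinAt u (Δ 0 * (ν 0 (x₀ s))⁻¹) (Icc 0 1) s := by
    intro s hs
    have h1 := (hg _ (hcm s hs)).2.2.comp s (hcd s).hasDerivWithinAt hcm
    have h2 := hκ _ (hum s hs)
    have h3 : (κ * inner ℝ p (gradient (pattern P 0) (q + g (c s) • p)))⁻¹ * (κ * Δ 0) =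
        Δ 0 * (ν 0 (x₀ s))⁻¹ := by
      have hκ0 : κ ≠ 0 := by rintro rfl; simp at h2
      simp only [hν, hN, hx₀, hu]
      rw [mul_inv]
      field_simp
    rw [h3] at h1
    exact h1
  have hx₀d : ∀ s ∈ Icc (0 : ℝ) 1, HasDerivWithinAt x₀ (Y 0 (x₀ s)) (Icc 0 1) s := fun s hs =>
    ((((hud s hs).smul_const p).const_add q).prodMk (hasDerivWithinAt_const _ _ _)).prodMk (hud s hs)
  set α : C(unitInterval, Phase d × ℝ) := ⟨fun s => x₀ s,
    continuousOn_iff_continuous_domRestrict.1 fun s hs => (hx₀d s hs).continuousWithinAt⟩ with hα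
  have hu0 : u 0 = 0 := by
    have := hgl 0 (left_mem_Icc.2 hℓ.le)
    simpa [hya0, hu, hc] using this
  have hu1 : u 1 = ℓ := by
    have := hgl ℓ (right_mem_Icc.2 hℓ.le)
    simpa [hyb0, hu, hc, hΔ] using this
  have hαO : ∀ s, (α s).1.1 ∈ O := fun s => hqO _ (hum s s.2)
  have hpos : ∀ s, 0 < Δ 0 * (ν 0 (α s))⁻¹ := fun s => by
    have h1 : 0 < κ * ν 0 (α s) := hκ _ (hum s s.2)
    have h2 : 0 < κ * Δ 0 := by simp only [hΔ]; linarith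
    have h3 : 0 < (κ * Δ 0) * (κ * ν 0 (α s))⁻¹ := mul_pos h2 (inv_pos.2 h1)
    have hκ0 : κ ≠ 0 := by rintro rfl; simp at h2
    have h4 : (κ * Δ 0) * (κ * ν 0 (α s))⁻¹ = Δ 0 * (ν 0 (α s))⁻¹ := by
      rw [mul_inv]; field_simp
    rwa [h4] at h3
  have hνne : ∀ s, ν 0 (α s) ≠ 0 := fun s h => by have := hpos s; rw [h] at this; simp at this
  have hid : ∀ s, CkConv r (fun _ (x : Phase d × ℝ) => x) (α s) := fun s => ckConv_id _
  have hNc : ∀ s, CkConv r N (α s) := fun s =>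
    (ckConv_pattern (hOs (hαO s))).gradient.comp_contDiff (f := fun x : Phase d × ℝ => x.1.1)
      (by fun_prop)
  have hνc : ∀ s, CkConv r ν (α s) := fun s => (hid s).fst.snd.inner (hNc s)
  have hθc : ∀ s, CkConv r (fun e x => Δ e * (ν e x)⁻¹) (α s) := fun s =>
    (ckConv_const hΔt _).smul ((hνc s).inv (hνne s))
  have hYc : ∀ s, CkConv r Y (α s) := fun s =>
    (((hθc s).smul (hid s).fst.snd).prodMk (ContDiffAt.ckConv contDiffAt_const)).prodMk (hθc s)
  have hZc : ∀ s, CkConv r Z (α s) := fun s =>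
    ((ContDiffAt.ckConv contDiffAt_const).prodMk
      (((hνc s).inv (hνne s)).smul (hNc s)).neg).prodMk (ContDiffAt.ckConv contDiffAt_const)
  obtain ⟨Φ, hΦ0, hΦ, hsol⟩ := exists_flow (by omega : r ≠ 0) (a := fun _ => 1) (b := b) (Y := Y)
    (Z := Z) (x := ((q, p), 0)) (by simp) hbt hYc hZc (by simp [hα, hx₀, hu0]) (fun s => by
      rw [hb0]
      simp only [ContinuousMap.one_apply, one_smul, ContinuousMap.zero_apply, zero_smul, add_zero]
      refine (hx₀d s s.2).congr (fun v hv => ?_) ?_ <;>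
        rw [curveExt_of_mem _ (by first | assumption | exact s.2)] <;> rfl)
  have hcurve := hΦ.eventually_forall_curve
    (P := fun x => x.2.1.1 ∈ O ∧ 0 < Δ x.1 * (ν x.1 x.2)⁻¹ ∧
      DifferentiableAt ℝ (pattern P x.1) x.2.1.1) (fun s => by
      rw [hΦ0]
      have hc1 : Tendsto (fun x : ℝ≥0 × (Phase d × ℝ) => (x.1, x.2.1.1)) (𝓝 (0, α s))
        (𝓝 (0, (α s).1.1)) := Continuous.tendsto (by fun_prop) _
      refine (hc1.eventually ((continuous_snd.tendsto ((0 : ℝ≥0), (α s).1.1)).eventually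
        (hO.mem_nhds (hαO s)))).and (((hθc s).at.tendsto.eventually (lt_mem_nhds (hpos s))).and ?_)
      exact hc1.eventually (ckConv_pattern (hOs (hαO s))).at.differentiableAt)
  have hι : ContDiffAt ℝ r (fun z : Phase d => (z, (0 : ℝ))) (q, p) := by fun_prop
  have hιt : Tendsto (fun x : ℝ≥0 × Phase d => (x.1, (x.2, (0 : ℝ)))) (𝓝 (0, (q, p)))
      (𝓝 (0, ((q, p), 0))) := Continuous.tendsto (by fun_prop) _
  have hbev : ∀ᶠ e : ℝ≥0 in 𝓝 0, e ≠ 0 → (e : ℝ) ∈ Ioc 0 P.ε₀ ∧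
      ∀ s : unitInterval, ya e + s * Δ e ∈ finiteSet P i e ∧ ∃ w : ℝ,
        HasDerivAt (fun s => (P.W i e s).toReal) w (ya e + s * Δ e) ∧ b e s = Δ e * w := by
    filter_upwards [eventually_mem_Ioc P, hb] with e h1 h2 h3 using ⟨h1 h3, h2 h3⟩
  refine ⟨fun e z => Φ e (z, 0) 1, (hΦ.eval 1).comp_contDiff (f := fun z : Phase d => (z, (0 : ℝ)))
    hι, by simp [hΦ0, hα, hx₀, hu1], ?_⟩
  filter_upwards [hιt.eventually hsol, hιt.eventually hcurve,
    (continuous_fst.tendsto ((0 : ℝ≥0), ((q, p) : Phase d))).eventually hbev] with x hx hcx hbx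
  obtain ⟨e, q', p'⟩ := x
  simp only at hx hcx hbx ⊢
  obtain ⟨hx0, hx⟩ := hx
  intro hstart
  set γ := curveExt (Φ e ((q', p'), 0)) with hγ
  have hγs : ∀ s (hs : s ∈ Icc (0 : ℝ) 1), γ s = Φ e ((q', p'), 0) ⟨s, hs⟩ := fun s hs =>
    curveExt_of_mem _ hs
  have h0m : (0 : ℝ) ∈ Icc (0 : ℝ) 1 := ⟨le_rfl, zero_le_one⟩
  have h1m : (1 : ℝ) ∈ Icc (0 : ℝ) 1 := ⟨zero_le_one, le_rfl⟩
  have hγ0 : γ 0 = ((q', p'), 0) := (hγs 0 h0m).trans hx0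
  have hγ1 : γ 1 = Φ e ((q', p'), 0) 1 := hγs 1 h1m
  set θ : ℝ → ℝ := fun s => Δ e * (ν e (γ s))⁻¹ with hθ
  have hclose : ∀ s ∈ Icc (0 : ℝ) 1, (γ s).1.1 ∈ O ∧ 0 < θ s ∧
      DifferentiableAt ℝ (pattern P e) (γ s).1.1 := fun s hs => by
    simp only [hθ]; rw [hγs s hs]; exact hcx ⟨s, hs⟩
  have hsolve : ∀ s (hs : s ∈ Icc (0 : ℝ) 1), HasDerivWithinAt γ
      (Y e (γ s) + b e ⟨s, hs⟩ • Z e (γ s)) (Icc 0 1) s := fun s hs => by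
    have := hx ⟨s, hs⟩
    rw [hγs s hs]
    simpa using this
  have hq : ∀ s ∈ Icc (0 : ℝ) 1, HasDerivWithinAt (fun s => (γ s).1.1) (θ s • (γ s).1.2)
      (Icc 0 1) s := fun s hs => by
    have := (hsolve s hs).prod_fst.prod_fst
    simpa [hY, hZ] using this
  have hp : ∀ s (hs : s ∈ Icc (0 : ℝ) 1), HasDerivWithinAt (fun s => (γ s).1.2)
      (-((b e ⟨s, hs⟩ * (ν e (γ s))⁻¹) • N e (γ s))) (Icc 0 1) s := fun s hs => by
    have := (hsolve s hs).prod_fst.prod_snd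
    simpa [hY, hZ, mul_smul] using this
  have ht : ∀ s ∈ Icc (0 : ℝ) 1, HasDerivWithinAt (fun s => (γ s).2) (θ s) (Icc 0 1) s :=
    fun s hs => by
      have := (hsolve s hs).prod_snd
      simpa [hY, hZ] using this
  -- the independent variable is the value of the pattern function
  have hinv : ∀ s ∈ Icc (0 : ℝ) 1, pattern P e (γ s).1.1 - P.level i = ya e + s * Δ e :=
    eqOn_of_hasDerivWithinAt_eq (f' := fun _ => Δ e) (fun s hs => by
      have h1 := (hasDerivWithinAt_comp_gradient (hclose s hs).2.2 (hq s hs)).sub_const (P.level i)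
      have h2 : inner ℝ (θ s • (γ s).1.2) (gradient (pattern P e) (γ s).1.1) = Δ e := by
        have h3 : ν e (γ s) ≠ 0 := fun h => by
          have := (hclose s hs).2.1
          simp [hθ, h] at this
        rw [real_inner_smul_left]
        exact inv_mul_cancel_right₀ h3 _
      rwa [h2] at h1)
      (fun s _ => by
        simpa using (((hasDerivAt_id s).mul_const (Δ e)).const_add (ya e)).hasDerivWithinAt)
      (by rw [hγ0]; simpa using hstart)
  refine ⟨?_, fun he => ?_, fun he => ?_⟩
  · have := hinv 1 h1m
    rw [hγ1] at this
    rw [this]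
    simp [hΔ]
  · obtain ⟨hε, hbx⟩ := hbx he
    have key : ∀ s (hs : s ∈ Icc (0 : ℝ) 1), P.V e (γ s).1.1 ≠ ⊤ ∧
        (b e ⟨s, hs⟩ * (ν e (γ s))⁻¹) • N e (γ s) =
          θ s • gradient (fun q => (P.V e q).toReal) (γ s).1.1 := fun s hs => by
      obtain ⟨h1, w, h2, h3⟩ := hbx ⟨s, hs⟩
      obtain ⟨h4, h5⟩ := gradient_potential hIIb hε (hOs (hclose s hs).1) (hinv s hs) h1 h2
      refine ⟨h4, ?_⟩
      rw [h5, h3, smul_smul]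
      congr 1
      simp only [hθ]; ring
    have := hamStep_of_timeChange (V := P.V e) (t := fun s => (γ s).2) (θ := θ)
      (q := fun s => (γ s).1.1) (p := fun s => (γ s).1.2) (fun s hs => (hclose s hs).2.1) ht hq
      (fun s hs => by rw [← (key s hs).2]; exact hp s hs) (fun s hs => (key s hs).1)
    rw [hγ0, hγ1] at this
    simpa using this
  · subst he
    have hp' : ∀ s ∈ Icc (0 : ℝ) 1, (γ s).1.2 = p' :=
      eqOn_of_hasDerivWithinAt_eq (f' := fun _ => 0) (fun s hs => by simpa [hb0] using hp s hs)
        (fun s _ => hasDerivWithinAt_const _ _ _) (by rw [hγ0])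
    have hq' : ∀ s ∈ Icc (0 : ℝ) 1, (γ s).1.1 = q' + (γ s).2 • p' :=
      eqOn_of_hasDerivWithinAt_eq (f' := fun s => θ s • p')
        (fun s hs => by have := hq s hs; rwa [hp' s hs] at this)
        (fun s hs => ((ht s hs).smul_const p').const_add q') (by rw [hγ0]; simp)
    obtain ⟨htm, g', -, hg'⟩ := exists_inverse_of_deriv_pos zero_le_one ht
      fun s hs => (hclose s hs).2.1
    have ht0 : (γ 0).2 = 0 := by rw [hγ0]
    have htpos : 0 < (γ 1).2 := by
      have := htm h0m h1m zero_lt_one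
      simpa only [ht0] using this
    refine ⟨(γ 1).2, htpos, ?_, fun v hv => ?_⟩
    · rw [← hγ1]
      exact Prod.ext (Prod.ext (hq' 1 h1m) (hp' 1 h1m)) rfl
    · obtain ⟨h1, h2, -⟩ := hg' v (by simpa only [ht0] using hv)
      have h3 : (γ (g' v)).1.1 = q' + v • p' := by rw [hq' _ h1]; simp only [h2]
      refine ⟨h3 ▸ (hclose _ h1).1, g' v, h1, fun hlt => ?_, fun hlt => ?_, ?_⟩
      · refine lt_of_le_of_ne h1.2 fun h => ?_
        simp only [h] at h2
        exact hlt.ne h2.symm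
      · refine lt_of_le_of_ne h1.1 fun h => ?_
        simp only [← h, ht0] at h2
        exact hlt.ne h2
      · have := hinv _ h1
        rwa [h3] at this

/-! ### Reflection by the barrier -/

variable {d r : ℕ} {ι : Type*} {B : BilliardTable d r ι} {P : PotentialData B} {i : ι}

theorem reflect_normalize (N p : Config d) :
    reflect (‖N‖⁻¹ • N) p = p + (-2 * inner ℝ p N / ‖N‖ ^ 2) • N := by
  rw [reflect, real_inner_smul_right, smul_smul, sub_eq_add_neg, ← neg_smul]
  congr 2
  rw [div_eq_mul_inv, ← inv_pow]
  ring

theorem isInvertible_of_apply_one {L : ℝ →L[ℝ] ℝ} (h : L 1 ≠ 0) : L.IsInvertible := by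
  refine ⟨ContinuousLinearEquiv.unitsEquivAut ℝ (Units.mk0 (L 1) h), ?_⟩
  ext
  simp

/-- A function with increasing derivative that takes the same value at both ends of `[0, 1]` stays
below it; here `w' = -σ h` with `h` increasing, so that `w` stays above. -/
theorem le_of_concave {w h : ℝ → ℝ} {σ ν : ℝ} (hσ : 0 < σ)
    (hw : ∀ s ∈ Icc (0 : ℝ) 1, HasDerivWithinAt w (-(σ * h s)) (Icc 0 1) s)
    (hh : StrictMonoOn h (Icc 0 1)) (h0 : w 0 = ν) (h1 : w 1 = ν) :
    ∀ s ∈ Icc (0 : ℝ) 1, ν ≤ w s := by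
  intro s hs
  by_contra! hlt
  have hs0 : 0 < s := lt_of_le_of_ne hs.1 (by rintro rfl; exact hlt.ne h0)
  have hs1 : s < 1 := lt_of_le_of_ne hs.2 (by rintro rfl; exact hlt.ne h1)
  have hc : ContinuousOn w (Icc 0 1) := fun s hs => (hw s hs).continuousWithinAt
  have hd : ∀ u ∈ Ioo (0 : ℝ) 1, HasDerivAt w (-(σ * h u)) u := fun u hu =>
    (hw u (Ioo_subset_Icc_self hu)).hasDerivAt (Icc_mem_nhds hu.1 hu.2)
  obtain ⟨a, ha, ha'⟩ := exists_hasDerivAt_eq_slope w (fun s => -(σ * h s)) hs0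
    (hc.mono (Icc_subset_Icc_right hs.2)) fun u hu => hd u ⟨hu.1, hu.2.trans hs1⟩
  obtain ⟨b, hb, hb'⟩ := exists_hasDerivAt_eq_slope w (fun s => -(σ * h s)) hs1
    (hc.mono (Icc_subset_Icc_left hs.1)) fun u hu => hd u ⟨hs0.trans hu.1, hu.2⟩
  have h2 : -(σ * h a) < 0 := by
    rw [ha']; exact div_neg_of_neg_of_pos (by linarith) (by linarith)
  have h3 : 0 < -(σ * h b) := by
    rw [hb']; exact div_pos (by linarith) (by linarith)
  have h4 := hh ⟨ha.1.le, ha.2.le.trans hs.2⟩ ⟨hs.1.trans hb.1.le, hb.2.le⟩ (ha.2.trans hb.1)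
  linarith [mul_lt_mul_of_pos_left h4 hσ]

set_option maxHeartbeats 800000 in
/-- Motion in the layer where the potential is not small, between two passages through the level
`V = ν e`. It is parametrized so that the momentum changes at unit rate along the normal (up to the
factor `σ`); then the value `w` of the potential is a regular state variable, and the time spent in
the layer tends to zero with the inverse barrier function. The last component of the map is
the duration. -/
theorem exists_reflection (hr : 1 ≤ r) (hIIb : P.ConditionIIb)
    {w₀ : ℝ} (D : BarrierInverse P i w₀) {q p : Config d} (hq : q ∈ P.strip i)
    (hin : inner ℝ p (gradient (pattern P 0) q) < 0) (hE : ‖p‖ ^ 2 / 2 < w₀) :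
    ∃ R : ℝ≥0 → Phase d → Phase d × ℝ, CkConv r R (q, p) ∧
      R 0 (q, p) = ((q, reflect (‖gradient (pattern P 0) q‖⁻¹ • gradient (pattern P 0) q) p), 0) ∧
      ∀ᶠ x in 𝓝 ((0 : ℝ≥0), ((q, p) : Phase d)),
        pattern P x.1 x.2.1 - P.level i = D.I x.1 (D.ν x.1) →
        pattern P x.1 (R x.1 x.2).1.1 - P.level i = D.I x.1 (D.ν x.1) ∧
        (x.1 ≠ 0 → HamStep (P.V x.1) (R x.1 x.2).2 x.2 (R x.1 x.2).1) ∧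
        (x.1 = 0 → R 0 x.2 = ((x.2.1, reflect (‖gradient (pattern P 0) x.2.1‖⁻¹ •
          gradient (pattern P 0) x.2.1) x.2.2), 0)) := by
  obtain ⟨r, rfl⟩ : ∃ k, r = k + 1 := ⟨r - 1, by omega⟩
  set N : ℝ≥0 → Config d → Config d := fun e => gradient (pattern P e) with hN
  set n := N 0 q with hn
  have hnpos : 0 < ‖n‖ := norm_pos_iff.2 fun h => by
    have hin' : inner ℝ p n < 0 := hin
    rw [h, inner_zero_right] at hin'; exact lt_irrefl _ hin'
  set m := -inner ℝ p n with hm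
  have hmpos : 0 < m := neg_pos.2 hin
  set σ₀ := 2 * m / ‖n‖ ^ 2 with hσ₀
  have hσ₀pos : 0 < σ₀ := by positivity
  have hσ₀n : σ₀ * ‖n‖ ^ 2 = 2 * m := by rw [hσ₀]; field_simp
  -- states are `((q, p), (t, w), σ)`
  set Y : ℝ≥0 → Phase d × (ℝ × ℝ) × ℝ → Phase d × (ℝ × ℝ) × ℝ := fun e x =>
    ((-(x.2.2 * D.G e x.2.1.2) • x.1.2, x.2.2 • N e x.1.1),
      (-(x.2.2 * D.G e x.2.1.2), -(x.2.2 * inner ℝ x.1.2 (N e x.1.1))), 0) with hY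
  set wl : ℝ → ℝ := fun s => σ₀ * m * s - (σ₀ * s) ^ 2 / 2 * ‖n‖ ^ 2 with hwl
  have hwl' : ∀ s, wl s = σ₀ * m * (s * (1 - s)) := fun s => by
    simp only [hwl]
    linear_combination (-(σ₀ * s ^ 2) / 2) * hσ₀n
  have hwlmem : ∀ s ∈ Icc (0 : ℝ) 1, wl s ∈ Ioo (-1) w₀ := fun s hs => by
    rw [hwl']
    have h1 : 0 ≤ s * (1 - s) := mul_nonneg hs.1 (by linarith [hs.2])
    have h2 : s * (1 - s) ≤ 1 / 4 := by nlinarith [sq_nonneg (s - 1 / 2)]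
    have h3 : 0 ≤ σ₀ * m := by positivity
    have h4 : m ≤ ‖p‖ * ‖n‖ := by
      rw [hm]; exact (neg_le_abs _).trans (abs_real_inner_le_norm p n)
    have h5 : σ₀ * m ≤ 2 * ‖p‖ ^ 2 := by
      rw [hσ₀, div_mul_eq_mul_div, div_le_iff₀ (by positivity)]
      nlinarith
    constructor
    · nlinarith
    · nlinarith
  set αf : ℝ → Phase d × (ℝ × ℝ) × ℝ := fun s => ((q, p + (s * σ₀) • n), (0, wl s), σ₀) with hαf
  set α : C(unitInterval, Phase d × (ℝ × ℝ) × ℝ) := ⟨fun s => αf s, by fun_prop⟩ with hα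
  have hid : ∀ s, CkConv (r + 1) (fun _ (x : Phase d × (ℝ × ℝ) × ℝ) => x) (α s) :=
    fun s => ckConv_id _
  have hNc : ∀ s, CkConv (r + 1) (fun e (x : Phase d × (ℝ × ℝ) × ℝ) => N e x.1.1) (α s) :=
    fun s => CkConv.comp_contDiff (g := N) (f := fun x : Phase d × (ℝ × ℝ) × ℝ => x.1.1)
      (ckConv_pattern hq).gradient (by fun_prop)
  have hGc : ∀ s, CkConv (r + 1) (fun e (x : Phase d × (ℝ × ℝ) × ℝ) => D.G e x.2.1.2) (α s) :=
    fun s => CkConv.comp_contDiff (g := D.G) (f := fun x : Phase d × (ℝ × ℝ) × ℝ => x.2.1.2)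
      (D.ckConv_G _ (hwlmem s s.2)) (by fun_prop)
  have hYc : ∀ s, CkConv (r + 1) Y (α s) := fun s =>
    ((((hid s).snd.snd.smul (hGc s)).neg.smul (hid s).fst.snd).prodMk
      ((hid s).snd.snd.smul (hNc s))).prodMk
    ((((hid s).snd.snd.smul (hGc s)).neg.prodMk
      ((hid s).snd.snd.smul ((hid s).fst.snd.inner (hNc s))).neg).prodMk
        (ContDiffAt.ckConv contDiffAt_const))
  obtain ⟨Φ, hΦ0, hΦ, hsol⟩ := exists_flow_autonomous (by omega : r + 1 ≠ 0)
    (x := ((q, p), (0, 0), σ₀)) hYc (by simp [hα, hαf, hwl]) (fun s hs => by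
      have h1 : HasDerivAt (fun s : ℝ => p + (s * σ₀) • n) (σ₀ • n) s := by
        simpa using (((hasDerivAt_id s).mul_const σ₀).smul_const n).const_add p
      have h2 : HasDerivAt wl (-(σ₀ * inner ℝ (p + (s * σ₀) • n) n)) s := by
        have h3 : HasDerivAt wl (σ₀ * m * 1 - (2 * (σ₀ * s) ^ 1 * (σ₀ * 1)) / 2 * ‖n‖ ^ 2) s :=
          ((hasDerivAt_id s).const_mul _).sub
            ((((((hasDerivAt_id s).const_mul σ₀)).pow 2).div_const 2).mul_const _)
        convert h3 using 1
        rw [inner_add_left, real_inner_smul_left, real_inner_self_eq_norm_sq, hm]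
        ring
      have h3 : HasDerivAt αf ((0, σ₀ • n), (0, -(σ₀ * inner ℝ (p + (s * σ₀) • n) n)), 0) s :=
        ((hasDerivAt_const _ _).prodMk h1).prodMk
          (((hasDerivAt_const _ _).prodMk h2).prodMk (hasDerivAt_const _ _))
      have h4 : Y 0 (curveExt α s) =
          ((0, σ₀ • n), (0, -(σ₀ * inner ℝ (p + (s * σ₀) • n) n)), 0) := by
        rw [curveExt_of_mem _ hs]
        simp [hY, hα, hαf, D.G_zero, hn]
      rw [h4]
      refine h3.hasDerivWithinAt.congr (fun u hu => ?_) ?_ <;>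
        rw [curveExt_of_mem _ (by assumption)] <;> rfl)
  -- what holds near the limit curve
  have hcurve := hΦ.eventually_forall_curve
    (P := fun x => x.2.1.1 ∈ P.strip i ∧ DifferentiableAt ℝ (pattern P x.1) x.2.1.1 ∧
      DifferentiableAt ℝ (N x.1) x.2.1.1 ∧ x.2.2.1.2 < w₀ ∧
      0 < x.2.2.2 * ‖N x.1 x.2.1.1‖ ^ 2 - x.2.2.2 * D.G x.1 x.2.2.1.2 *
        inner ℝ x.2.1.2 (fderiv ℝ (N x.1) x.2.1.1 x.2.1.2)) (fun s => by
      rw [hΦ0]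
      have hc1 : Tendsto (fun x : ℝ≥0 × (Phase d × (ℝ × ℝ) × ℝ) => (x.1, x.2.1.1)) (𝓝 (0, α s))
        (𝓝 (0, q)) := Continuous.tendsto (by fun_prop) _
      have hc2 : Tendsto (fun x : ℝ≥0 × (Phase d × (ℝ × ℝ) × ℝ) => x.2.2.1.2) (𝓝 (0, α s))
        (𝓝 (wl s)) := Continuous.tendsto (by fun_prop) _
      have hc3 : Tendsto (fun x : ℝ≥0 × (Phase d × (ℝ × ℝ) × ℝ) => x.2.2.2) (𝓝 (0, α s))
        (𝓝 σ₀) := Continuous.tendsto (by fun_prop) _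
      have hc4 : Tendsto (fun x : ℝ≥0 × (Phase d × (ℝ × ℝ) × ℝ) => x.2.1.2) (𝓝 (0, α s))
        (𝓝 (p + (s * σ₀ : ℝ) • n)) := Continuous.tendsto (by fun_prop) _
      have hNg : CkConv (r + 1) N q := (ckConv_pattern hq).gradient
      have hf := hNg.fderiv.at.tendsto.comp hc1
      refine (hc1.eventually ((continuous_snd.tendsto ((0 : ℝ≥0), q)).eventually
        (isOpen_strip.mem_nhds hq))).and ((hc1.eventually
          (ckConv_pattern hq).at.differentiableAt).and ((hc1.eventually hNg.at.differentiableAt).and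
        ((hc2.eventually (gt_mem_nhds (hwlmem s s.2).2)).and ?_)))
      have h1 := ((hNg.at.tendsto.comp hc1).norm.pow 2)
      have h2 := (hGc s).at.tendsto
      have h4 := (isBoundedBilinearMap_apply (𝕜 := ℝ) (E := Config d)
        (F := Config d)).continuous.continuousAt.tendsto.comp (hf.prodMk_nhds hc4)
      have h3 := (hc3.mul h1).sub ((hc3.mul h2).mul (hc4.inner h4))
      refine h3.eventually (lt_mem_nhds ?_)
      simp only [D.G_zero, mul_zero, zero_mul, sub_zero]
      positivity)
  -- the starting states
  set j : ℝ≥0 → Phase d × ℝ → Phase d × (ℝ × ℝ) × ℝ := fun e y => (y.1, (0, D.ν e), y.2) with hj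
  have hj0 : j 0 ((q, p), σ₀) = ((q, p), (0, 0), σ₀) := by simp [hj, D.ν_zero]
  have hjc : CkConv (r + 1) j ((q, p), σ₀) :=
    (ckConv_id (n := r + 1) ((q, p), σ₀)).fst.prodMk (((ContDiffAt.ckConv contDiffAt_const).prodMk
      (ckConv_const (c := D.ν) (by rw [D.ν_zero]; exact D.tendsto_ν) _)).prodMk
        (ckConv_id (n := r + 1) ((q, p), σ₀)).snd)
  have hjt : Tendsto (fun x : ℝ≥0 × (Phase d × ℝ) => (x.1, j x.1 x.2)) (𝓝 (0, ((q, p), σ₀)))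
      (𝓝 (0, ((q, p), (0, 0), σ₀))) := by
    have := tendsto_prodMk_fst hjc.at.tendsto
    rwa [hj0] at this
  set Ψ : ℝ≥0 → Phase d × ℝ → Phase d × (ℝ × ℝ) × ℝ := fun e y => Φ e (j e y) 1 with hΨ
  have hΨc : CkConv (r + 1) Ψ ((q, p), σ₀) :=
    CkConv.comp_of_eq (g := fun e y => Φ e y 1) (hΦ.eval 1) hjc hj0
  have h0m : (0 : ℝ) ∈ Icc (0 : ℝ) 1 := ⟨le_rfl, zero_le_one⟩
  have h1m : (1 : ℝ) ∈ Icc (0 : ℝ) 1 := ⟨zero_le_one, le_rfl⟩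
  -- the explicit solution for `e = 0`
  have hexp : ∀ᶠ x in 𝓝 ((0 : ℝ≥0), (((q, p), σ₀) : Phase d × ℝ)), x.1 = 0 →
      Ψ 0 x.2 = ((x.2.1.1, x.2.1.2 + x.2.2 • N 0 x.2.1.1),
        (0, -(x.2.2 * inner ℝ x.2.1.2 (N 0 x.2.1.1)) - x.2.2 ^ 2 / 2 * ‖N 0 x.2.1.1‖ ^ 2),
          x.2.2) := by
    filter_upwards [hjt.eventually hsol] with x hx he
    obtain ⟨e, ⟨q', p'⟩, σ⟩ := x
    simp only at he
    subst he
    simp only at hx ⊢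
    obtain ⟨hx0, hx⟩ := hx
    set γ := curveExt (Φ 0 (j 0 ((q', p'), σ))) with hγ
    have hγ0 : γ 0 = ((q', p'), (0, 0), σ) := by
      rw [hγ, curveExt_of_mem _ h0m]
      refine hx0.trans ?_
      simp [hj, D.ν_zero]
    have hγ1 : γ 1 = Ψ 0 ((q', p'), σ) := curveExt_of_mem _ h1m
    have h1 : ∀ s ∈ Icc (0 : ℝ) 1, (γ s).2.2 = σ :=
      eqOn_of_hasDerivWithinAt_eq (f' := fun _ => 0) (g := fun _ => σ)
        (fun s hs => (hx s hs).prod_snd.prod_snd)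
        (fun s _ => hasDerivWithinAt_const _ _ _) (by rw [hγ0])
    have h2 : ∀ s ∈ Icc (0 : ℝ) 1, (γ s).1.1 = q' :=
      eqOn_of_hasDerivWithinAt_eq (f' := fun _ => 0) (g := fun _ => q')
        (fun s hs => by simpa [hY, D.G_zero] using (hx s hs).prod_fst.prod_fst)
        (fun s _ => hasDerivWithinAt_const _ _ _) (by rw [hγ0])
    have h3 : ∀ s ∈ Icc (0 : ℝ) 1, (γ s).2.1.1 = 0 :=
      eqOn_of_hasDerivWithinAt_eq (f' := fun _ => 0) (g := fun _ => 0)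
        (fun s hs => by simpa [hY, D.G_zero] using (hx s hs).prod_snd.prod_fst.prod_fst)
        (fun s _ => hasDerivWithinAt_const _ _ _) (by rw [hγ0])
    have h4 : ∀ s ∈ Icc (0 : ℝ) 1, (γ s).1.2 = p' + (s * σ) • N 0 q' :=
      eqOn_of_hasDerivWithinAt_eq (f' := fun _ => σ • N 0 q')
        (fun s hs => by
          have := (hx s hs).prod_fst.prod_snd
          simpa only [hY, h1 s hs, h2 s hs] using this)
        (fun s _ => by
          simpa using ((((hasDerivAt_id s).mul_const σ).smul_const (N 0 q')).const_add
            p').hasDerivWithinAt) (by rw [hγ0]; simp)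
    have h5 : ∀ s ∈ Icc (0 : ℝ) 1, (γ s).2.1.2 =
        -(s * (σ * inner ℝ p' (N 0 q'))) - (σ * s) ^ 2 / 2 * ‖N 0 q'‖ ^ 2 :=
      eqOn_of_hasDerivWithinAt_eq
        (f' := fun s => -(σ * inner ℝ (p' + (s * σ) • N 0 q') (N 0 q')))
        (fun s hs => by
          have := (hx s hs).prod_snd.prod_fst.prod_snd
          simpa only [hY, h1 s hs, h2 s hs, h4 s hs] using this)
        (fun s _ => by
          have h6 : HasDerivAt (fun s : ℝ => -(s * (σ * inner ℝ p' (N 0 q'))) -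
              (σ * s) ^ 2 / 2 * ‖N 0 q'‖ ^ 2) (-(1 * (σ * inner ℝ p' (N 0 q'))) -
              (2 * (σ * s) ^ 1 * (σ * 1)) / 2 * ‖N 0 q'‖ ^ 2) s :=
            ((hasDerivAt_id s).mul_const _).neg.sub
              ((((((hasDerivAt_id s).const_mul σ)).pow 2).div_const 2).mul_const _)
          refine (h6.congr_deriv ?_).hasDerivWithinAt
          rw [inner_add_left, real_inner_smul_left, real_inner_self_eq_norm_sq]
          ring) (by rw [hγ0]; simp)
    rw [← hγ1]
    refine Prod.ext (Prod.ext (h2 1 h1m) ?_) (Prod.ext (Prod.ext (h3 1 h1m) ?_) (h1 1 h1m))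
    · rw [h4 1 h1m, one_mul]
    · rw [h5 1 h1m, one_mul, mul_one]
  -- the exit condition determines `σ`
  set F : ℝ≥0 → Phase d × ℝ → ℝ := fun e y => (Ψ e y).2.1.2 - D.ν e with hF
  have hFc : CkConv (r + 1) F ((q, p), σ₀) :=
    hΨc.snd.fst.snd.sub (ckConv_const (c := D.ν) (by rw [D.ν_zero]; exact D.tendsto_ν) _)
  have hF0 : ∀ᶠ y in 𝓝 (((q, p), σ₀) : Phase d × ℝ), F 0 y =
      -(y.2 * inner ℝ y.1.2 (N 0 y.1.1)) - y.2 ^ 2 / 2 * ‖N 0 y.1.1‖ ^ 2 := by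
    filter_upwards [eventually_zero_mem hexp] with y hy
    simp [hF, hy rfl, D.ν_zero]
  have hinv : (fderiv ℝ (F 0) ((q, p), σ₀) ∘L .inr ℝ (Phase d) ℝ).IsInvertible := by
    refine isInvertible_of_apply_one ?_
    have h1 : HasDerivAt (fun σ : ℝ => (((q, p), σ) : Phase d × ℝ)) ((0, 1) : Phase d × ℝ) σ₀ :=
      (hasDerivAt_const _ _).prodMk (hasDerivAt_id _)
    have h2 : HasDerivAt (fun σ : ℝ => F 0 ((q, p), σ)) (fderiv ℝ (F 0) ((q, p), σ₀) (0, 1)) σ₀ :=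
      hFc.at.differentiableAt.self_of_nhds.hasFDerivAt.comp_hasDerivAt σ₀ h1
    have h3 : HasDerivAt (fun σ : ℝ => -(σ * inner ℝ p n) - σ ^ 2 / 2 * ‖n‖ ^ 2)
        (-(1 * inner ℝ p n) - (2 * σ₀ ^ 1 * 1) / 2 * ‖n‖ ^ 2) σ₀ :=
      ((hasDerivAt_id σ₀).mul_const _).neg.sub
        ((((hasDerivAt_id σ₀).pow 2).div_const 2).mul_const _)
    have h4 := h2.unique (h3.congr_of_eventuallyEq (h1.continuousAt.eventually hF0))
    have h5 : (fderiv ℝ (F 0) ((q, p), σ₀) ∘L .inr ℝ (Phase d) ℝ) 1 = -m := by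
      simp only [ContinuousLinearMap.comp_apply, ContinuousLinearMap.inr_apply]
      rw [h4, hm]
      linear_combination -hσ₀n + 2 * hm
    rw [h5]
    exact (neg_pos.2 (by simpa using neg_neg_of_pos hmpos) : 0 < -(-m)).ne' ∘ fun h => by rw [h]; simp
  have hF00 : F 0 ((q, p), σ₀) = 0 := by
    rw [hF0.self_of_nhds]
    change -(σ₀ * inner ℝ p n) - σ₀ ^ 2 / 2 * ‖n‖ ^ 2 = 0
    linear_combination (-(σ₀ / 2)) * hσ₀n + σ₀ * hm
  obtain ⟨g, hg0, hgc, hg⟩ := exists_implicit_of_ckConv (by omega : r + 1 ≠ 0) hFc hF00 hinv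
  have hgpair : CkConv (r + 1) (fun e (z : Phase d) => (z, g e z)) (q, p) :=
    (ckConv_id _).prodMk hgc
  have hgt : Tendsto (fun x : ℝ≥0 × Phase d => (x.1, (x.2, g x.1 x.2))) (𝓝 (0, (q, p)))
      (𝓝 (0, ((q, p), σ₀))) := by
    have := tendsto_prodMk_fst (f := fun e z => (z, g e z)) hgpair.at.tendsto
    rwa [hg0] at this
  have hgpos : ∀ᶠ x in 𝓝 ((0 : ℝ≥0), ((q, p) : Phase d)), 0 < g x.1 x.2 :=
    hgc.at.tendsto.eventually (lt_mem_nhds (by rw [hg0]; exact hσ₀pos))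
  have hRc : CkConv (r + 1) (fun e (z : Phase d) => Ψ e (z, g e z)) (q, p) :=
    CkConv.comp_of_eq (g := Ψ) hΨc hgpair (by simp [hg0])
  have hexp' := hgt.eventually hexp
  -- for `e = 0` the exit condition is the reflection law
  have hrefl : ∀ᶠ x in 𝓝 ((0 : ℝ≥0), ((q, p) : Phase d)), x.1 = 0 →
      ((Ψ 0 (x.2, g 0 x.2)).1, (Ψ 0 (x.2, g 0 x.2)).2.1.1) =
        ((x.2.1, reflect (‖N 0 x.2.1‖⁻¹ • N 0 x.2.1) x.2.2), (0 : ℝ)) := by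
    have hNpos : ∀ᶠ x in 𝓝 ((0 : ℝ≥0), ((q, p) : Phase d)), 0 < ‖N x.1 x.2.1‖ := by
      have hc : Tendsto (fun x : ℝ≥0 × Phase d => (x.1, x.2.1)) (𝓝 (0, (q, p))) (𝓝 (0, q)) :=
        Continuous.tendsto (by fun_prop) _
      exact ((ckConv_pattern hq).gradient.at.tendsto.comp hc).norm.eventually (lt_mem_nhds hnpos)
    filter_upwards [hexp', hg, hgpos, hNpos] with x h1 h2 h3 h4 he
    obtain ⟨e, q', p'⟩ := x
    simp only at he h1 h2 h3 h4 ⊢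
    subst he
    have h5 := h1 rfl
    simp only [hF, h5, D.ν_zero, sub_zero] at h2
    rw [h5]
    set σ := g 0 (q', p')
    have h6 : σ = -2 * inner ℝ p' (N 0 q') / ‖N 0 q'‖ ^ 2 := by
      rw [eq_div_iff (by positivity)]
      have h7 : σ * (inner ℝ p' (N 0 q') + σ * ‖N 0 q'‖ ^ 2 / 2) = 0 := by linear_combination -h2
      rcases mul_eq_zero.1 h7 with h8 | h8
      · exact absurd h8 h3.ne'
      · linear_combination 2 * h8
    rw [reflect_normalize, ← h6]
  refine ⟨fun e z => ((Ψ e (z, g e z)).1, (Ψ e (z, g e z)).2.1.1), hRc.fst.prodMk hRc.snd.fst.fst,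
    hrefl.self_of_nhds rfl, ?_⟩
  have hinvD : ∀ᶠ x in 𝓝 ((0 : ℝ≥0), ((q, p) : Phase d)), x.1 ≠ 0 →
      ∀ w ∈ Ico (D.ν x.1) w₀, D.I x.1 w ∈ finiteSet P i x.1 ∧ P.W i x.1 (D.I x.1 w) = w ∧
        HasDerivAt (D.I x.1) (D.G x.1 w) w ∧
        HasDerivAt (fun s => (P.W i x.1 s).toReal) (D.G x.1 w)⁻¹ (D.I x.1 w) ∧ D.G x.1 w < 0 :=
    (continuous_fst.tendsto ((0 : ℝ≥0), ((q, p) : Phase d))).eventually D.inverse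
  filter_upwards [hrefl, hgt.eventually (hjt.eventually hsol),
    hgt.eventually (hjt.eventually hcurve), hg, hgpos, hinvD,
    (continuous_fst.tendsto ((0 : ℝ≥0), ((q, p) : Phase d))).eventually (eventually_mem_Ioc P)]
    with x hxr hx hcx hgx hσ hD hε hstart
  obtain ⟨e, z⟩ := x
  simp only at hxr hx hcx hgx hσ hD hε hstart ⊢
  rcases eq_or_ne e 0 with he | he
  · subst he
    have h1 := hxr rfl
    refine ⟨?_, fun h => (h rfl).elim, fun _ => h1⟩
    have h2 := congrArg (fun y => y.1.1) h1
    simp only at h2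
    rw [h2]; exact hstart
  refine and_assoc.1 ⟨?_, fun h => (he h).elim⟩
  specialize hD he
  specialize hε he
  obtain ⟨hx0, hx⟩ := hx
  set σ := g e z with hσdef
  set γ := curveExt (Φ e (j e (z, σ))) with hγ
  have hγs : ∀ s (hs : s ∈ Icc (0 : ℝ) 1), γ s = Φ e (j e (z, σ)) ⟨s, hs⟩ := fun s hs =>
    curveExt_of_mem _ hs
  have hγ0 : γ 0 = (z, (0, D.ν e), σ) := (hγs 0 h0m).trans hx0
  have hγ1 : γ 1 = Ψ e (z, σ) := hγs 1 h1m
  have hγσ : ∀ s ∈ Icc (0 : ℝ) 1, (γ s).2.2 = σ :=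
    eqOn_of_hasDerivWithinAt_eq (f' := fun _ => 0) (g := fun _ => σ)
      (fun s hs => (hx s hs).prod_snd.prod_snd)
      (fun s _ => hasDerivWithinAt_const _ _ _) (by rw [hγ0])
  set w : ℝ → ℝ := fun s => (γ s).2.1.2 with hw
  set h : ℝ → ℝ := fun s => inner ℝ (γ s).1.2 (N e (γ s).1.1) with hh
  set θ : ℝ → ℝ := fun s => -(σ * D.G e (w s)) with hθ
  have hclose : ∀ s ∈ Icc (0 : ℝ) 1, (γ s).1.1 ∈ P.strip i ∧
      DifferentiableAt ℝ (pattern P e) (γ s).1.1 ∧ DifferentiableAt ℝ (N e) (γ s).1.1 ∧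
      w s < w₀ ∧ 0 < σ * ‖N e (γ s).1.1‖ ^ 2 - σ * D.G e (w s) *
        inner ℝ (γ s).1.2 (fderiv ℝ (N e) (γ s).1.1 (γ s).1.2) := fun s hs => by
    have := hcx ⟨s, hs⟩
    rw [← hγs s hs] at this
    simpa only [hγσ s hs] using this
  have hqd : ∀ s ∈ Icc (0 : ℝ) 1, HasDerivWithinAt (fun s => (γ s).1.1) (θ s • (γ s).1.2)
      (Icc 0 1) s := fun s hs => by
    have := (hx s hs).prod_fst.prod_fst
    simpa only [hY, hγσ s hs] using this
  have hpd : ∀ s ∈ Icc (0 : ℝ) 1, HasDerivWithinAt (fun s => (γ s).1.2) (σ • N e (γ s).1.1)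
      (Icc 0 1) s := fun s hs => by
    have := (hx s hs).prod_fst.prod_snd
    simpa only [hY, hγσ s hs] using this
  have htd : ∀ s ∈ Icc (0 : ℝ) 1, HasDerivWithinAt (fun s => (γ s).2.1.1) (θ s) (Icc 0 1) s :=
    fun s hs => by
      have := (hx s hs).prod_snd.prod_fst.prod_fst
      simpa only [hY, hγσ s hs] using this
  have hwd : ∀ s ∈ Icc (0 : ℝ) 1, HasDerivWithinAt w (-(σ * h s)) (Icc 0 1) s := fun s hs => by
    have := (hx s hs).prod_snd.prod_fst.prod_snd
    simpa only [hY, hγσ s hs] using this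
  have hhd : ∀ s ∈ Icc (0 : ℝ) 1, HasDerivWithinAt h (σ * ‖N e (γ s).1.1‖ ^ 2 -
      σ * D.G e (w s) * inner ℝ (γ s).1.2 (fderiv ℝ (N e) (γ s).1.1 (γ s).1.2)) (Icc 0 1) s :=
    fun s hs => by
      have h1 := (hclose s hs).2.2.1.hasFDerivAt.comp_hasDerivWithinAt s (hqd s hs)
      have h2 := (hpd s hs).inner ℝ h1
      refine h2.congr_deriv ?_
      simp only [map_smul, real_inner_smul_left, real_inner_smul_right,
        real_inner_self_eq_norm_sq, hθ, Function.comp_apply]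
      ring
  have hhm : StrictMonoOn h (Icc 0 1) :=
    (exists_inverse_of_deriv_pos zero_le_one hhd fun s hs => (hclose s hs).2.2.2.2).1
  have hw0 : w 0 = D.ν e := by simp only [hw, hγ0]
  have hw1 : w 1 = D.ν e := by
    simp only [hw, hγ1]
    exact sub_eq_zero.1 hgx
  have hwmem : ∀ s ∈ Icc (0 : ℝ) 1, w s ∈ Ico (D.ν e) w₀ := fun s hs =>
    ⟨le_of_concave hσ hwd hhm hw0 hw1 s hs, (hclose s hs).2.2.2.1⟩
  -- the potential along the solution is `w`
  have hinv : ∀ s ∈ Icc (0 : ℝ) 1, pattern P e (γ s).1.1 - P.level i = D.I e (w s) :=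
    eqOn_of_hasDerivWithinAt_eq (f' := fun s => θ s * h s) (fun s hs => by
      have h1 := (hasDerivWithinAt_comp_gradient (hclose s hs).2.1 (hqd s hs)).sub_const (P.level i)
      rw [real_inner_smul_left] at h1
      exact h1)
      (fun s hs => by
        have h1 := (hD _ (hwmem s hs)).2.2.1.comp_hasDerivWithinAt s (hwd s hs)
        have h2 : D.G e (w s) * -(σ * h s) = θ s * h s := by simp only [hθ]; ring
        rwa [h2] at h1) (by rw [hγ0, hw0]; exact hstart)
  refine ⟨?_, fun _ => ?_⟩
  · rw [← hγ1, hinv 1 h1m, hw1]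
  · have hθpos : ∀ s ∈ Icc (0 : ℝ) 1, 0 < θ s := fun s hs =>
      neg_pos.2 (mul_neg_of_pos_of_neg hσ (hD _ (hwmem s hs)).2.2.2.2)
    have key : ∀ s ∈ Icc (0 : ℝ) 1, P.V e (γ s).1.1 ≠ ⊤ ∧
        σ • N e (γ s).1.1 = -(θ s • gradient (fun q => (P.V e q).toReal) (γ s).1.1) :=
      fun s hs => by
        obtain ⟨h1, -, -, h4, h5⟩ := hD _ (hwmem s hs)
        obtain ⟨h6, h7⟩ := gradient_potential hIIb hε (hclose s hs).1 (hinv s hs) h1 h4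
        refine ⟨h6, ?_⟩
        rw [h7, smul_smul, ← neg_smul]
        congr 1
        simp only [hθ]
        field_simp [h5.ne]
    have := hamStep_of_timeChange (V := P.V e) hθpos htd hqd
      (fun s hs => by rw [← (key s hs).2]; exact hpd s hs) (fun s hs => (key s hs).1)
    rw [hγ0, hγ1] at this
    simpa using this

/-! ### A single collision -/

variable {d r : ℕ} {ι : Type*} {B : BilliardTable d r ι} {P : PotentialData B} {i : ι}

/-- One step of the billiard (`e = 0`) or of the Hamiltonian motion (`e ≠ 0`). -/
def FlowStep (P : PotentialData B) (e : ℝ≥0) (τ : ℝ) (z z' : Phase d) : Prop :=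
  (e = 0 → BilliardStep B τ z z') ∧ (e ≠ 0 → HamStep (P.V e) τ z z')

theorem FlowStep.trans {e : ℝ≥0} {τ₁ τ₂ : ℝ} {z₁ z₂ z₃ : Phase d} (h : FlowStep P e τ₁ z₁ z₂)
    (h' : FlowStep P e τ₂ z₂ z₃) : FlowStep P e (τ₁ + τ₂) z₁ z₃ :=
  ⟨fun he => (h.1 he).trans (h'.1 he), fun he => (h.2 he).trans (h'.2 he)⟩

/-- The pattern function describes the table near a point of a wall outside the neighbourhood of the
corners. -/
theorem exists_wallChart (hIIa : P.ConditionIIa) (hIIc : P.ConditionIIc) {q : Config d}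
    (hq : q ∈ B.wall i) (hqs : q ∈ P.strip i) :
    ∃ O : Set (Config d), IsOpen O ∧ q ∈ O ∧ O ⊆ P.strip i ∧
      (∀ x ∈ O, pattern P 0 x - P.level i ∈ P.J i) ∧
      (∀ x ∈ O, 0 < pattern P 0 x - P.level i → x ∈ interior B.domain) ∧
      ∀ x ∈ O, pattern P 0 x - P.level i = 0 → x ∈ frontier B.domain ∧ x ∉ B.corner ∧
        IsInwardNormal B.domain x (‖gradient (pattern P 0) x‖⁻¹ • gradient (pattern P 0) x) := by
  have hQ0 : pattern P 0 = P.Q 0 := by ext; simp [pattern]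
  have hcd : ∀ x ∈ P.strip i, ContDiffAt ℝ ((r + 1 : ℕ) : WithTop ℕ∞) (pattern P 0) x :=
    fun x hx => (ckConv_pattern hx).at.1.self_of_nhds
  have hq0 : pattern P 0 q - P.level i = 0 := by rw [hQ0, (hIIa i).1 q ⟨hq, hqs⟩, sub_self]
  have h1 : ∀ᶠ x in 𝓝 q, x ∈ B.domain ↔ P.level i ≤ P.Q 0 x := (hIIa i).2 q ⟨hq, hqs⟩
  have h2 : ∀ᶠ x in 𝓝 q, pattern P 0 x - P.level i ∈ P.J i :=
    ContinuousAt.eventually_mem (f := fun x => pattern P 0 x - P.level i)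
      ((hcd q hqs).continuousAt.sub continuousAt_const)
      ((P.isOpen_J i).mem_nhds (by rw [hq0]; exact P.zero_mem_J i))
  obtain ⟨O, hO, hOo, hqO⟩ := eventually_nhds_iff.1
    (h1.and (h2.and ((isOpen_strip (P := P) (i := i)).mem_nhds hqs)))
  have hD : ∀ x ∈ O, ∀ᶠ y in 𝓝 x, y ∈ B.domain ↔ P.level i ≤ P.Q 0 y := fun x hx =>
    Filter.mem_of_superset (hOo.mem_nhds hx) fun y hy => (hO y hy).1
  refine ⟨O, hOo, hqO, fun x hx => (hO x hx).2.2, fun x hx => (hO x hx).2.1, fun x hx hpos => ?_,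
    fun x hx hzero => ?_⟩
  · rw [mem_interior_iff_mem_nhds]
    have h3 : ∀ᶠ y in 𝓝 x, P.level i < pattern P 0 y :=
      (hcd x (hO x hx).2.2).continuousAt.eventually (lt_mem_nhds (by linarith))
    filter_upwards [hD x hx, h3] with y hy hy2
    rw [hQ0] at hy2
    exact hy.2 hy2.le
  · have hx2 := (hO x hx).2.2
    have hxl : P.Q 0 x = P.level i := by rw [← hQ0]; linarith
    have hgrad : gradient (pattern P 0) x ≠ 0 := by
      rw [hQ0]; exact hIIc.1 0 ⟨le_rfl, P.ε₀_pos.le⟩ i x hx2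
    refine ⟨⟨subset_closure ((hO x hx).1.2 hxl.ge), fun hint => hgrad ?_⟩, fun hc => ?_,
      pattern P 0, (hcd x hx2).of_le (by exact_mod_cast Nat.le_add_left 1 r), hgrad, ?_, rfl⟩
    · have hmin : IsLocalMin (pattern P 0) x := by
        filter_upwards [hD x hx, mem_interior_iff_mem_nhds.1 hint] with y hy hy2
        rw [hQ0, hxl]; exact hy.1 hy2
      rw [gradient, hmin.fderiv_eq_zero, map_zero]
    · exact hx2.2 (interior_subset (P.corner_subset hc))
    · filter_upwards [hD x hx] with y hy
      rw [hQ0, hxl]; exact hy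

/-- Free flight up to a level surface of the pattern function, with the duration. -/
theorem exists_sectionMap (hr : 1 ≤ r) (hI : P.ConditionI) {q p : Config d} {τ δ : ℝ} (hτ : 0 < τ)
    (h : ∀ s ∈ Icc 0 τ, q + s • p ∈ interior B.domain) (hs : q + τ • p ∈ P.strip i)
    (htr : inner ℝ p (gradient (pattern P 0) (q + τ • p)) ≠ 0)
    (hδ : pattern P 0 (q + τ • p) - P.level i = δ) :
    ∃ S : ℝ≥0 → Phase d → Phase d × ℝ, CkConv r S (q, p) ∧ S 0 (q, p) = ((q + τ • p, p), τ) ∧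
      ∀ᶠ x in 𝓝 ((0 : ℝ≥0), ((q, p) : Phase d)),
        pattern P x.1 (S x.1 x.2).1.1 - P.level i = δ ∧
        (x.1 ≠ 0 → HamStep (P.V x.1) (S x.1 x.2).2 x.2 (S x.1 x.2).1) ∧
        (x.1 = 0 → ∃ t, 0 < t ∧ S 0 x.2 = ((x.2.1 + t • x.2.2, x.2.2), t) ∧
          ∀ s ∈ Icc 0 t, x.2.1 + s • x.2.2 ∈ interior B.domain) := by
  obtain ⟨C, hC, hC0, hstep⟩ := exists_freeFlight hr hI hτ h
  set F : ℝ≥0 → Phase d × ℝ → ℝ := fun e y => pattern P e (C e y).1 - P.level i - δ with hF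
  have hFc : CkConv r F ((q, p), τ) := by
    have h1 : CkConv r (fun e y => pattern P e (C e y).1) ((q, p), τ) :=
      ((ckConv_pattern hs).mono (Nat.le_succ r)).comp_of_eq hC.fst (by rw [hC0])
    exact (h1.sub (ContDiffAt.ckConv contDiffAt_const)).sub (ContDiffAt.ckConv contDiffAt_const)
  have hF0 : F 0 ((q, p), τ) = 0 := by simp [hF, hC0, hδ]
  have hinv : (fderiv ℝ (F 0) ((q, p), τ) ∘L .inr ℝ (Phase d) ℝ).IsInvertible := by
    refine isInvertible_of_apply_one ?_
    have h1 : HasDerivAt (fun σ : ℝ => (((q, p), σ) : Phase d × ℝ)) ((0, 1) : Phase d × ℝ) τ :=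
      (hasDerivAt_const _ _).prodMk (hasDerivAt_id _)
    obtain ⟨k, rfl⟩ : ∃ k, r = k + 1 := ⟨r - 1, by omega⟩
    have h2 : HasDerivAt (fun σ : ℝ => F 0 ((q, p), σ)) (fderiv ℝ (F 0) ((q, p), τ) (0, 1)) τ :=
      hFc.at.differentiableAt.self_of_nhds.hasFDerivAt.comp_hasDerivAt τ h1
    have h3 : HasDerivAt (fun σ : ℝ => pattern P 0 (q + σ • p) - P.level i - δ)
        (inner ℝ p (gradient (pattern P 0) (q + τ • p))) τ := by
      have h4 : HasDerivAt (fun σ : ℝ => q + σ • p) p τ := by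
        simpa using ((hasDerivAt_id τ).smul_const p).const_add q
      exact (((hasDerivWithinAt_univ.1 (hasDerivWithinAt_comp_gradient
        (ckConv_pattern hs).at.differentiableAt.self_of_nhds
        h4.hasDerivWithinAt)).sub_const _).sub_const _)
    have h5 : ∀ᶠ σ in 𝓝 τ, F 0 ((q, p), σ) = pattern P 0 (q + σ • p) - P.level i - δ := by
      filter_upwards [h1.continuousAt.eventually (eventually_zero_mem hstep)] with σ hσ
      simp only [hF, (hσ.2 rfl).2.1]
    have h4 := h2.unique (h3.congr_of_eventuallyEq h5)
    simp only [ContinuousLinearMap.comp_apply, ContinuousLinearMap.inr_apply]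
    rw [h4]
    exact htr
  obtain ⟨g, hg0, hgc, hg⟩ := exists_implicit_of_ckConv (by omega : r ≠ 0) hFc hF0 hinv
  have hpair : CkConv r (fun e (z : Phase d) => (z, g e z)) (q, p) := (ckConv_id _).prodMk hgc
  refine ⟨fun e z => (C e (z, g e z), g e z), CkConv.prodMk (CkConv.comp_of_eq hC hpair
    (by rw [hg0])) hgc, by simp only [hg0, hC0], ?_⟩
  have hstep' := hpair.eventually_comp (P := fun x => (x.1 ≠ 0 → HamStep (P.V x.1) x.2.2 x.2.1
      (C x.1 x.2)) ∧ (x.1 = 0 → 0 < x.2.2 ∧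
        C 0 x.2 = (x.2.1.1 + x.2.2 • x.2.1.2, x.2.1.2) ∧
          ∀ s ∈ Icc 0 x.2.2, x.2.1.1 + s • x.2.1.2 ∈ interior B.domain)) (by rw [hg0]; exact hstep)
  filter_upwards [hg, hstep'] with x h1 h2
  refine ⟨by simp only [hF] at h1; linarith, h2.1, fun he => ?_⟩
  obtain ⟨e, z⟩ := x
  simp only at he h1 h2 ⊢
  subst he
  obtain ⟨h3, h4, h5⟩ := h2.2 rfl
  exact ⟨g 0 z, h3, by rw [h4], h5⟩

theorem tendsto_toReal_barrier (hIII : P.ConditionIII) {δ : ℝ} (hδ : 0 < δ) (hJ : δ ∈ P.J i) :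
    Tendsto (fun e : ℝ≥0 => (P.W i e δ).toReal) (𝓝[≠] 0) (𝓝 0) ∧
      ∀ᶠ e : ℝ≥0 in 𝓝 0, e ≠ 0 → δ ∈ finiteSet P i e := by
  have h1 := (hIII i δ hJ).1 hδ
  have h2 : Tendsto (fun e : ℝ≥0 => (e : ℝ)) (𝓝[≠] 0) (𝓝[>] 0) := by
    refine tendsto_nhdsWithin_iff.2 ⟨(NNReal.continuous_coe.tendsto 0).mono_left
      nhdsWithin_le_nhds, ?_⟩
    filter_upwards [self_mem_nhdsWithin] with e he
    exact NNReal.coe_pos.2 (pos_iff_ne_zero.2 he)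
  refine ⟨?_, ?_⟩
  · have h3 := (EReal.tendsto_toReal EReal.zero_ne_top EReal.zero_ne_bot).comp (h1.comp h2)
    rwa [EReal.toReal_zero] at h3
  · have h4 : ∀ᶠ ε in 𝓝[>] (0 : ℝ), P.W i ε δ < ⊤ :=
      h1.eventually (gt_mem_nhds (EReal.coe_lt_top 0))
    exact (eventually_nnreal_of_nhdsGT h4).mono fun e he he0 => ⟨hJ, (he he0).ne⟩

set_option maxHeartbeats 1000000 in
/-- The soft collision map converges to the billiard collision map: the map of the phase space from
a time `η` before to a time `η` after a non-tangent collision. -/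
theorem exists_collisionMap (hr : 1 ≤ r) (hI : P.ConditionI) (hIIa : P.ConditionIIa)
    (hIIb : P.ConditionIIb) (hIIc : P.ConditionIIc) (hIII : P.ConditionIII) (hIV : P.ConditionIV)
    {q p p' : Config d} (hq : q ∈ B.wall i) (hqs : q ∈ P.strip i)
    (hin : inner ℝ p (gradient (pattern P 0) q) < 0)
    (hE : ((‖p‖ ^ 2 / 2 : ℝ) : EReal) < P.height i)
    (hp' : p' = reflect (‖gradient (pattern P 0) q‖⁻¹ • gradient (pattern P 0) q) p) :
    ∃ η₀ > 0, ∀ η, 0 < η → η ≤ η₀ → ∃ C : ℝ≥0 → Phase d → Phase d,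
      CkConv r C (q - η • p, p) ∧ C 0 (q - η • p, p) = (q + η • p', p') ∧
      ∀ᶠ x in 𝓝 ((0 : ℝ≥0), ((q - η • p, p) : Phase d)),
        FlowStep P x.1 (2 * η) x.2 (C x.1 x.2) := by
  obtain ⟨w₀, hw₀, hw₀E⟩ := EReal.lt_iff_exists_real_btwn.1 hE
  have hw₀' : ‖p‖ ^ 2 / 2 < w₀ := by exact_mod_cast hw₀
  obtain ⟨D⟩ := exists_barrierInverse hIIc hIII hIV (lt_of_le_of_lt (by positivity) hw₀') hw₀E
  obtain ⟨O, hO, hqO, hOs, hOJ, hOint, hOfr⟩ := exists_wallChart hIIa hIIc hq hqs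
  set N : Config d → Config d := gradient (pattern P 0) with hN
  have hNc : ∀ x ∈ O, ContinuousAt N x := fun x hx =>
    (ckConv_pattern (hOs hx)).gradient.at.continuousAt
  have hQd : ∀ x ∈ O, DifferentiableAt ℝ (pattern P 0) x := fun x hx =>
    (ckConv_pattern (hOs hx)).at.differentiableAt.self_of_nhds
  have hq0 : pattern P 0 q - P.level i = 0 := by
    rw [show pattern P 0 q = P.Q 0 q by simp [pattern], (hIIa i).1 q ⟨hq, hqs⟩, sub_self]
  have hout : 0 < inner ℝ p' (N q) := by
    have hn : 0 < ‖N q‖ := norm_pos_iff.2 fun h => by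
      rw [h, inner_zero_right] at hin; exact lt_irrefl _ hin
    rw [hp', reflect_normalize, inner_add_left, real_inner_smul_left, real_inner_self_eq_norm_sq,
      div_mul_cancel₀ _ (by positivity)]
    linarith
  -- short segments at the collision point on which the pattern function is monotone
  have hseg : ∀ v : Config d, ∀ κ : ℝ, 0 < κ * inner ℝ v (N q) → ∀ᶠ u in 𝓝 (0 : ℝ),
      q + u • v ∈ O ∧ 0 < κ * inner ℝ v (N (q + u • v)) := by
    intro v κ hv
    have hc : ContinuousAt (fun u : ℝ => q + u • v) 0 := by fun_prop
    have hc0 : q + (0 : ℝ) • v = q := by simp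
    have hc1 : ContinuousAt (fun u : ℝ => κ * inner ℝ v (N (q + u • v))) 0 :=
      continuousAt_const.mul (continuousAt_const.inner
        (ContinuousAt.comp (g := N) (by rw [hc0]; exact hNc q hqO) hc))
    exact (hc.eventually_mem (hO.mem_nhds (by rw [hc0]; exact hqO))).and
      (hc1.eventually (lt_mem_nhds (by simpa only [hc0] using hv)))
  obtain ⟨η₀, hη₀, hball⟩ := Metric.eventually_nhds_iff_ball.1
    ((hseg p (-1) (by linarith)).and (hseg p' 1 (by linarith)))
  have hmem : ∀ u, |u| < η₀ → (q + u • p ∈ O ∧ 0 < -1 * inner ℝ p (N (q + u • p))) ∧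
      (q + u • p' ∈ O ∧ 0 < 1 * inner ℝ p' (N (q + u • p'))) := fun u hu => hball u (by simpa using hu)
  have hmono : ∀ v : Config d, ∀ κ : ℝ,
      (∀ u, |u| < η₀ → q + u • v ∈ O ∧ 0 < κ * inner ℝ v (N (q + u • v))) →
      StrictMonoOn (fun u : ℝ => κ * (pattern P 0 (q + u • v) - P.level i)) (Ioo (-η₀) η₀) := by
    intro v κ hv
    have hder : ∀ u ∈ Ioo (-η₀) η₀, HasDerivAt
        (fun u : ℝ => κ * (pattern P 0 (q + u • v) - P.level i))
        (κ * inner ℝ v (N (q + u • v))) u := by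
      intro u hu
      have h1 : HasDerivAt (fun u : ℝ => q + u • v) v u := by
        simpa using ((hasDerivAt_id u).smul_const v).const_add q
      exact ((hasDerivWithinAt_univ.1 (hasDerivWithinAt_comp_gradient (hQd _ (hv u (abs_lt.2 hu)).1)
        h1.hasDerivWithinAt)).sub_const _).const_mul κ
    refine strictMonoOn_of_deriv_pos (convex_Ioo _ _)
      (fun u hu => (hder u hu).continuousAt.continuousWithinAt) fun u hu => ?_
    rw [interior_Ioo] at hu
    rw [(hder u hu).deriv]
    exact (hv u (abs_lt.2 hu)).2
  have hbefore : ∀ u, 0 < u → u < η₀ → 0 < pattern P 0 (q + (-u) • p) - P.level i := by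
    intro u hu hu'
    have := hmono p (-1) (fun u hu => (hmem u hu).1) (a := -u) (b := 0) ⟨by linarith, by linarith⟩
      ⟨by linarith, by linarith⟩ (by linarith)
    simp only [zero_smul, add_zero, hq0] at this
    linarith
  have hafter : ∀ u, 0 < u → u < η₀ → 0 < pattern P 0 (q + u • p') - P.level i := by
    intro u hu hu'
    have := hmono p' 1 (fun u hu => (hmem u hu).2) (a := 0) (b := u) ⟨by linarith, by linarith⟩
      ⟨by linarith, by linarith⟩ (by linarith)
    simp only [zero_smul, add_zero, hq0] at this
    linarith
  refine ⟨η₀ / 2, by positivity, fun η hη hη₁ => ?_⟩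
  have hη₂ : η < η₀ := by linarith
  set ℓ := η / 2 with hℓ
  have hℓpos : 0 < ℓ := by positivity
  set δ₀ := pattern P 0 (q + (-ℓ) • p) - P.level i with hδ₀
  set δ₁ := pattern P 0 (q + ℓ • p') - P.level i with hδ₁
  have hδ₀pos : 0 < δ₀ := hbefore ℓ hℓpos (by linarith)
  have hδ₁pos : 0 < δ₁ := hafter ℓ hℓpos (by linarith)
  obtain ⟨hWt₀, hWf₀⟩ := tendsto_toReal_barrier hIII hδ₀pos
    (hOJ _ (hmem (-ℓ) (by rw [abs_neg, abs_of_pos hℓpos]; linarith)).1.1)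
  obtain ⟨hWt₁, hWf₁⟩ := tendsto_toReal_barrier hIII hδ₁pos
    (hOJ _ (hmem ℓ (by rw [abs_of_pos hℓpos]; linarith)).2.1)
  -- the value of the pattern function at which the potential is `ν e`
  set y : ℝ≥0 → ℝ := fun e => D.I e (D.ν e) with hy
  have hy0 : y 0 = 0 := D.I_zero
  have hyt : Tendsto y (𝓝 0) (𝓝 (y 0)) := by rw [hy0]; exact D.tendsto_I
  have hyinv : ∀ᶠ e : ℝ≥0 in 𝓝 0, e ≠ 0 → y e ∈ finiteSet P i e ∧ P.W i e (y e) = D.ν e := by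
    filter_upwards [D.inverse, D.tendsto_ν.eventually (gt_mem_nhds
      (lt_of_le_of_lt (by positivity) hw₀' : 0 < w₀))] with e h1 h2 h3
    have := h1 h3 (D.ν e) ⟨le_rfl, h2⟩
    exact ⟨this.1, this.2.1⟩
  have hyf : ∀ᶠ e : ℝ≥0 in 𝓝 0, e ≠ 0 → y e ∈ finiteSet P i e :=
    hyinv.mono fun e h1 h2 => (h1 h2).1
  have hyW : Tendsto (fun e : ℝ≥0 => (P.W i e (y e)).toReal) (𝓝[≠] 0) (𝓝 0) := by
    refine (D.tendsto_ν.mono_left nhdsWithin_le_nhds).congr' ?_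
    filter_upwards [nhdsWithin_le_nhds hyinv, self_mem_nhdsWithin] with e h1 h2
    rw [(h1 h2).2, EReal.toReal_coe]
  have hback : ∀ s : ℝ, q - η • p + s • p = q + (-(η - s)) • p := fun s => by module
  have hback' : ∀ s : ℝ, q + (-ℓ) • p + s • p = q + (-(ℓ - s)) • p := fun s => by module
  have hz₁ : q - η • p + ℓ • p = q + (-ℓ) • p := by rw [hback, hℓ]; congr 3; ring
  -- free flight to the section, crossing, reflection, crossing, free flight
  obtain ⟨S, hSc, hS0, hS⟩ := exists_sectionMap (i := i) (q := q - η • p) (p := p) (δ := δ₀) hr hI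
    hℓpos (fun s hs => by
      rw [hback]
      exact hOint _ (hmem _ (by rw [abs_neg, abs_lt]; constructor <;> linarith [hs.1, hs.2])).1.1
        (hbefore _ (by linarith [hs.2]) (by linarith [hs.1])))
    (by rw [hz₁]; exact hOs (hmem _ (by rw [abs_neg, abs_of_pos hℓpos]; linarith)).1.1)
    (by
      rw [hz₁]
      have := (hmem (-ℓ) (by rw [abs_neg, abs_of_pos hℓpos]; linarith)).1.2
      intro h
      rw [← hN] at h
      rw [h] at this
      simp at this) (by rw [hz₁])
  rw [hz₁] at hS0
  have hin₀ : q + (-ℓ) • p + ℓ • p = q := by module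
  obtain ⟨A, hAc, hA0, hA⟩ := exists_crossing (i := i) hr hIIb hIIc (q := q + (-ℓ) • p) (p := p)
    (κ := -1) hℓpos hO hOs (fun u hu => by
      rw [hback']
      exact (hmem _ (by rw [abs_neg, abs_lt]; constructor <;> linarith [hu.1, hu.2])).1.1)
    (fun u hu => by
      rw [hback']
      exact (hmem _ (by rw [abs_neg, abs_lt]; constructor <;> linarith [hu.1, hu.2])).1.2)
    (ya := fun _ => δ₀) (yb := y) tendsto_const_nhds hyt rfl (by rw [hin₀, hq0, hy0]) hWf₀ hyf
    (by simpa using hyW.sub hWt₀)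
  rw [hin₀] at hA0
  obtain ⟨R, hRc, hR0, hR⟩ := exists_reflection hr hIIb D hqs hin hw₀'
  rw [← hN, ← hp'] at hR0
  obtain ⟨A', hAc', hA0', hA'⟩ := exists_crossing (i := i) hr hIIb hIIc (q := q) (p := p')
    (κ := 1) hℓpos hO hOs
    (fun u hu => (hmem _ (by rw [abs_lt]; constructor <;> linarith [hu.1, hu.2])).2.1)
    (fun u hu => (hmem _ (by rw [abs_lt]; constructor <;> linarith [hu.1, hu.2])).2.2)
    (ya := y) (yb := fun _ => δ₁) hyt tendsto_const_nhds (by rw [hq0, hy0]) rfl hyf hWf₁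
    (by simpa using hWt₁.sub hyW)
  have hforw : ∀ s : ℝ, q + ℓ • p' + s • p' = q + (ℓ + s) • p' := fun s => by module
  obtain ⟨C, hCc, hC0, hC⟩ := exists_freeFlight (P := P) (q := q + ℓ • p') (p := p') hr hI hℓpos
    (fun s hs => by
      rw [hforw]
      exact hOint _ (hmem _ (by rw [abs_lt]; constructor <;> linarith [hs.1, hs.2])).2.1
        (hafter _ (by linarith [hs.1]) (by linarith [hs.2])))
  set f₂ : ℝ≥0 → Phase d → Phase d × ℝ := fun e z => A e (S e z).1 with hf₂
  set f₃ : ℝ≥0 → Phase d → Phase d × ℝ := fun e z => R e (f₂ e z).1 with hf₃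
  set f₄ : ℝ≥0 → Phase d → Phase d × ℝ := fun e z => A' e (f₃ e z).1 with hf₄
  set t₅ : ℝ≥0 → Phase d → ℝ := fun e z =>
    2 * η - (S e z).2 - (f₂ e z).2 - (f₃ e z).2 - (f₄ e z).2 with ht₅
  have e₁ : (S 0 (q - η • p, p)).1 = (q + (-ℓ) • p, p) := by rw [hS0]
  have e₂ : f₂ 0 (q - η • p, p) = ((q, p), ℓ) := by simp only [hf₂, e₁, hA0]
  have e₃ : f₃ 0 (q - η • p, p) = ((q, p'), 0) := by simp only [hf₃, e₂, hR0]
  have e₄ : f₄ 0 (q - η • p, p) = ((q + ℓ • p', p'), ℓ) := by simp only [hf₄, e₃, hA0']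
  have e₅ : t₅ 0 (q - η • p, p) = ℓ := by
    simp only [ht₅, e₂, e₃, e₄, hS0]; rw [hℓ]; ring
  have c₂ : CkConv r f₂ (q - η • p, p) := CkConv.comp_of_eq hAc hSc.fst e₁
  have c₃ : CkConv r f₃ (q - η • p, p) := CkConv.comp_of_eq hRc c₂.fst (by rw [e₂])
  have c₄ : CkConv r f₄ (q - η • p, p) := CkConv.comp_of_eq hAc' c₃.fst (by rw [e₃])
  have c₅ : CkConv r t₅ (q - η • p, p) :=
    ((((ContDiffAt.ckConv contDiffAt_const).sub hSc.snd).sub c₂.snd).sub c₃.snd).sub c₄.snd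
  have c₆ : CkConv r (fun e z => ((f₄ e z).1, t₅ e z)) (q - η • p, p) := c₄.fst.prodMk c₅
  have hbase : ((f₄ 0 (q - η • p, p)).1, t₅ 0 (q - η • p, p)) = ((q + ℓ • p', p'), ℓ) := by
    rw [e₄, e₅]
  refine ⟨fun e z => C e ((f₄ e z).1, t₅ e z), CkConv.comp_of_eq hCc c₆ hbase, ?_, ?_⟩
  · simp only [hbase, hC0, hforw]
    rw [hℓ, add_halves]
  have ev₂ := hSc.fst.eventually_comp (by rw [e₁]; exact hA)
  have ev₃ := c₂.fst.eventually_comp (by rw [e₂]; exact hR)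
  have ev₄ := c₃.fst.eventually_comp (by rw [e₃]; exact hA')
  have ev₅ := c₆.eventually_comp (by rw [hbase]; exact hC)
  filter_upwards [hS, ev₂, ev₃, ev₄, ev₅] with x h1 h2 h3 h4 h5
  obtain ⟨e, z⟩ := x
  simp only at h1 h2 h3 h4 h5 ⊢
  obtain ⟨h1a, h1b, h1c⟩ := h1
  obtain ⟨h2a, h2b, h2c⟩ := h2 h1a
  obtain ⟨h3a, h3b, h3c⟩ := h3 h2a
  obtain ⟨h4a, h4b, h4c⟩ := h4 h3a
  refine ⟨fun he => ?_, fun he => ?_⟩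
  · subst he
    obtain ⟨q', v⟩ := z
    obtain ⟨t₁, ht₁, hz₁', hfree₁⟩ := h1c rfl
    obtain ⟨t₂, ht₂, hz₂, hcr₁⟩ := h2c rfl
    have hz₃ := h3c rfl
    obtain ⟨t₄, ht₄, hz₄, hcr₂⟩ := h4c rfl
    obtain ⟨ht₅', hz₅, hfree₂⟩ := h5.2 rfl
    set X := q' + (t₁ + t₂) • v with hX
    have hXeq : ∀ u : ℝ, q' + t₁ • v + u • v = q' + (t₁ + u) • v := fun u => by module
    simp only at hz₁' hfree₁
    have E₂ : f₂ 0 (q', v) = ((X, v), t₂) := by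
      simp only [hf₂]; rw [hz₂, hz₁']; simp only [hXeq, hX]
    rw [hz₁'] at hcr₁
    simp only [hXeq, hy0] at hcr₁
    set w := reflect (‖N X‖⁻¹ • N X) v with hw
    have E₃ : f₃ 0 (q', v) = ((X, w), 0) := by
      simp only [hf₃]; rw [hz₃, E₂]
    have E₄ : f₄ 0 (q', v) = ((X + t₄ • w, w), t₄) := by
      simp only [hf₄]; rw [hz₄, E₃]
    rw [E₃] at hcr₂
    simp only [hy0] at hcr₂
    have E₅ : t₅ 0 (q', v) = 2 * η - (t₁ + t₂) - t₄ := by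
      simp only [ht₅, hz₁', E₂, E₃, E₄]; ring
    rw [E₄, E₅] at hz₅ hfree₂
    rw [E₅] at ht₅'
    rw [E₄, E₅, hz₅]
    simp only at hfree₂ ⊢
    have hXO : X ∈ O := (hcr₁ t₂ ⟨ht₂.le, le_rfl⟩).1
    have hX0 : pattern P 0 X - P.level i = 0 := by
      have h6 := h2a
      rw [show (A 0 (S 0 (q', v)).1) = ((X, v), t₂) from E₂] at h6
      exact h6.trans hy0
    obtain ⟨hXf, hXc, hXn⟩ := hOfr X hXO hX0
    have hcol := billiardStep_collision (B := B) (q := q') (p := v) (n := ‖N X‖⁻¹ • N X)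
      (t := t₁ + t₂) (τ := 2 * η) (by linarith) (by linarith) (fun s hs => ?_) (fun s hs => ?_)
      hXf hXc hXn
    · have h6 : X + (2 * η - (t₁ + t₂)) • w = X + t₄ • w + (2 * η - (t₁ + t₂) - t₄) • w := by
        module
      rw [← h6]
      exact hcol
    · rcases le_or_gt s t₁ with h6 | h6
      · exact hfree₁ s ⟨hs.1, h6⟩
      · obtain ⟨h7, a, ha, ha1, -, ha3⟩ := hcr₁ (s - t₁) ⟨by linarith, by linarith [hs.2]⟩
        rw [add_sub_cancel] at h7 ha3
        refine hOint _ h7 ?_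
        rw [ha3]
        nlinarith [ha1 (by linarith [hs.2])]
    · rcases le_or_gt (s - (t₁ + t₂)) t₄ with h6 | h6
      · obtain ⟨h7, a, ha, -, ha2, ha3⟩ := hcr₂ (s - (t₁ + t₂)) ⟨by linarith [hs.1], h6⟩
        refine hOint _ h7 ?_
        rw [ha3]
        nlinarith [ha2 (by linarith [hs.1])]
      · have h7 := hfree₂ (s - (t₁ + t₂) - t₄) ⟨by linarith, by linarith [hs.2]⟩
        have h8 : X + (s - (t₁ + t₂)) • w = X + t₄ • w + (s - (t₁ + t₂) - t₄) • w := by module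
        rw [← h8] at h7
        exact h7
  · have := ((((h1b he).trans (h2b he)).trans (h3b he)).trans (h4b he)).trans (h5.1 he)
    have hsum : (S e z).2 + (A e (S e z).1).2 + (R e (f₂ e z).1).2 + (A' e (f₃ e z).1).2 +
        t₅ e z = 2 * η := by simp only [ht₅, hf₂, hf₃, hf₄]; ring
    rw [hsum] at this
    exact this

/-! ### Following a billiard trajectory -/

variable {d r : ℕ} {ι : Type*} {B : BilliardTable d r ι} {P : PotentialData B}

/-- The soft motion over the time `s` converges to the billiard motion near `ρ`, where the latter
leads to `z`. -/
def Reaches (P : PotentialData B) (ρ : Phase d) (s : ℝ) (z : Phase d) : Prop :=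
  ∃ C : ℝ≥0 → Phase d → Phase d, CkConv r C ρ ∧ C 0 ρ = z ∧
    ∀ᶠ x in 𝓝 ((0 : ℝ≥0), ρ), FlowStep P x.1 s x.2 (C x.1 x.2)

theorem Reaches.trans {ρ z z' : Phase d} {s s' : ℝ} (h : Reaches P ρ s z)
    (h' : Reaches P z s' z') : Reaches P ρ (s + s') z' := by
  obtain ⟨C, hC, hz, hs⟩ := h
  obtain ⟨C', hC', hz', hs'⟩ := h'
  refine ⟨fun e x => C' e (C e x), CkConv.comp_of_eq hC' hC hz, by simp only [hz, hz'], ?_⟩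
  filter_upwards [hs, hC.eventually_comp (by rw [hz]; exact hs')] with x h1 h2 using h1.trans h2

theorem reaches_free (hr : 1 ≤ r) (hI : P.ConditionI) {q p : Config d} {τ : ℝ} (hτ : 0 < τ)
    (h : ∀ s ∈ Icc 0 τ, q + s • p ∈ interior B.domain) :
    Reaches P (q, p) τ (q + τ • p, p) := by
  obtain ⟨C, hC, hC0, hstep⟩ := exists_freeFlight hr hI hτ h
  refine ⟨fun e z => C e (z, τ), hC.comp_contDiff (f := fun z : Phase d => (z, τ)) (by fun_prop),
    hC0, ?_⟩
  have ht : Tendsto (fun x : ℝ≥0 × Phase d => (x.1, (x.2, τ))) (𝓝 (0, (q, p)))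
      (𝓝 (0, ((q, p), τ))) := Continuous.tendsto (by fun_prop) _
  filter_upwards [ht.eventually hstep] with x hx
  refine ⟨fun he => ?_, hx.1⟩
  obtain ⟨h1, h2, h3⟩ := hx.2 he
  obtain ⟨e, z⟩ := x
  simp only at he h1 h2 h3 ⊢
  subst he
  rw [h2]
  exact billiardStep_free h1.le h3

theorem norm_reflect {n p : Config d} (hn : ‖n‖ = 1) : ‖reflect n p‖ = ‖p‖ := by
  have h : ‖reflect n p‖ ^ 2 = ‖p‖ ^ 2 := by
    rw [reflect, norm_sub_sq_real, real_inner_smul_right, norm_smul, hn, mul_one,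
      Real.norm_eq_abs, sq_abs]
    ring
  exact (sq_eq_sq₀ (norm_nonneg _) (norm_nonneg _)).1 h

theorem inner_reflect {n p : Config d} (hn : ‖n‖ = 1) :
    inner ℝ (reflect n p) n = -inner ℝ p n := by
  rw [reflect, inner_sub_left, real_inner_smul_left, real_inner_self_eq_norm_sq, hn]
  ring

/-- A non-tangent collision, in terms of the pattern function. -/
theorem exists_collision (hIIa : P.ConditionIIa) (hIIc : P.ConditionIIc) {T : ℝ} {γ : ℝ → Phase d}
    (hγ : B.IsTrajectory T γ) {t : ℝ} (ht : t ∈ Ioc 0 T) (hfr : (γ t).1 ∈ frontier B.domain)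
    (hcorner : (γ t).1 ∉ P.cornerNhd) (htan : ¬ B.IsTangency γ t) :
    ∃ i p, (γ t).1 ∈ B.wall i ∧ (γ t).1 ∈ P.strip i ∧
      inner ℝ p (gradient (pattern P 0) (γ t).1) < 0 ∧
      (γ t).2 = reflect (‖gradient (pattern P 0) (γ t).1‖⁻¹ • gradient (pattern P 0) (γ t).1) p ∧
      ‖(γ t).2‖ = ‖p‖ ∧ ∃ η > 0, η < t ∧ ∀ u ∈ Ico (t - η) t, (γ u).1 ∉ frontier B.domain ∧
        γ u = ((γ t).1 - (t - u) • p, p) := by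
  set q := (γ t).1 with hq
  obtain ⟨i, hi⟩ : ∃ i, q ∈ B.wall i := by
    rw [B.frontier_domain] at hfr
    exact mem_iUnion.1 hfr
  have hqs : q ∈ P.strip i := ⟨P.wall_subset i hi, hcorner⟩
  obtain ⟨O, hO, hqO, hOs, -, -, hOfr⟩ := exists_wallChart hIIa hIIc hi hqs
  have hQ0 : pattern P 0 = P.Q 0 := by ext; simp [pattern]
  have hq0 : pattern P 0 q - P.level i = 0 := by rw [hQ0, (hIIa i).1 q ⟨hi, hqs⟩, sub_self]
  obtain ⟨-, -, hn⟩ := hOfr q hqO hq0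
  set N := gradient (pattern P 0) q with hN
  have hN0 : N ≠ 0 := by rw [hN, hQ0]; exact hIIc.1 0 ⟨le_rfl, P.ε₀_pos.le⟩ i q hqs
  have hn1 : ‖‖N‖⁻¹ • N‖ = 1 := norm_smul_inv_norm (𝕜 := ℝ) hN0
  -- the free motion before the collision
  obtain ⟨η, hη, hfree⟩ := hγ.eventually_free t
  set η' := min (η / 2) (t / 2) with hη'
  have hη'pos : 0 < η' := lt_min (by positivity) (half_pos ht.1)
  have hη'le : η' ≤ η / 2 := min_le_left _ _
  have hη't : η' ≤ t / 2 := min_le_right _ _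
  have ht0 := ht.1
  have hnf : ∀ u ∈ Ico (t - η') t, (γ u).1 ∉ frontier B.domain := fun u hu =>
    hfree u ⟨by linarith [hu.1], hu.2.le.trans ht.2⟩
      (by rw [abs_sub_lt_iff]; constructor <;> linarith [hu.1, hu.2]) hu.2.ne
  set s := t - η' with hs
  set p := (γ s).2 with hp
  have hmot : ∀ u ∈ Ico s t, (γ u).2 = p ∧ (γ u).1 = (γ s).1 + (u - s) • p := fun u hu =>
    hγ.free s u (by linarith) hu.1 (hu.2.le.trans ht.2) fun v hv => hnf v ⟨hv.1.le, hv.2.trans_lt hu.2⟩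
  have hst : s < t := by linarith
  have hqt : q = (γ s).1 + (t - s) • p := by
    have h1 : Tendsto (fun u => (γ u).1) (𝓝[<] t) (𝓝 q) := by
      have h2 := hγ.continuousOn t ⟨ht0.le, ht.2⟩
      refine h2.tendsto.mono_left (nhdsWithin_le_iff.2 ?_)
      filter_upwards [Ioo_mem_nhdsLT ht0] with u hu using ⟨hu.1.le, hu.2.le.trans ht.2⟩
    have h2 : Tendsto (fun u => (γ s).1 + (u - s) • p) (𝓝[<] t) (𝓝 ((γ s).1 + (t - s) • p)) :=
      (Continuous.tendsto (by fun_prop) t).mono_left nhdsWithin_le_nhds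
    refine tendsto_nhds_unique h1 (h2.congr' ?_)
    filter_upwards [Ioo_mem_nhdsLT hst] with u hu using (hmot u ⟨hu.1.le, hu.2⟩).2.symm
  have hback : ∀ u ∈ Ico s t, γ u = (q - (t - u) • p, p) := fun u hu => by
    refine Prod.ext ?_ (hmot u hu).1
    rw [(hmot u hu).2, hqt]
    module
  obtain ⟨-, n, p_in, hn', hpin, hpt⟩ := hγ.collision t ht hfr
  have hpp : p_in = p := tendsto_nhds_unique hpin
    (hγ.tendsto_momentum (by linarith) hst ht.2 fun u hu => hnf u ⟨hu.1.le, hu.2⟩)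
  have hnn : n = ‖N‖⁻¹ • N := hn'.unique hn
  rw [hpp, hnn] at hpt
  have hne : inner ℝ p N ≠ 0 := fun h => htan ⟨hfr, _, hn, by
    rw [hpt, inner_reflect hn1, real_inner_smul_right, h, mul_zero, neg_zero]⟩
  -- the trajectory arrives from the side where the pattern function is larger
  have hle : inner ℝ p N ≤ 0 := by
    have hline : HasDerivAt (fun u : ℝ => q + u • p) p 0 := by
      simpa using ((hasDerivAt_id (0 : ℝ)).smul_const p).const_add q
    have hd : HasDerivAt (fun u : ℝ => pattern P 0 (q + u • p)) (inner ℝ p N) 0 := by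
      have h1 := hasDerivWithinAt_univ.1 (hasDerivWithinAt_comp_gradient (f := pattern P 0)
        (c := fun u : ℝ => q + u • p) (t := 0)
        (by simpa using (ckConv_pattern hqs).at.differentiableAt.self_of_nhds)
        hline.hasDerivWithinAt)
      simpa [hN] using h1
    have h1 := (hasDerivAt_iff_tendsto_slope.1 hd).mono_left
      (nhdsWithin_mono 0 (s := Iio (0 : ℝ)) fun u (hu : u < 0) => hu.ne)
    have hloc : ∀ᶠ u in 𝓝 (0 : ℝ), q + u • p ∈ B.domain ↔ P.level i ≤ P.Q 0 (q + u • p) := by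
      have h2 : Tendsto (fun u : ℝ => q + u • p) (𝓝 0) (𝓝 q) := by
        have := hline.continuousAt.tendsto
        simpa using this
      exact h2.eventually ((hIIa i).2 q ⟨hi, hqs⟩)
    refine le_of_tendsto h1 ?_
    filter_upwards [nhdsWithin_le_nhds hloc, Ioo_mem_nhdsLT (show -η' < 0 by linarith)] with u hu hu2
    have h2 : q + u • p ∈ B.domain := by
      have h3 := hγ.mem_domain (t + u) ⟨by linarith [hu2.1], by linarith [hu2.2, ht.2]⟩
      rw [hback (t + u) ⟨by linarith [hu2.1], by linarith [hu2.2]⟩] at h3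
      convert h3 using 1
      simp only
      module
    have h3 := hu.1 h2
    rw [slope_def_field]
    refine div_nonpos_of_nonneg_of_nonpos ?_ (by linarith [hu2.2])
    simp only [zero_smul, add_zero]
    rw [← hQ0] at h3
    linarith
  exact ⟨i, p, hi, hqs, lt_of_le_of_ne hle hne, hpt, by rw [hpt, norm_reflect hn1], η', hη'pos,
    by linarith, fun u hu => ⟨hnf u hu, hback u hu⟩⟩

/-- By induction on the number of collisions, the motion converges up to any time that is
not a collision time; the energy is conserved. -/
theorem reaches_of_isTrajectory (hr : 1 ≤ r) (hI : P.ConditionI) (hIIa : P.ConditionIIa)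
    (hIIb : P.ConditionIIb) (hIIc : P.ConditionIIc) (hIII : P.ConditionIII) (hIV : P.ConditionIV)
    {T : ℝ} {γ : ℝ → Phase d} (hγ : B.IsTrajectory T γ) (h0 : (γ 0).1 ∈ interior B.domain)
    (hE : ∀ i, ((‖(γ 0).2‖ ^ 2 / 2 : ℝ) : EReal) < P.height i)
    (hcorner : ∀ t ∈ Icc 0 T, (γ t).1 ∈ frontier B.domain → (γ t).1 ∉ P.cornerNhd)
    (htan : ∀ t ∈ Icc 0 T, ¬ B.IsTangency γ t) {s : ℝ} (hs : s ∈ Ioc 0 T)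
    (hsf : (γ s).1 ∉ frontier B.domain) :
    Reaches P (γ 0) s (γ s) ∧ ‖(γ s).2‖ = ‖(γ 0).2‖ := by
  have hfin : ∀ s ≤ T, {t | t ∈ Icc 0 s ∧ (γ t).1 ∈ frontier B.domain}.Finite := fun s hs =>
    (hγ.mono hs).finite_collisions
  have h0f : (γ 0).1 ∉ frontier B.domain := notMem_frontier_of_mem_interior h0
  -- a free piece of the trajectory
  have hfree : ∀ a b, 0 ≤ a → a < b → b ≤ T → (∀ u ∈ Icc a b, (γ u).1 ∉ frontier B.domain) →
      Reaches P (γ a) (b - a) (γ b) ∧ (γ b).2 = (γ a).2 := by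
    intro a b ha hab hb hnf
    have hmot : ∀ u ∈ Icc a b, γ u = ((γ a).1 + (u - a) • (γ a).2, (γ a).2) := fun u hu => by
      obtain ⟨h1, h2⟩ := hγ.free a u ha hu.1 (hu.2.trans hb) fun v hv => hnf v
        ⟨hv.1.le, hv.2.trans hu.2⟩
      exact Prod.ext h2 h1
    have h1 := reaches_free (P := P) hr hI (q := (γ a).1) (p := (γ a).2) (sub_pos.2 hab)
      fun v hv => by
        have h2 : a + v ∈ Icc a b := ⟨by linarith [hv.1], by linarith [hv.2]⟩
        have h3 := mem_interior_of_notMem_frontier (hγ.mem_domain (a + v)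
          ⟨by linarith [hv.1], h2.2.trans hb⟩) (hnf _ h2)
        rw [hmot _ h2] at h3
        simpa using h3
    have h2 := hmot b ⟨hab.le, le_rfl⟩
    rw [← h2] at h1
    exact ⟨h1, by rw [h2]⟩
  induction hn : {t | t ∈ Icc 0 s ∧ (γ t).1 ∈ frontier B.domain}.ncard using
    Nat.strong_induction_on generalizing s with
  | _ n ih =>
    rcases eq_empty_or_nonempty {t | t ∈ Icc 0 s ∧ (γ t).1 ∈ frontier B.domain} with hem | hne
    · obtain ⟨h1, h2⟩ := hfree 0 s le_rfl hs.1 hs.2 fun u hu hu2 =>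
        (hem ▸ (show u ∈ {t | t ∈ Icc 0 s ∧ (γ t).1 ∈ frontier B.domain} from ⟨hu, hu2⟩) :
          u ∈ (∅ : Set ℝ))
      rw [sub_zero] at h1
      exact ⟨h1, by rw [h2]⟩
    · -- the last collision before `s`
      obtain ⟨t, ⟨htm, htf⟩, hmax⟩ := (hfin s hs.2).exists_maximalFor id _ hne
      have hlast : ∀ u ∈ Ioc t s, (γ u).1 ∉ frontier B.domain := fun u hu huf =>
        hu.1.not_ge (hmax (j := u) ⟨⟨htm.1.trans hu.1.le, hu.2⟩, huf⟩ hu.1.le)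
      have ht0 : 0 < t := lt_of_le_of_ne htm.1 (by rintro rfl; exact h0f htf)
      have hts : t < s := lt_of_le_of_ne htm.2 (by rintro rfl; exact hsf htf)
      have htT : t ∈ Icc 0 T := ⟨ht0.le, htm.2.trans hs.2⟩
      obtain ⟨i, p, hi, hqs, hin, hrefl, hnorm, η₁, hη₁, hη₁t, hbef⟩ := exists_collision hIIa hIIc hγ
        ⟨ht0, htT.2⟩ htf (hcorner t htT htf) (htan t htT)
      -- the motion up to a time shortly before the collision
      have hprev : ∀ η, 0 < η → η ≤ η₁ → Reaches P (γ 0) (t - η) (γ (t - η)) ∧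
          ‖(γ (t - η)).2‖ = ‖(γ 0).2‖ := by
        intro η hη hη'
        have hsub : {u | u ∈ Icc 0 (t - η) ∧ (γ u).1 ∈ frontier B.domain} ⊂
            {u | u ∈ Icc 0 s ∧ (γ u).1 ∈ frontier B.domain} := by
          refine ⟨fun u hu => ⟨⟨hu.1.1, by linarith [hu.1.2]⟩, hu.2⟩, fun h => ?_⟩
          have := (h (show t ∈ {u | u ∈ Icc 0 s ∧ (γ u).1 ∈ frontier B.domain} from
            ⟨htm, htf⟩)).1.2
          linarith
        exact ih _ (hn ▸ ncard_lt_ncard hsub (hfin s hs.2)) ⟨by linarith, by linarith [htT.2]⟩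
          (hbef _ ⟨by linarith, by linarith⟩).1 rfl
      have hpnorm : ‖p‖ = ‖(γ 0).2‖ := by
        rw [← (hprev η₁ hη₁ le_rfl).2, (hbef (t - η₁) ⟨le_rfl, by linarith⟩).2]
      obtain ⟨η₀, hη₀, hmap⟩ := exists_collisionMap hr hI hIIa hIIb hIIc hIII hIV hi hqs hin
        (by rw [hpnorm]; exact hE i) hrefl
      set η := min (min η₀ η₁) ((s - t) / 2) with hη
      have hηpos : 0 < η := lt_min (lt_min hη₀ hη₁) (by linarith)
      have hη1 : η ≤ η₁ := (min_le_left _ _).trans (min_le_right _ _)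
      have hη2 : η ≤ (s - t) / 2 := min_le_right _ _
      have hcol : Reaches P (γ (t - η)) (2 * η) (γ (t + η)) := by
        have h1 : γ (t - η) = ((γ t).1 - η • p, p) := by
          rw [(hbef (t - η) ⟨by linarith, by linarith⟩).2, sub_sub_cancel]
        have h2 : γ (t + η) = ((γ t).1 + η • (γ t).2, (γ t).2) := by
          obtain ⟨h3, h4⟩ := hγ.free t (t + η) ht0.le (by linarith) (by linarith [hs.2])
            fun u hu => hlast u ⟨hu.1, by linarith [hu.2]⟩
          rw [add_sub_cancel_left] at h4
          exact Prod.ext h4 h3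
        rw [h1, h2]
        exact hmap η hηpos ((min_le_left _ _).trans (min_le_left _ _))
      obtain ⟨h5, h6⟩ := hfree (t + η) s (by linarith) (by linarith) hs.2 fun u hu =>
        hlast u ⟨by linarith [hu.1], hu.2⟩
      have h7 := ((hprev η hηpos hη1).1.trans hcol).trans h5
      have h8 : t - η + 2 * η + (s - (t + η)) = s := by ring
      rw [h8] at h7
      refine ⟨h7, ?_⟩
      rw [(hγ.free t s ht0.le hts.le hs.2 hlast).1, hnorm, hpnorm]

/-- One family of maps of the initial point and the time contains both flows near `(γ 0, T)`. -/
theorem exists_flowFamily (hr : 1 ≤ r) (hI : P.ConditionI) (hIIa : P.ConditionIIa)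
    (hIIb : P.ConditionIIb) (hIIc : P.ConditionIIc) (hIII : P.ConditionIII) (hIV : P.ConditionIV)
    {T : ℝ} (hT : 0 < T) {γ : ℝ → Phase d} (hγ : B.IsTrajectory T γ)
    (h0 : (γ 0).1 ∈ interior B.domain) (hTint : (γ T).1 ∈ interior B.domain)
    (hE : ∀ i, ((‖(γ 0).2‖ ^ 2 / 2 : ℝ) : EReal) < P.height i)
    (hcorner : ∀ t ∈ Icc 0 T, (γ t).1 ∈ frontier B.domain → (γ t).1 ∉ P.cornerNhd)
    (htan : ∀ t ∈ Icc 0 T, ¬ B.IsTangency γ t) :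
    ∃ C : ℝ≥0 → Phase d × ℝ → Phase d, CkConv r C (γ 0, T) ∧
      ∀ᶠ x in 𝓝 ((0 : ℝ≥0), ((γ 0, T) : Phase d × ℝ)), FlowStep P x.1 x.2.2 x.2.1 (C x.1 x.2) := by
  obtain ⟨η, hη, hfree⟩ := hγ.eventually_free T
  set s := max (T - η / 2) (T / 2) with hs
  have hsT : s < T := max_lt (by linarith) (by linarith)
  have hs0 : 0 < s := lt_of_lt_of_le (by linarith) (le_max_right _ _)
  have hsη : T - η / 2 ≤ s := le_max_left _ _
  have hnf : ∀ u ∈ Icc s T, (γ u).1 ∉ frontier B.domain := by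
    intro u hu
    rcases eq_or_lt_of_le hu.2 with h | h
    · rw [h]; exact notMem_frontier_of_mem_interior hTint
    · exact hfree u ⟨hs0.le.trans hu.1, hu.2⟩
        (by rw [abs_sub_lt_iff]; constructor <;> linarith [hu.1]) h.ne
  obtain ⟨⟨C₁, hC₁, hz, hstep₁⟩, -⟩ := reaches_of_isTrajectory hr hI hIIa hIIb hIIc hIII hIV hγ h0 hE
    hcorner htan ⟨hs0, hsT.le⟩ (hnf s ⟨le_rfl, hsT.le⟩)
  obtain ⟨C₂, hC₂, -, hstep₂⟩ := exists_freeFlight (P := P) hr hI (q := (γ s).1) (p := (γ s).2)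
    (sub_pos.2 hsT) fun v hv => by
      have h2 : s + v ∈ Icc s T := ⟨by linarith [hv.1], by linarith [hv.2]⟩
      have h3 := mem_interior_of_notMem_frontier (hγ.mem_domain (s + v)
        ⟨hs0.le.trans h2.1, h2.2⟩) (hnf _ h2)
      have h4 := (hγ.free s (s + v) hs0.le h2.1 h2.2 fun u hu => hnf u
        ⟨hu.1.le, hu.2.trans h2.2⟩).2
      rwa [h4, add_sub_cancel_left] at h3
  have h1 : CkConv r (fun e (x : Phase d × ℝ) => (C₁ e x.1, x.2 - s)) (γ 0, T) :=
    (CkConv.comp_contDiff (g := C₁) (f := fun x : Phase d × ℝ => x.1) hC₁ (by fun_prop)).prodMk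
      (ContDiffAt.ckConv (f := fun x : Phase d × ℝ => x.2 - s) (by fun_prop))
  refine ⟨fun e x => C₂ e (C₁ e x.1, x.2 - s), CkConv.comp_of_eq hC₂ h1 (by simp only [hz]), ?_⟩
  have ht : Tendsto (fun x : ℝ≥0 × (Phase d × ℝ) => (x.1, x.2.1)) (𝓝 (0, (γ 0, T)))
      (𝓝 (0, γ 0)) := Continuous.tendsto (by fun_prop) _
  filter_upwards [ht.eventually hstep₁, h1.eventually_comp (by rw [hz]; exact hstep₂)] with x hx hx2
  obtain ⟨e, z, t⟩ := x
  simp only at hx hx2 ⊢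
  have h3 : FlowStep P e (t - s) (C₁ e z) (C₂ e (C₁ e z, t - s)) := by
    refine ⟨fun he => ?_, hx2.1⟩
    obtain ⟨h4, h5, h6⟩ := hx2.2 he
    subst he
    rw [h5]
    exact billiardStep_free h4.le h6
  have := hx.trans h3
  rwa [add_sub_cancel] at this

end SoftBilliard

end

theorem theorem2 {d r : ℕ} (hr : 1 ≤ r) {ι : Type*} [Finite ι]
    (B : BilliardTable d r ι) (P : PotentialData B)
    (hI : P.ConditionI) (hIIa : P.ConditionIIa) (hIIb : P.ConditionIIb) (hIIc : P.ConditionIIc)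
    (hIII : P.ConditionIII) (hIV : P.ConditionIV)
    (T : ℝ) (hT : 0 < T) (ρ₀ : Phase d) (γ : ℝ → Phase d)
    -- `γ` is the billiard trajectory of `ρ₀` on `[0, T]`, with inner end points
    (hγ : B.IsTrajectory T γ) (hγ₀ : γ 0 = ρ₀)
    (hρ₀ : ρ₀.1 ∈ interior B.domain) (hρT : (B.flow T ρ₀).1 ∈ interior B.domain)
    -- its energy lies below all barriers
    (Hstar : ℝ) (henergy : ‖ρ₀.2‖ ^ 2 / 2 = Hstar) (hH : (Hstar : EReal) < ⨅ i, P.height i)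
    -- all its collisions take place away from the corners and are not tangencies
    (hcorner : ∀ t ∈ Icc 0 T, (γ t).1 ∈ frontier B.domain → (γ t).1 ∉ P.cornerNhd)
    (htangency : ∀ t ∈ Icc 0 T, ¬ B.IsTangency γ t) :
    ∃ U : Set (Phase d), IsOpen U ∧ ρ₀ ∈ U ∧ ∃ δ > 0,
      -- the billiard flow is defined and `C^r` on `U × (T - δ, T + δ)`
      (∀ ρ ∈ U, ∀ t ∈ Ioo (T - δ) (T + δ), B.FlowDefined t ρ) ∧
      ContDiffOn ℝ r (fun z : Phase d × ℝ => B.flow z.2 z.1) (U ×ˢ Ioo (T - δ) (T + δ)) ∧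
      -- so are the Hamiltonian flows for all small `ε > 0`
      (∀ᶠ ε in 𝓝[>] (0 : ℝ),
        (∀ ρ ∈ U, ∀ t ∈ Ioo (T - δ) (T + δ), HamiltonianFlowDefined (P.V ε) t ρ) ∧
        ContDiffOn ℝ r (fun z : Phase d × ℝ => hamiltonianFlow (P.V ε) z.2 z.1)
          (U ×ˢ Ioo (T - δ) (T + δ))) ∧
      -- and they converge to the billiard flow with all derivatives up to order `r`
      ∀ k ≤ r, TendstoUniformlyOn
        (fun ε => iteratedFDeriv ℝ k
          (fun z : Phase d × ℝ => hamiltonianFlow (P.V ε) z.2 z.1))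
        (iteratedFDeriv ℝ k (fun z : Phase d × ℝ => B.flow z.2 z.1))
        (𝓝[>] 0) (U ×ˢ Ioo (T - δ) (T + δ)) := by
  subst hγ₀
  have hflow : B.flow T (γ 0) = γ T :=
    BilliardStep.flow_eq (z := γ 0) (z' := γ T) ⟨hT.le, γ, hγ, rfl, rfl⟩
  rw [hflow] at hρT
  have hE : ∀ i, ((‖(γ 0).2‖ ^ 2 / 2 : ℝ) : EReal) < P.height i := fun i => by
    rw [henergy]; exact hH.trans_le (iInf_le _ i)
  obtain ⟨C, hC, hstep⟩ := exists_flowFamily hr hI hIIa hIIb hIIc hIII hIV hT hγ hρ₀ hρT hE hcorner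
    htangency
  -- a neighbourhood with compact closure on which the family `C` converges and gives the flows
  rw [nhds_prod_eq] at hstep
  obtain ⟨pe, hpe, pz, hpz, hpp⟩ := Filter.eventually_prod_iff.1 hstep
  obtain ⟨δ, hδ, hball⟩ := Metric.nhds_basis_closedBall.eventually_iff.1 (hC.and hpz)
  set K : Set (Phase d × ℝ) := Metric.closedBall (γ 0, T) δ with hK
  have hKc : IsCompact K := isCompact_closedBall _ _
  set Ω : Set (Phase d × ℝ) := Metric.ball (γ 0) δ ×ˢ Ioo (T - δ) (T + δ) with hΩ
  have hΩo : IsOpen Ω := Metric.isOpen_ball.prod isOpen_Ioo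
  have hΩK : Ω ⊆ K := by
    rw [hΩ, hK, ← Real.ball_eq_Ioo, ball_prod_same]
    exact Metric.ball_subset_closedBall
  have hCK : ∀ y ∈ K, CkConvAt r C y := fun y hy => (hball hy).1
  have hfs : ∀ e, pe e → ∀ y ∈ K, FlowStep P e y.2 y.1 (C e y) := fun e he y hy =>
    hpp he (hball hy).2
  have hpe0 : pe 0 := hpe.self_of_nhds
  have hB : ∀ y ∈ Ω, B.flow y.2 y.1 = C 0 y := fun y hy =>
    BilliardStep.flow_eq ((hfs 0 hpe0 y (hΩK hy)).1 rfl)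
  have hsoft : ∀ᶠ ε in 𝓝[>] (0 : ℝ), (∀ y ∈ Ω, HamiltonianFlowDefined (P.V ε) y.2 y.1) ∧
      ∀ y ∈ Ω, hamiltonianFlow (P.V ε) y.2 y.1 = C ε.toNNReal y := by
    filter_upwards [eventually_nhdsGT_of_nnreal hpe, Ioc_mem_nhdsGT P.ε₀_pos] with ε hε hε₀
    have hcoe : ((ε.toNNReal : NNReal) : ℝ) = ε := Real.coe_toNNReal _ hε₀.1.le
    have hne : ε.toNNReal ≠ 0 := (Real.toNNReal_pos.2 hε₀.1).ne'
    have hham : ∀ y ∈ Ω, HamStep (P.V ε) y.2 y.1 (C ε.toNNReal y) := fun y hy => by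
      have := (hfs _ hε y (hΩK hy)).2 hne
      rwa [hcoe] at this
    refine ⟨fun y hy => (hham y hy).flowDefined, fun y hy => ?_⟩
    refine (hham y hy).flow_eq (P.continuous_V ε hε₀) ((P.contDiffOn_V ε hε₀).of_le ?_)
    exact_mod_cast Nat.succ_le_succ hr
  refine ⟨Metric.ball (γ 0) δ, Metric.isOpen_ball, Metric.mem_ball_self hδ, δ, hδ,
    fun ρ hρ t ht => ?_, ?_, ?_, fun k hk => ?_⟩
  · exact ((hfs 0 hpe0 (ρ, t) (hΩK ⟨hρ, ht⟩)).1 rfl).flowDefined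
  · exact ContDiffOn.congr (fun y hy => (hCK y (hΩK hy)).1.self_of_nhds.contDiffWithinAt) hB
  · filter_upwards [hsoft, eventually_nhdsGT_of_nnreal (eventually_contDiffAt_of_ckConvAt hKc hCK)]
      with ε hε hε'
    exact ⟨fun ρ hρ t ht => hε.1 (ρ, t) ⟨hρ, ht⟩,
      ContDiffOn.congr (fun y hy => (hε' y (hΩK hy)).contDiffWithinAt) hε.2⟩
  · -- on the open set `Ω` the derivatives of the flows are those of the family `C`
    have hder : ∀ {f g : Phase d × ℝ → Phase d}, (∀ y ∈ Ω, f y = g y) → ∀ y ∈ Ω,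
        iteratedFDeriv ℝ k f y = iteratedFDeriv ℝ k g y := fun h y hy =>
      (Filter.EventuallyEq.iteratedFDeriv ℝ
        (Filter.eventuallyEq_of_mem (hΩo.mem_nhds hy) h) k).self_of_nhds
    rw [Metric.tendstoUniformlyOn_iff]
    intro η hη
    have hu := Metric.tendstoUniformlyOn_iff.1 (tendstoUniformlyOn_of_ckConvAt hKc hCK hk) η hη
    filter_upwards [hsoft, eventually_nhdsGT_of_nnreal hu] with ε hε hε' y hy
    rw [hder hB y hy, hder hε.2 y hy]
    exact hε' y (hΩK hy)
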